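/- Let $X$ be a (thick) building of type $\tilde A_2$ of finite thickness: every edge of $X$ is contained in exactly $q+1$ triangles, with $2\le q<\infty$. Let $T$ be a $(q+1)$-regular tree with edges of length $\sqrt3/2$, and let $\Upsilon$ be the model wall-tree: the simplicial complex structure on the CAT(0) space $T\times\mathbb R$ whose vertices are the points $(t,u/2)$, with $t$ a vertex of $T$ and $u\in\mathbb Z$ of the same parity as $d_T(o,t)$ for a fixed origin $o\in T$ ($d_T$ being the graph distance), and whose simplices are the finite nonempty sets of vertices at pairwise distance at most $1$ (so that $\gamma\times\mathbb R$ is the tessellation $\Sigma$ of the plane by equilateral triangles of side $1$, for every bi-infinite geodesic $\gamma$ of $T$). By a convex subset of $\Upsilon$ we mean a nonempty, finite or infinite, convex subcomplex, i.e. the full subcomplex spanned by a nonempty set of vertices which contains every vertex lying on a geodesic of the 1-skeleton of $\Upsilon$ between two of its vertices. Distances are the Euclidean (CAT(0)) ones: those of $T\times \mathbb R$ in $\Upsilon$ and in its convex subsets, and those measured in a common apartment (copy of $\Sigma$) in $X$. A simplicial isometry $Y\to Y'$ is a simplicial map which preserves the distances between vertices and such that every simplex of $Y'$ spanned by vertices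 of the image is the image of a simplex of $Y$; $\mathrm{Isom}(Y,Y')$ is the set of these maps, with the $\sigma$-algebra generated by the sets $\{\beta\mid\beta(y)=y'\}$ for vertices $y$ of $Y$, $y'$ of $Y'$. Then for all convex subsets $Z$ of $\Upsilon$ one can choose measures $\mu_Z$ on $\mathrm{Isom}(Z,X)$ such that: 1. if $Z$ is a single vertex, $\mu_Z$ is the counting measure on $\mathrm{Isom}(Z,X)$, which is identified by evaluation with the set of vertices of $X$; 2. for every two convex subsets $Z_1,Z_2$ of $\Upsilon$ and every simplicial isometry $i:Z_1\to Z_2$, the restriction map $\mathrm{Isom}(Z_2,X)\to\mathrm{Isom}(Z_1,X)$, $\beta\mapsto\beta\circ i$, is measure-preserving; 3. each $\mu_Z$ is invariant under $\mathrm{Aut}(Z)\times\mathrm{Aut}(X)$, where $\mathrm{Aut}$ denotes the group of simplicial automorphisms and $(g,h)$ acts on $\mathrm{Isom}(Z,X)$ by $\beta\mapsto h\circ\beta\circ g^{-1}$. -/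

import Mathlib

open MeasureTheory

namespace A2Tilde

noncomputable section

/-! ### Simplicial complexes, automorphisms, simplicial isometries -/

/-- The complex on `V` whose simplices are the nonempty finite sets of points that are pairwise
equal or adjacent, for a reflexive symmetric relation `r` ("equal or adjacent"). -/
def flagComplex {V : Type*} (r : V → V → Prop) (hr : ∀ v, r v v) : AbstractSimplicialComplex V where
  faces := {s | s.Nonempty ∧ ∀ v ∈ s, ∀ w ∈ s, r v w}
  isRelLowerSet_faces := fun _ hs =>
    ⟨hs.1, fun _ hts ht => ⟨ht, fun v hv w hw => hs.2 v (hts hv) w (hts hw)⟩⟩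
  singleton_mem := fun v => ⟨Finset.singleton_nonempty v, by simp [hr]⟩

/-- A simplicial automorphism: a bijection of the vertices that preserves simplices in both
directions. -/
structure SimplicialAut {V : Type*} (K : AbstractSimplicialComplex V) where
  toEquiv : V ≃ V
  map_mem_iff : ∀ s : Finset V, s.map toEquiv.toEmbedding ∈ K.faces ↔ s ∈ K.faces

/-- The 1-skeleton. -/
def skeleton {V : Type*} (K : AbstractSimplicialComplex V) : SimpleGraph V where
  Adj v w := v ≠ w ∧ ∃ s ∈ K.faces, v ∈ s ∧ w ∈ s
  symm := ⟨fun _ _ h => ⟨h.1.symm, h.2.imp fun _ hs => ⟨hs.1, hs.2.2, hs.2.1⟩⟩⟩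
  loopless := ⟨fun _ h => h.1 rfl⟩

/-- A simplicial complex together with a distance function on its vertices. -/
structure MetricComplex (V : Type*) extends AbstractSimplicialComplex V where
  dist : V → V → ℝ

/-- The full subcomplex spanned by a set of vertices, with the restricted distance. -/
def MetricComplex.restrict {V : Type*} (K : MetricComplex V) (Z : Set V) : MetricComplex Z where
  faces := {s | s.map (Function.Embedding.subtype (· ∈ Z)) ∈ K.faces}
  isRelLowerSet_faces := fun s hs => by
    refine ⟨Finset.map_nonempty.1 (K.isRelLowerSet_faces hs).1, fun t hts ht => ?_⟩
    exact (K.isRelLowerSet_faces hs).2 (Finset.map_subset_map.2 hts) (Finset.map_nonempty.2 ht)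
  singleton_mem := fun v => by
    simpa using K.singleton_mem (v : V)
  dist v w := K.dist v w

open Classical in
/-- A simplicial isometry `K → L`: a map of the vertices that sends simplices to simplices, preserves
the distance between vertices (in particular it is injective), and for which every simplex of `L`
spanned by vertices of the image is itself the image of a simplex of `K`. -/
@[ext]
structure Isom {V W : Type*} (K : MetricComplex V) (L : MetricComplex W) where
  toFun : V → W
  dist_eq : ∀ v w, L.dist (toFun v) (toFun w) = K.dist v w
  image_mem_iff : ∀ s : Finset V, s.image toFun ∈ L.faces ↔ s ∈ K.faces

/-- Composition of simplicial isometries; for `i : Z₁ → Z₂`, the map `β ↦ β.comp i` is the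
restriction map `Isom(Z₂, X) → Isom(Z₁, X)`. -/
def Isom.comp {U V W : Type*} {J : MetricComplex U} {K : MetricComplex V} {L : MetricComplex W}
    (β : Isom K L) (i : Isom J K) : Isom J L where
  toFun := β.toFun ∘ i.toFun
  dist_eq := fun v w => (β.dist_eq _ _).trans (i.dist_eq v w)
  image_mem_iff := fun s => by
    classical
    rw [← i.image_mem_iff s, ← β.image_mem_iff, Finset.image_image]

/-- The σ-algebra on `Isom K L` generated by the sets `{β | β v = w}`: for countable complexes, the
Borel σ-algebra of the topology of pointwise convergence. -/
instance Isom.measurableSpace {V W : Type*} (K : MetricComplex V) (L : MetricComplex W) :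
    MeasurableSpace (Isom K L) :=
  ⨆ v : V, MeasurableSpace.comap (fun β : Isom K L => β.toFun v) ⊤

/-! ### The model apartment and buildings -/

/-- The squared Euclidean length of `m e₁ + n e₂`, where `e₁, e₂` are unit vectors of the plane at
angle `π / 3`. -/
def latticeSqNorm (a : ℤ × ℤ) : ℤ := a.1 ^ 2 + a.1 * a.2 + a.2 ^ 2

/-- The model apartment: the tessellation of the Euclidean plane by equilateral triangles of side 1,
the vertex `(m, n)` being the point `m e₁ + n e₂`. Two vertices are adjacent when they are at
distance 1. -/
def modelApartment : MetricComplex (ℤ × ℤ) where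
  toAbstractSimplicialComplex :=
    flagComplex (fun a b => latticeSqNorm (a - b) ≤ 1) (by simp [latticeSqNorm])
  dist a b := Real.sqrt (latticeSqNorm (a - b))

/-- A simplicial isomorphism of the model apartment onto a subcomplex of `X`. -/
structure ApartmentEmbedding {V : Type*} (X : AbstractSimplicialComplex V)
    extends (ℤ × ℤ) ↪ V where
  map_mem : ∀ s ∈ modelApartment.faces, s.map toEmbedding ∈ X.faces

/-- The set of simplices of the image of the model apartment. -/
def ApartmentEmbedding.imageFaces {V : Type*} {X : AbstractSimplicialComplex V}
    (φ : ApartmentEmbedding X) : Set (Finset V) :=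
  (fun s => s.map φ.toEmbedding) '' modelApartment.faces

/-- The triangles of `X` that contain the edge `e`. -/
def trianglesAt {V : Type*} (X : AbstractSimplicialComplex V) (e : Finset V) : Set (Finset V) :=
  {t | t ∈ X.faces ∧ t.card = 3 ∧ e ⊆ t}

/-- `𝒜` is a system of apartments that makes `X` a (thick) building of type `Ã₂`. A subcomplex is
given by its set of simplices. -/
structure IsApartmentSystem {V : Type*} (X : AbstractSimplicialComplex V)
    (𝒜 : Set (Set (Finset V))) : Prop where
  /-- every apartment is a copy of the model apartment -/
  copy : ∀ A ∈ 𝒜, ∃ φ : ApartmentEmbedding X, φ.imageFaces = A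
  /-- any two simplices lie in a common apartment -/
  common : ∀ s ∈ X.faces, ∀ t ∈ X.faces, ∃ A ∈ 𝒜, s ∈ A ∧ t ∈ A
  /-- for any two apartments `A`, `A'` there is an isomorphism `A → A'` (written `φ' ∘ φ⁻¹` with
  parametrizations `φ` of `A` and `φ'` of `A'`) that fixes `A ∩ A'` pointwise -/
  iso : ∀ A ∈ 𝒜, ∀ A' ∈ 𝒜, ∃ φ φ' : ApartmentEmbedding X,
    φ.imageFaces = A ∧ φ'.imageFaces = A' ∧
      ∀ a : ℤ × ℤ, {φ.toFun a} ∈ A' → φ'.toFun a = φ.toFun a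
  /-- every edge is contained in at least three triangles -/
  thick : ∀ e ∈ X.faces, e.card = 2 → 3 ≤ (trianglesAt X e).encard

/-- Buildings of type `Ã₂`. -/
def IsBuilding {V : Type*} (X : AbstractSimplicialComplex V) : Prop :=
  ∃ 𝒜 : Set (Set (Finset V)), IsApartmentSystem X 𝒜

/-- `X` has finite thickness `q + 1`: every edge lies in finitely many triangles, and `q + 1` is the
number of triangles at some edge (in a building this number is the same for all edges). -/
def HasThickness {V : Type*} (X : AbstractSimplicialComplex V) (q : ℕ) : Prop :=
  (∀ e ∈ X.faces, e.card = 2 → (trianglesAt X e).Finite) ∧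
    ∃ e ∈ X.faces, e.card = 2 ∧ (trianglesAt X e).ncard = q + 1

/-- The Euclidean (CAT(0)) distance between two vertices of a building: the distance measured in an
embedded copy of the model apartment that contains both of them. In a building such a copy exists
and the value does not depend on it, so that the infimum is over a one-point set. -/
def euclDist {V : Type*} (X : AbstractSimplicialComplex V) (x y : V) : ℝ :=
  sInf {r | ∃ (φ : ApartmentEmbedding X) (a b : ℤ × ℤ),
    φ.toFun a = x ∧ φ.toFun b = y ∧ r = modelApartment.dist a b}

/-- A building with its Euclidean distance. -/
def buildingComplex {V : Type*} (X : AbstractSimplicialComplex V) : MetricComplex V where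
  toAbstractSimplicialComplex := X
  dist := euclDist X

/-! ### The model wall-tree -/

/-- The vertices of the model wall-tree over the tree `T` with origin `o`: the pair `(t, u)` stands
for the point `(t, u / 2)` of `T × ℝ`; it is a vertex when `u` has the parity of `d(o, t)`. -/
def WallTreeVertex {V : Type*} (T : SimpleGraph V) (o : V) : Type _ :=
  {p : V × ℤ // Even (p.2 - (T.dist o p.1 : ℤ))}

/-- Four times the squared distance in `T × ℝ`, when the edges of `T` have length `√3 / 2`. -/
def wallTreeSqDist {V : Type*} (T : SimpleGraph V) (o : V) (p p' : WallTreeVertex T o) : ℤ :=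
  3 * (T.dist p.1.1 p'.1.1 : ℤ) ^ 2 + (p.1.2 - p'.1.2) ^ 2

/-- The model wall-tree, with the distance of `T × ℝ`. Vertices are adjacent when they are at
distance 1; so the triangles are the sets `{(t, u), (t, u + 2), (t', u + 1)}` with `t`, `t'`
adjacent in `T`, and the part over every bi-infinite geodesic of `T` is a copy of the model
apartment. -/
def wallTree {V : Type*} (T : SimpleGraph V) (o : V) : MetricComplex (WallTreeVertex T o) where
  toAbstractSimplicialComplex :=
    flagComplex (fun p p' => wallTreeSqDist T o p p' ≤ 4) (by simp [wallTreeSqDist])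
  dist p p' := Real.sqrt (wallTreeSqDist T o p p') / 2

/-- Nonempty convex subcomplexes of the model wall-tree, given by their vertex sets: the set contains
every vertex that lies on a geodesic of the 1-skeleton between two of its vertices. (The full
subcomplexes they span are exactly the convex subcomplexes of the CAT(0) space `T × ℝ`.) -/
structure ConvexSubset {V : Type*} (T : SimpleGraph V) (o : V) where
  verts : Set (WallTreeVertex T o)
  nonempty : verts.Nonempty
  convex : ∀ x ∈ verts, ∀ y ∈ verts, ∀ w,
    (skeleton (wallTree T o).toAbstractSimplicialComplex).dist x w +
      (skeleton (wallTree T o).toAbstractSimplicialComplex).dist w y =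
      (skeleton (wallTree T o).toAbstractSimplicialComplex).dist x y → w ∈ verts

/-- A convex subset as a complex, with the distance of the model wall-tree. -/
def ConvexSubset.complex {V : Type*} {T : SimpleGraph V} {o : V} (Z : ConvexSubset T o) :
    MetricComplex Z.verts :=
  (wallTree T o).restrict Z.verts

end

end A2Tilde

namespace A2Tilde

/-! ### The triangular lattice -/

/-! The mass of a cylinder is prescribed by a count. For a finite convex set `F` in `Z` and a vertex
`p` of `F`, let `n` be the number of isometric maps from `F` to `X` with a given value at `p`. Once
`n` is known to depend on `F` only, one asks that the maps with a given restriction to `F` have mass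
`n⁻¹` (`IsEquidistributed`). At most one measure satisfies this for all `F`
(`IsEquidistributed.unique`). Since the condition only involves the geometry of `F`, uniqueness
yields compatibility with restrictions and automorphisms (`IsEquidistributed.measurePreserving`);
counting measure is the case `n = 1`. It remains to make isometries countable, to show that the
counts are constant, and to construct the measures.

From metric to local conditions. The 1-skeletons of the building and of the wall-tree are both a
`FlatGraph`: a vertex and a triangle always lie in a convex isometric copy of the triangular
lattice. For the building this follows from retractions onto apartments (`exists_retraction`), for
the wall-tree from lines in the tree (`line_isFlat`). In such a graph the position of `z` with
respect to `u` can be read at a neighbour `y` of `z` closer to `u`, from the neighbours of `y` that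
are closer to `u` and from link distances at `y` (`FlatGraph.downSet_of_upStep`). Hence maps of
convex sets that preserve link distances preserve graph distances and closer neighbours
(`LocIsomOn.dist_downSet`), and the Euclidean distance is a function of these (`SqDist`).
Conversely, link distances are recognised by the squared distances 1, 3, 4. So simplicial isometries
of convex sets are the same as local isometries (`LocIsomOn`).

Constancy. Links have no cycles shorter than six and diameter three (`opp_of_path`,
`exists_isMid_of_opp`), and all edges lie in `q + 1` triangles (`ncard_const`). Therefore a local
isometry has a constant number of extensions to one more vertex in four situations:
`extNum_isolated`, `extNum_end`, `extNum_edge` and `extNum_corner`. Any finite convex set can be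
reduced to a given nonempty convex subset by undoing such additions: slanted rows, highest or lowest
vertices, and leaf columns are removed (`hasConvexStep`). This proves `exists_extNum`. Counting
through an edge shows that the base point does not matter (`extNum_basePoint`).

Construction. Exhaust `Z` by balls, extend from each ball to the next by independent uniform
choices, and sum over all images of the centre (`exists_isEquidistributed`). Multiplicativity of the
counts carries the prescribed masses from balls to all finite convex sets
(`isEquidistributed_of_ball`). -/

/-- The graph distance from the origin in the triangular lattice. -/
def hexDist (a : ℤ × ℤ) : ℕ := max (max a.1.natAbs a.2.natAbs) (a.1 + a.2).natAbs

/-- The six lattice vectors of length one. -/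
def hexDirs : Finset (ℤ × ℤ) := {(1, 0), (0, 1), (-1, 1), (-1, 0), (0, -1), (1, -1)}

lemma mem_hexDirs_iff (a : ℤ × ℤ) : a ∈ hexDirs ↔ hexDist a = 1 := by
  obtain ⟨m, n⟩ := a
  simp only [hexDirs, hexDist, Finset.mem_insert, Finset.mem_singleton, Prod.mk.injEq]
  omega

lemma hexDist_eq_zero (a : ℤ × ℤ) : hexDist a = 0 ↔ a = 0 := by
  obtain ⟨m, n⟩ := a
  simp only [hexDist, Prod.mk_eq_zero]; omega

/-- Rotation of the lattice by `π / 3`. -/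
def hexRot : ℤ × ℤ ≃+ ℤ × ℤ where
  toFun a := (-a.2, a.1 + a.2)
  invFun a := (a.1 + a.2, -a.1)
  left_inv a := by ext <;> simp
  right_inv a := by ext <;> simp
  map_add' a b := by ext <;> simp <;> ring

/-- Every nonzero lattice vector is the image of a vector of a fixed sector under a linear
isometry. -/
lemma exists_sector (a : ℤ × ℤ) (ha : a ≠ 0) : ∃ e : ℤ × ℤ ≃+ ℤ × ℤ,
    (∀ x, hexDist (e x) = hexDist x) ∧ (∀ x, latticeSqNorm (e x) = latticeSqNorm x) ∧
    ∃ m n : ℤ, 0 < m ∧ 0 ≤ n ∧ e (m, n) = a := by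
  -- It suffices to treat the rotated vector. The sector `0 < m`, `0 ≤ n` is a half-open angle of `π
  -- / 3`, so at most five rotations reach it.
  have step : ∀ b : ℤ × ℤ, (∃ e : ℤ × ℤ ≃+ ℤ × ℤ,
      (∀ x, hexDist (e x) = hexDist x) ∧ (∀ x, latticeSqNorm (e x) = latticeSqNorm x) ∧
      ∃ m n : ℤ, 0 < m ∧ 0 ≤ n ∧ e (m, n) = hexRot b) → ∃ e : ℤ × ℤ ≃+ ℤ × ℤ,
      (∀ x, hexDist (e x) = hexDist x) ∧ (∀ x, latticeSqNorm (e x) = latticeSqNorm x) ∧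
      ∃ m n : ℤ, 0 < m ∧ 0 ≤ n ∧ e (m, n) = b := by
    rintro b ⟨e, h1, h2, m, n, hm, hn, hb⟩
    refine ⟨e.trans hexRot.symm, fun x => ?_, fun x => ?_, m, n, hm, hn, by simp [hb]⟩
    · rw [← h1 x]
      simp only [hexDist, hexRot, AddEquiv.trans_apply, AddEquiv.symm_mk, AddEquiv.coe_mk,
        Equiv.coe_fn_symm_mk]
      omega
    · rw [← h2 x]
      simp only [latticeSqNorm, hexRot, AddEquiv.trans_apply, AddEquiv.symm_mk, AddEquiv.coe_mk,
        Equiv.coe_fn_symm_mk]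
      ring
  have base : ∀ b : ℤ × ℤ, 0 < b.1 → 0 ≤ b.2 → ∃ e : ℤ × ℤ ≃+ ℤ × ℤ,
      (∀ x, hexDist (e x) = hexDist x) ∧ (∀ x, latticeSqNorm (e x) = latticeSqNorm x) ∧
      ∃ m n : ℤ, 0 < m ∧ 0 ≤ n ∧ e (m, n) = b := fun b h1 h2 =>
    ⟨AddEquiv.refl _, fun _ => rfl, fun _ => rfl, b.1, b.2, h1, h2, rfl⟩
  have ha' : a.1 ≠ 0 ∨ a.2 ≠ 0 := by
    by_contra h; push Not at h; exact ha (Prod.ext h.1 h.2)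
  by_cases c0 : 0 < a.1 ∧ 0 ≤ a.2
  · exact base a c0.1 c0.2
  apply step
  by_cases c1 : 0 < (hexRot a).1 ∧ 0 ≤ (hexRot a).2
  · exact base _ c1.1 c1.2
  apply step
  by_cases c2 : 0 < (hexRot (hexRot a)).1 ∧ 0 ≤ (hexRot (hexRot a)).2
  · exact base _ c2.1 c2.2
  apply step
  by_cases c3 : 0 < (hexRot (hexRot (hexRot a))).1 ∧ 0 ≤ (hexRot (hexRot (hexRot a))).2
  · exact base _ c3.1 c3.2
  apply step
  by_cases c4 : 0 < (hexRot (hexRot (hexRot (hexRot a)))).1 ∧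
      0 ≤ (hexRot (hexRot (hexRot (hexRot a)))).2
  · exact base _ c4.1 c4.2
  apply step
  apply base <;> simp [hexRot] at * <;> omega

/-! ### Flats in graphs -/

section Flats

variable {V : Type*} {G : SimpleGraph V}

/-- The neighbours of `y` that are closer to `u`. -/
def downSet (G : SimpleGraph V) (u y : V) : Set V := {c | G.Adj y c ∧ G.dist u c + 1 = G.dist u y}

/-- Two neighbours `c`, `z` of `y` that are at distance at least three in the link of `y`. -/
def Opp (G : SimpleGraph V) (y c z : V) : Prop :=
  c ≠ z ∧ ¬ G.Adj c z ∧ ∀ w, G.Adj y w → G.Adj c w → ¬ G.Adj w z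

/-- `w` is the midpoint of two neighbours `c`, `z` of `y` at distance two in the link of `y`. -/
def IsMid (G : SimpleGraph V) (y c z w : V) : Prop :=
  c ≠ z ∧ ¬ G.Adj c z ∧ G.Adj y w ∧ G.Adj c w ∧ G.Adj w z

/-- A convex isometric copy of the triangular lattice. -/
structure IsFlat (G : SimpleGraph V) (φ : ℤ × ℤ → V) : Prop where
  dist_eq : ∀ a b, G.dist (φ a) (φ b) = hexDist (b - a)
  convex : ∀ a b w, G.dist (φ a) w + G.dist w (φ b) = G.dist (φ a) (φ b) → w ∈ Set.range φ

/-- A connected graph in which every vertex and every triangle (or edge) lie in a common flat. -/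
structure FlatGraph (G : SimpleGraph V) : Prop where
  connected : G.Connected
  exists_flat : ∀ u x y z, G.Adj x y → (z = y ∨ (G.Adj x z ∧ G.Adj y z)) →
    ∃ φ, IsFlat G φ ∧ u ∈ Set.range φ ∧ x ∈ Set.range φ ∧ y ∈ Set.range φ ∧ z ∈ Set.range φ

lemma Opp.symm {y c z : V} (h : Opp G y c z) : Opp G y z c :=
  ⟨h.1.symm, fun h' => h.2.1 h'.symm, fun w h1 h2 h3 => h.2.2 w h1 h3.symm h2.symm⟩

lemma IsMid.symm {y c z w : V} (h : IsMid G y c z w) : IsMid G y z c w :=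
  ⟨h.1.symm, fun h' => h.2.1 h'.symm, h.2.2.1, h.2.2.2.2.symm, h.2.2.2.1.symm⟩

lemma opp_or_isMid {y c z : V} (h1 : c ≠ z) (h2 : ¬ G.Adj c z) :
    Opp G y c z ∨ ∃ w, IsMid G y c z w := by
  by_cases h : ∃ w, IsMid G y c z w
  · exact Or.inr h
  · refine Or.inl ⟨h1, h2, fun w h3 h4 h5 => h ⟨w, h1, h2, h3, h4, h5⟩⟩

lemma Opp.not_isMid {y c z w : V} (h : Opp G y c z) : ¬ IsMid G y c z w :=
  fun h' => h.2.2 w h'.2.2.1 h'.2.2.2.1 h'.2.2.2.2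

/-! ### Links and closer neighbours in the coordinates of a flat -/

namespace IsFlat

variable {φ : ℤ × ℤ → V}

lemma comp (h : IsFlat G φ) (e : ℤ × ℤ ≃ ℤ × ℤ)
    (he : ∀ a b, hexDist (e b - e a) = hexDist (b - a)) : IsFlat G (φ ∘ e) where
  dist_eq a b := by simp [h.dist_eq, he]
  convex a b w hw := by
    obtain ⟨c, hc⟩ := h.convex _ _ w hw
    exact ⟨e.symm c, by simpa using hc⟩

lemma adj_iff (h : IsFlat G φ) (a b : ℤ × ℤ) : G.Adj (φ a) (φ b) ↔ b - a ∈ hexDirs := by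
  rw [← SimpleGraph.dist_eq_one_iff_adj, h.dist_eq, mem_hexDirs_iff]

lemma injective (h : IsFlat G φ) : Function.Injective φ := fun a b hab => by
  have := h.dist_eq a b
  rw [hab, SimpleGraph.dist_self, eq_comm, hexDist_eq_zero, sub_eq_zero] at this
  exact this.symm

lemma eq_iff (h : IsFlat G φ) {a b : ℤ × ℤ} : φ a = φ b ↔ a = b := h.injective.eq_iff

/-- The two vertices of the flat are at distance exactly two, so their common neighbour is on a
geodesic and convexity of the flat applies. -/
lemma mem_range_of_adj_of_adj (h : IsFlat G φ) {a b : ℤ × ℤ} {w : V} (hab : a ≠ b)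
    (hn : ¬ G.Adj (φ a) (φ b)) (h1 : G.Adj (φ a) w) (h2 : G.Adj w (φ b)) :
    w ∈ Set.range φ := by
  apply h.convex a b
  rw [SimpleGraph.dist_eq_one_iff_adj.2 h1, SimpleGraph.dist_eq_one_iff_adj.2 h2]
  have := G.dist_le (SimpleGraph.Walk.cons h1 (SimpleGraph.Walk.cons h2 SimpleGraph.Walk.nil))
  rw [adj_iff h, mem_hexDirs_iff, ← h.dist_eq] at hn
  have h0 : G.dist (φ a) (φ b) ≠ 0 := by
    rw [h.dist_eq, Ne, hexDist_eq_zero, sub_eq_zero]; exact hab.symm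
  simp only [SimpleGraph.Walk.length_cons, SimpleGraph.Walk.length_nil] at this
  omega

/-- A midpoint is a common neighbour of two non-adjacent vertices of the flat and hence lies in the
flat; the rest is a check over the six directions. -/
lemma isMid_iff (h : IsFlat G φ) (a : ℤ × ℤ) {ε δ : ℤ × ℤ} (hε : ε ∈ hexDirs) (hδ : δ ∈ hexDirs)
    (w : V) : IsMid G (φ a) (φ (a + ε)) (φ (a + δ)) w ↔
      (ε + δ ∈ hexDirs ∧ w = φ (a + (ε + δ))) := by
  have key : ∀ ε ∈ hexDirs, ∀ δ ∈ hexDirs, ∀ η ∈ hexDirs, ε ≠ δ → δ - ε ∉ hexDirs →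
      η - ε ∈ hexDirs → δ - η ∈ hexDirs → η = ε + δ := by decide
  have key2 : ∀ ε ∈ hexDirs, ∀ δ ∈ hexDirs, ε + δ ∈ hexDirs → ε ≠ δ ∧ δ - ε ∉ hexDirs := by
    decide
  constructor
  · rintro ⟨h1, h2, h3, h4, h5⟩
    obtain ⟨b, rfl⟩ := h.mem_range_of_adj_of_adj (fun h' => h1 (by rw [h'])) h2 h4 h5
    rw [adj_iff h] at h2 h3 h4 h5
    have hb : b = a + (b - a) := by abel
    rw [Ne, h.eq_iff] at h1
    have := key ε hε δ hδ (b - a) h3 (fun h' => h1 (by rw [h'])) (by rwa [add_sub_add_left_eq_sub] at h2)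
      (by convert h4 using 1; abel) (by convert h5 using 1; abel)
    rw [← this]
    exact ⟨h3, by rw [← hb]⟩
  · rintro ⟨h1, rfl⟩
    obtain ⟨h2, h3⟩ := key2 ε hε δ hδ h1
    refine ⟨?_, ?_, ?_, ?_, ?_⟩
    · rw [Ne, h.eq_iff]; simpa using h2
    · rw [adj_iff h]; convert h3 using 2; abel
    · rw [adj_iff h]; convert h1 using 1; abel
    · rw [adj_iff h]; convert hδ using 1; abel
    · have : ∀ ε ∈ hexDirs, -ε ∈ hexDirs := by decide
      rw [adj_iff h]; convert this ε hε using 1; abel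

/-- By `isMid_iff` no vertex outside the flat can shorten link distances between directions of the
flat, so opposition is that of the hexagon. -/
lemma opp_iff (h : IsFlat G φ) (a : ℤ × ℤ) {ε δ : ℤ × ℤ} (hε : ε ∈ hexDirs) (hδ : δ ∈ hexDirs) :
    Opp G (φ a) (φ (a + ε)) (φ (a + δ)) ↔ δ = -ε := by
  have key : ∀ ε ∈ hexDirs, ∀ δ ∈ hexDirs, (ε ≠ δ ∧ δ - ε ∉ hexDirs ∧ ε + δ ∉ hexDirs) ↔ δ = -ε := by
    decide
  rw [← key ε hε δ hδ]
  have e1 : φ (a + ε) ≠ φ (a + δ) ↔ ε ≠ δ := by rw [Ne, h.eq_iff]; simp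
  have e2 : G.Adj (φ (a + ε)) (φ (a + δ)) ↔ δ - ε ∈ hexDirs := by
    rw [adj_iff h, add_sub_add_left_eq_sub]
  constructor
  · intro ho
    exact ⟨e1.1 ho.1, fun h' => ho.2.1 (e2.2 h'), fun h' =>
      ho.not_isMid ((h.isMid_iff a hε hδ _).2 ⟨h', rfl⟩)⟩
  · rintro ⟨h1, h2, h3⟩
    rcases opp_or_isMid (y := φ a) (e1.2 h1) (fun h' => h2 (e2.1 h')) with h4 | ⟨w, h4⟩
    · exact h4
    · exact absurd ((h.isMid_iff a hε hδ _).1 h4).1 h3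

lemma exists_dir_of_adj (h : IsFlat G φ) {a : ℤ × ℤ} {x : V} (hx : x ∈ Set.range φ)
    (hadj : G.Adj (φ a) x) : ∃ ε ∈ hexDirs, x = φ (a + ε) := by
  obtain ⟨b, rfl⟩ := hx
  rw [adj_iff h] at hadj
  exact ⟨b - a, hadj, by congr 1; abel⟩

lemma adj_dir (h : IsFlat G φ) (a : ℤ × ℤ) {ε : ℤ × ℤ} (hε : ε ∈ hexDirs) :
    G.Adj (φ a) (φ (a + ε)) := by
  rw [adj_iff h]; simpa using hε

lemma adj_dirs_iff (h : IsFlat G φ) (a ε δ : ℤ × ℤ) :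
    G.Adj (φ (a + ε)) (φ (a + δ)) ↔ δ - ε ∈ hexDirs := by
  rw [adj_iff h, add_sub_add_left_eq_sub]

lemma mem_downSet_iff (h : IsFlat G φ) (a : ℤ × ℤ) (c : V) :
    c ∈ downSet G (φ 0) (φ a) ↔
      ∃ ε ∈ hexDirs, hexDist (a + ε) + 1 = hexDist a ∧ c = φ (a + ε) := by
  constructor
  · rintro ⟨h1, h2⟩
    have : c ∈ Set.range φ := by
      apply h.convex 0 a
      rw [← h2, SimpleGraph.dist_eq_one_iff_adj.2 h1.symm]
    obtain ⟨ε, hε, rfl⟩ := h.exists_dir_of_adj this h1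
    rw [h.dist_eq, h.dist_eq, sub_zero, sub_zero] at h2
    exact ⟨ε, hε, h2, rfl⟩
  · rintro ⟨ε, hε, h1, rfl⟩
    refine ⟨h.adj_dir a hε, ?_⟩
    rw [h.dist_eq, h.dist_eq, sub_zero, sub_zero, h1]

/-- Together with `downSet_interior` this is the dichotomy on which the recursion rests: one closer
neighbour in an edge direction, two in all other directions. -/
lemma downSet_axis (h : IsFlat G φ) {m : ℤ} (hm : 0 < m) :
    downSet G (φ 0) (φ (m, 0)) = {φ (m - 1, 0)} := by
  ext c
  rw [h.mem_downSet_iff]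
  simp only [hexDirs, Finset.mem_insert, Finset.mem_singleton, exists_eq_or_imp,
    exists_eq_left, hexDist, Prod.mk_add_mk, Set.mem_singleton_iff]
  constructor
  · rintro (⟨h1, -⟩ | ⟨h1, -⟩ | ⟨h1, -⟩ | ⟨h1, h2⟩ | ⟨h1, -⟩ | ⟨h1, -⟩)
    · omega
    · omega
    · omega
    · rw [h2]; congr 1
    · omega
    · omega
  · rintro rfl
    right; right; right; left
    exact ⟨by omega, by congr 1⟩

lemma downSet_interior (h : IsFlat G φ) {m n : ℤ} (hm : 0 < m) (hn : 0 < n) :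
    downSet G (φ 0) (φ (m, n)) = {φ (m - 1, n), φ (m, n - 1)} := by
  ext c
  rw [h.mem_downSet_iff]
  simp only [hexDirs, Finset.mem_insert, Finset.mem_singleton, exists_eq_or_imp,
    exists_eq_left, hexDist, Prod.mk_add_mk, Set.mem_singleton_iff, Set.mem_insert_iff]
  constructor
  · rintro (⟨h1, -⟩ | ⟨h1, -⟩ | ⟨h1, -⟩ | ⟨h1, h2⟩ | ⟨h1, h2⟩ | ⟨h1, -⟩)
    · omega
    · omega
    · omega
    · left; rw [h2]; congr 1; simp [sub_eq_add_neg]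
    · right; rw [h2]; congr 1; simp [sub_eq_add_neg]
    · omega
  · rintro (rfl | rfl)
    · right; right; right; left
      exact ⟨by omega, by congr 1; simp [sub_eq_add_neg]⟩
    · right; right; right; right; left
      exact ⟨by omega, by congr 1; simp [sub_eq_add_neg]⟩

end IsFlat

namespace FlatGraph

lemma exists_flat_center (hG : FlatGraph G) (u x y z : V) (hxy : G.Adj x y)
    (hz : z = y ∨ (G.Adj x z ∧ G.Adj y z)) :
    ∃ φ, IsFlat G φ ∧ φ 0 = x ∧ u ∈ Set.range φ ∧ y ∈ Set.range φ ∧ z ∈ Set.range φ := by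
  obtain ⟨φ, hφ, hu, ⟨a, hx⟩, hy, hz⟩ := hG.exists_flat u x y z hxy hz
  have hs : Set.range (φ ∘ (Equiv.addRight a)) = Set.range φ := EquivLike.range_comp φ (Equiv.addRight a)
  refine ⟨φ ∘ (Equiv.addRight a), hφ.comp _ (fun b c => by simp), by simp [hx], ?_⟩
  rw [hs]
  exact ⟨hu, hy, hz⟩

/-- A vertex and an edge not at that vertex lie in a flat, in normal position. -/
lemma exists_flat_sector (hG : FlatGraph G) {u y z : V} (huy : u ≠ y) (hyz : G.Adj y z) :
    ∃ φ, IsFlat G φ ∧ φ 0 = u ∧ ∃ m n : ℤ, 0 < m ∧ 0 ≤ n ∧ φ (m, n) = y ∧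
      ∃ ε ∈ hexDirs, z = φ ((m, n) + ε) := by
  obtain ⟨φ, hφ, ⟨a, ha⟩, ⟨b, hb⟩, hz, -⟩ := hG.exists_flat u y z z hyz (Or.inl rfl)
  have hab : b - a ≠ 0 := fun h => huy (by rw [← ha, ← hb, sub_eq_zero.1 h])
  obtain ⟨e, h1, h2, m, n, hm, hn, hmn⟩ := exists_sector (b - a) hab
  have hflat : IsFlat G (φ ∘ (e.toEquiv.trans (Equiv.addRight a))) :=
    hφ.comp _ (fun x y => by simp [← map_sub, h1])
  have hy : (φ ∘ (e.toEquiv.trans (Equiv.addRight a))) (m, n) = y := by simp [hmn, hb]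
  have hs : Set.range (φ ∘ (e.toEquiv.trans (Equiv.addRight a))) = Set.range φ :=
    EquivLike.range_comp φ (e.toEquiv.trans (Equiv.addRight a))
  refine ⟨_, hflat, by simp [ha], m, n, hm, hn, hy, ?_⟩
  apply hflat.exists_dir_of_adj
  · rw [hs]; exact hz
  · rw [hy]; exact hyz

/-! #### Links -/

/-- Links have no 4-cycles: in a flat through `x`, `c`, `z` the midpoint is determined by the two
directions. -/
lemma isMid_unique (hG : FlatGraph G) {c x z m m' : V} (hx : G.Adj c x) (hz : G.Adj c z)
    (h : IsMid G c x z m) (h' : IsMid G c x z m') : m = m' := by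
  obtain ⟨φ, hφ, rfl, hx', hz', -⟩ := hG.exists_flat_center x c z z hz (Or.inl rfl)
  obtain ⟨ε, hε, rfl⟩ := hφ.exists_dir_of_adj hx' hx
  obtain ⟨δ, hδ, rfl⟩ := hφ.exists_dir_of_adj hz' hz
  rw [hφ.isMid_iff 0 hε hδ] at h h'
  rw [h.2, h'.2]

/-- There are no complete subgraphs on four vertices. -/
lemma not_adj_of_path (hG : FlatGraph G) {c x m y : V} (hx : G.Adj c x) (hm : G.Adj c m)
    (hy : G.Adj c y) (hxm : G.Adj x m) (hmy : G.Adj m y) : ¬ G.Adj x y := by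
  intro h
  obtain ⟨φ, hφ, rfl, hm', hx', hy'⟩ := hG.exists_flat_center m c x y hx (Or.inr ⟨hy, h⟩)
  obtain ⟨ε, hε, rfl⟩ := hφ.exists_dir_of_adj hx' hx
  obtain ⟨δ, hδ, rfl⟩ := hφ.exists_dir_of_adj hm' hm
  obtain ⟨η, hη, rfl⟩ := hφ.exists_dir_of_adj hy' hy
  rw [hφ.adj_dirs_iff] at hxm hmy h
  have key3 : ∀ ε ∈ hexDirs, ∀ δ ∈ hexDirs, ∀ η ∈ hexDirs, δ - ε ∈ hexDirs → η - δ ∈ hexDirs →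
      η - ε ∉ hexDirs := by decide
  exact key3 ε hε δ hδ η hη hxm hmy h

/-- Non-backtracking paths of length three in a link are geodesic. A flat through `x` and the
triangle `c`, `y`, `v` also contains the midpoint `m`, so the path is half of the hexagon of
directions at `c`. -/
lemma opp_of_path (hG : FlatGraph G) {c x m y v : V} (hx : G.Adj c x) (hm : G.Adj c m)
    (hy : G.Adj c y) (hv : G.Adj c v) (hxm : G.Adj x m) (hmy : G.Adj m y) (hyv : G.Adj y v)
    (hxy : x ≠ y) (hmv : m ≠ v) : Opp G c x v := by
  have key2 : ∀ ε ∈ hexDirs, ∀ η ∈ hexDirs, ∀ κ ∈ hexDirs, ε + η ∈ hexDirs → κ - η ∈ hexDirs →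
      ε + η ≠ κ → κ = -ε := by decide
  have hnxy : ¬ G.Adj x y := hG.not_adj_of_path hx hm hy hxm hmy
  obtain ⟨φ, hφ, rfl, hx', hy', hv'⟩ := hG.exists_flat_center x c y v hy (Or.inr ⟨hv, hyv⟩)
  obtain ⟨ε, hε, rfl⟩ := hφ.exists_dir_of_adj hx' hx
  obtain ⟨η, hη, rfl⟩ := hφ.exists_dir_of_adj hy' hy
  obtain ⟨κ, hκ, rfl⟩ := hφ.exists_dir_of_adj hv' hv
  obtain ⟨h1, rfl⟩ := (hφ.isMid_iff 0 hε hη m).1 ⟨hxy, hnxy, hm, hxm, hmy⟩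
  rw [hφ.opp_iff 0 hε hκ]
  rw [hφ.adj_dirs_iff] at hyv
  exact key2 ε hε η hη κ hκ h1 hyv (fun h => hmv (by rw [h]))

lemma isMid_of_path (hG : FlatGraph G) {c x m y : V} (hx : G.Adj c x) (hm : G.Adj c m)
    (hy : G.Adj c y) (hxm : G.Adj x m) (hmy : G.Adj m y) (hxy : x ≠ y) : IsMid G c x y m :=
  ⟨hxy, hG.not_adj_of_path hx hm hy hxm hmy, hm, hxm, hmy⟩

/-- In a flat through `x` and the triangle `c`, `y`, `v`, the direction of `v` is next to the
antipode of `x`, hence two steps away from `x`. -/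
lemma exists_isMid_of_opp (hG : FlatGraph G) {c x y v : V} (hx : G.Adj c x)
    (hy : G.Adj c y) (hv : G.Adj c v) (ho : Opp G c x y) (hyv : G.Adj y v) :
    ∃ m, IsMid G c x v m := by
  obtain ⟨φ, hφ, rfl, hx', hy', hv'⟩ := hG.exists_flat_center x c y v hy (Or.inr ⟨hv, hyv⟩)
  obtain ⟨ε, hε, rfl⟩ := hφ.exists_dir_of_adj hx' hx
  obtain ⟨η, hη, rfl⟩ := hφ.exists_dir_of_adj hy' hy
  obtain ⟨κ, hκ, rfl⟩ := hφ.exists_dir_of_adj hv' hv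
  rw [hφ.opp_iff 0 hε hη] at ho
  rw [hφ.adj_dirs_iff] at hyv
  have key : ∀ ε ∈ hexDirs, ∀ κ ∈ hexDirs, κ - -ε ∈ hexDirs → ε + κ ∈ hexDirs := by decide
  exact ⟨_, (hφ.isMid_iff 0 hε hκ _).2 ⟨key ε hε κ hκ (ho ▸ hyv), rfl⟩⟩

end FlatGraph

end Flats

/-! ### Local isometries are isometries -/

section LocalIsometries

variable {V : Type*} {G : SimpleGraph V}

lemma downSet_self (u : V) : downSet G u u = ∅ := by
  ext c; simp [downSet]

lemma downSet_of_adj (hG : G.Connected) {u z : V} (h : G.Adj u z) : downSet G u z = {u} := by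
  ext c
  simp only [downSet, SimpleGraph.dist_eq_one_iff_adj.2 h, Set.mem_ofPred_eq,
    Set.mem_singleton_iff, Nat.add_eq_right, hG.dist_eq_zero_iff]
  exact ⟨fun h' => h'.2.symm, fun h' => ⟨h' ▸ h.symm, h'.symm⟩⟩

lemma FlatGraph.downSet_nonempty (hG : FlatGraph G) {u y : V} (h : u ≠ y) :
    (downSet G u y).Nonempty := by
  obtain ⟨p, hp⟩ := hG.connected.exists_walk_length_eq_dist y u
  cases p with
  | nil => exact absurd rfl h
  | @cons _ c _ hadj q =>
    refine ⟨c, hadj, ?_⟩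
    rw [SimpleGraph.Walk.length_cons, SimpleGraph.dist_comm] at hp
    have h1 := G.dist_le q
    have h2 := hG.connected.dist_triangle (u := u) (v := c) (w := y)
    rw [SimpleGraph.dist_eq_one_iff_adj.2 hadj.symm] at h2
    rw [SimpleGraph.dist_comm] at h1
    omega

/-- How `y`, `z` may be placed with respect to `u` if `z` is farther from `u` than its
neighbour `y`. -/
inductive UpStep (G : SimpleGraph V) (u y z : V) : Set V → Prop
  | straight (c : V) : downSet G u y = {c} → Opp G y c z → UpStep G u y z {y}
  | turn (c w : V) : downSet G u y = {c} → IsMid G y c z w → UpStep G u y z {y, w}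
  | interior (c₁ c₂ w : V) : c₁ ≠ c₂ → downSet G u y = {c₁, c₂} → Opp G y c₁ z →
      IsMid G y c₂ z w → UpStep G u y z {y, w}

lemma pair_ne_singleton {a b c : V} (h : a ≠ b) : ({a, b} : Set V) ≠ {c} := by
  intro h'
  have ha : a ∈ ({c} : Set V) := h' ▸ Set.mem_insert _ _
  have hb : b ∈ ({c} : Set V) := h' ▸ Set.mem_insert_of_mem _ rfl
  exact h (ha.trans hb.symm)

lemma IsFlat.sector_ne {φ : ℤ × ℤ → V} (hφ : IsFlat G φ) (m n : ℤ) :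
    φ (m - 1, n) ≠ φ (m, n - 1) := by
  rw [Ne, hφ.eq_iff, Prod.mk.injEq]; omega

/-- In normal position `u = φ 0`, `y = φ (m, n)`, the link relations between `z` and the closer
neighbours of `y` determine the direction from `y` to `z`, up to the symmetry in the axis. So purely
local data at `y` decide how far `z` is and which of its neighbours are closer; this is what makes
local isometries isometries. -/
lemma FlatGraph.downSet_of_upStep (hG : FlatGraph G) {u y z : V} {S : Set V} (huy : u ≠ y)
    (hyz : G.Adj y z) (h : UpStep G u y z S) :
    G.dist u z = G.dist u y + 1 ∧ downSet G u z = S := by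
  obtain ⟨φ, hφ, rfl, m, n, hm, hn, rfl, ε, hε, rfl⟩ := hG.exists_flat_sector huy hyz
  have e1 : ((m - 1, n) : ℤ × ℤ) = (m, n) + (-1, 0) := by simp [sub_eq_add_neg]
  have e2 : ((m, n - 1) : ℤ × ℤ) = (m, n) + (0, -1) := by simp [sub_eq_add_neg]
  have d1 : ((-1, 0) : ℤ × ℤ) ∈ hexDirs := by decide
  have d2 : ((0, -1) : ℤ × ℤ) ∈ hexDirs := by decide
  have axis : ∀ c, downSet G (φ 0) (φ (m, n)) = {c} → n = 0 ∧ c = φ ((m, n) + (-1, 0)) := by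
    intro c hc
    rcases hn.eq_or_lt with rfl | hn'
    · rw [hφ.downSet_axis hm, Set.singleton_eq_singleton_iff, e1] at hc
      exact ⟨rfl, hc.symm⟩
    · rw [hφ.downSet_interior hm hn'] at hc
      exact absurd hc (pair_ne_singleton (hφ.sector_ne m n))
  cases h with
  | straight c hc ho =>
    obtain ⟨rfl, rfl⟩ := axis c hc
    rw [hφ.opp_iff _ d1 hε] at ho
    subst ho
    have : ((m, 0) : ℤ × ℤ) + -(-1, 0) = (m + 1, 0) := by simp
    rw [this]
    refine ⟨?_, ?_⟩
    · simp only [hφ.dist_eq, hexDist, sub_zero]; omega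
    · rw [hφ.downSet_axis (by omega)]; congr 3; omega
  | turn c w hc hmid =>
    obtain ⟨rfl, rfl⟩ := axis c hc
    rw [hφ.isMid_iff _ d1 hε] at hmid
    obtain ⟨h1, rfl⟩ := hmid
    have : ∀ ε ∈ hexDirs, (-1, 0) + ε ∈ hexDirs → ε = (0, 1) ∨ ε = (1, -1) := by decide
    refine ⟨?_, ?_⟩
    · rcases this ε hε h1 with rfl | rfl <;>
        simp only [hφ.dist_eq, hexDist, sub_zero, Prod.mk_add_mk] <;> omega
    -- The direction `(1, -1)` leaves the sector, where `downSet_interior` does not apply, so the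
    -- closer neighbours are listed directly.
    · ext c
      rw [hφ.mem_downSet_iff]
      rcases this ε hε h1 with rfl | rfl
      · simp only [hexDirs, Finset.mem_insert, Finset.mem_singleton, exists_eq_or_imp,
          exists_eq_left, hexDist, Prod.mk_add_mk, Set.mem_singleton_iff, Set.mem_insert_iff]
        constructor
        · rintro (⟨h1, -⟩ | ⟨h1, -⟩ | ⟨h1, -⟩ | ⟨h1, h2⟩ | ⟨h1, h2⟩ | ⟨h1, -⟩)
          · omega
          · omega
          · omega
          · right; rw [h2]; congr 1; ext <;> simp
          · left; rw [h2]; congr 1; ext <;> simp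
          · omega
        · rintro (rfl | rfl)
          · right; right; right; right; left
            exact ⟨by omega, by congr 1; ext <;> simp⟩
          · right; right; right; left
            exact ⟨by omega, by congr 1; ext <;> simp⟩
      · simp only [hexDirs, Finset.mem_insert, Finset.mem_singleton, exists_eq_or_imp,
          exists_eq_left, hexDist, Prod.mk_add_mk, Set.mem_singleton_iff, Set.mem_insert_iff]
        constructor
        · rintro (⟨h1, -⟩ | ⟨h1, -⟩ | ⟨h1, h2⟩ | ⟨h1, h2⟩ | ⟨h1, h2⟩ | ⟨h1, -⟩)
          · omega
          · omega
          · left; rw [h2]; congr 1; ext <;> simp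
          · right; rw [h2]; congr 1; ext <;> simp
          · omega
          · omega
        · rintro (rfl | rfl)
          · right; right; left
            exact ⟨by omega, by congr 1; ext <;> simp⟩
          · right; right; right; left
            exact ⟨by omega, by congr 1; ext <;> simp⟩
  | interior c₁ c₂ w hne hc ho hmid =>
    rcases hn.eq_or_lt with rfl | hn'
    · rw [hφ.downSet_axis hm] at hc
      exact absurd hc.symm (pair_ne_singleton hne)
    rw [hφ.downSet_interior hm hn', Set.pair_eq_pair_iff, e1, e2] at hc
    rcases hc with ⟨rfl, rfl⟩ | ⟨rfl, rfl⟩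
    · rw [hφ.opp_iff _ d1 hε] at ho
      subst ho
      rw [hφ.isMid_iff _ d2 hε] at hmid
      obtain ⟨-, rfl⟩ := hmid
      have h3 : ((m, n) : ℤ × ℤ) + -(-1, 0) = (m + 1, n) := by simp
      have h4 : ((m, n) : ℤ × ℤ) + ((0, -1) + -(-1, 0)) = (m + 1, n - 1) := by
        simp [sub_eq_add_neg]
      rw [h3, h4]
      refine ⟨?_, ?_⟩
      · simp only [hφ.dist_eq, hexDist, sub_zero]; omega
      · rw [hφ.downSet_interior (by omega) hn']; congr 3; omega
    · rw [hφ.opp_iff _ d2 hε] at ho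
      subst ho
      rw [hφ.isMid_iff _ d1 hε] at hmid
      obtain ⟨-, rfl⟩ := hmid
      have h3 : ((m, n) : ℤ × ℤ) + -(0, -1) = (m, n + 1) := by simp
      have h4 : ((m, n) : ℤ × ℤ) + ((-1, 0) + -(0, -1)) = (m - 1, n + 1) := by
        simp [sub_eq_add_neg]
      rw [h3, h4]
      refine ⟨?_, ?_⟩
      · simp only [hφ.dist_eq, hexDist, sub_zero]; omega
      · rw [hφ.downSet_interior hm (by omega), Set.pair_comm]; congr 3; omega

/-- In normal position only the directions `(1, 0)`, `(0, 1)` and, on the axis, `(1, -1)` increase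
the distance; they are matched with the constructors of `UpStep`. -/
lemma FlatGraph.exists_upStep (hG : FlatGraph G) {u y z : V} (huy : u ≠ y)
    (hy : y ∈ downSet G u z) : ∃ S, UpStep G u y z S := by
  obtain ⟨hyz, hd⟩ := hy
  obtain ⟨φ, hφ, rfl, m, n, hm, hn, rfl, ε, hε, rfl⟩ := hG.exists_flat_sector huy hyz.symm
  have e1 : ((m - 1, n) : ℤ × ℤ) = (m, n) + (-1, 0) := by simp [sub_eq_add_neg]
  have e2 : ((m, n - 1) : ℤ × ℤ) = (m, n) + (0, -1) := by simp [sub_eq_add_neg]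
  have d1 : ((-1, 0) : ℤ × ℤ) ∈ hexDirs := by decide
  have d2 : ((0, -1) : ℤ × ℤ) ∈ hexDirs := by decide
  have hε' := hε
  simp only [hφ.dist_eq, hexDist, sub_zero] at hd
  simp only [hexDirs, Finset.mem_insert, Finset.mem_singleton] at hε'
  rcases hn.eq_or_lt with rfl | hn'
  · have hds := hφ.downSet_axis hm
    rw [e1] at hds
    rcases hε' with rfl | rfl | rfl | rfl | rfl | rfl
    · exact ⟨_, .straight _ hds ((hφ.opp_iff _ d1 hε).2 (by decide))⟩
    · exact ⟨_, .turn _ _ hds ((hφ.isMid_iff _ d1 hε _).2 ⟨by decide, rfl⟩)⟩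
    · simp at hd; omega
    · simp at hd; omega
    · simp at hd; omega
    · exact ⟨_, .turn _ _ hds ((hφ.isMid_iff _ d1 hε _).2 ⟨by decide, rfl⟩)⟩
  · have hds := hφ.downSet_interior hm hn'
    have hne := hφ.sector_ne m n
    rw [e1, e2] at hds hne
    rcases hε' with rfl | rfl | rfl | rfl | rfl | rfl
    · exact ⟨_, .interior _ _ _ hne hds ((hφ.opp_iff _ d1 hε).2 (by decide))
        ((hφ.isMid_iff _ d2 hε _).2 ⟨by decide, rfl⟩)⟩
    · exact ⟨_, .interior _ _ _ hne.symm (by rw [hds, Set.pair_comm])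
        ((hφ.opp_iff _ d2 hε).2 (by decide)) ((hφ.isMid_iff _ d1 hε _).2 ⟨by decide, rfl⟩)⟩
    · simp at hd; omega
    · simp at hd; omega
    · simp at hd; omega
    · simp at hd; omega

/-- Geodesic convexity of a set of vertices. -/
def GConvex (G : SimpleGraph V) (F : Set V) : Prop :=
  ∀ x ∈ F, ∀ y ∈ F, ∀ w, G.dist x w + G.dist w y = G.dist x y → w ∈ F

lemma GConvex.downSet_subset {F : Set V} (hF : GConvex G F) {u z : V} (hu : u ∈ F) (hz : z ∈ F) :
    downSet G u z ⊆ F := fun c hc => hF u hu z hz c (by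
  rw [SimpleGraph.dist_eq_one_iff_adj.2 hc.1.symm, hc.2])

lemma dist_eq_two {x y w : V} (hn : x ≠ y) (ha : ¬ G.Adj x y) (h1 : G.Adj x w) (h2 : G.Adj w y) :
    G.dist x y = 2 := by
  have := G.dist_le (SimpleGraph.Walk.cons h1 (SimpleGraph.Walk.cons h2 SimpleGraph.Walk.nil))
  rw [← SimpleGraph.dist_eq_one_iff_adj] at ha
  have h0 : G.dist x y ≠ 0 := SimpleGraph.dist_ne_zero_iff_ne_and_reachable.2
    ⟨hn, h1.reachable.trans h2.reachable⟩
  simp only [SimpleGraph.Walk.length_cons, SimpleGraph.Walk.length_nil] at this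
  omega

lemma GConvex.mem_of_isMid {F : Set V} (hF : GConvex G F) {y c z w : V} (hc : c ∈ F) (hz : z ∈ F)
    (h : IsMid G y c z w) : w ∈ F := by
  apply hF c hc z hz
  rw [dist_eq_two h.1 h.2.1 h.2.2.2.1 h.2.2.2.2, SimpleGraph.dist_eq_one_iff_adj.2 h.2.2.2.1,
    SimpleGraph.dist_eq_one_iff_adj.2 h.2.2.2.2]

variable {V' : Type*} {G' : SimpleGraph V'}

/-- A map that is a local isometry on `F`: it preserves the distances in links. -/
structure LocIsomOn (G : SimpleGraph V) (G' : SimpleGraph V') (f : V → V') (F : Set V) : Prop where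
  adj : ∀ x ∈ F, ∀ y ∈ F, G.Adj x y → G'.Adj (f x) (f y)
  opp : ∀ y ∈ F, ∀ c ∈ F, ∀ z ∈ F, G.Adj y c → G.Adj y z → Opp G y c z →
    Opp G' (f y) (f c) (f z)
  mid : ∀ y ∈ F, ∀ c ∈ F, ∀ z ∈ F, G.Adj y c → G.Adj y z → (∃ w, IsMid G y c z w) →
    ∃ w, IsMid G' (f y) (f c) (f z) w

lemma LocIsomOn.mono {f : V → V'} {F F' : Set V} (h : LocIsomOn G G' f F) (hF : F' ⊆ F) :
    LocIsomOn G G' f F' where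
  adj x hx y hy := h.adj x (hF hx) y (hF hy)
  opp y hy c hc z hz := h.opp y (hF hy) c (hF hc) z (hF hz)
  mid y hy c hc z hz := h.mid y (hF hy) c (hF hc) z (hF hz)

lemma LocIsomOn.congr {f f' : V → V'} {F : Set V} (h : LocIsomOn G G' f F) (hf : Set.EqOn f f' F) :
    LocIsomOn G G' f' F where
  adj x hx y hy hxy := by rw [← hf hx, ← hf hy]; exact h.adj x hx y hy hxy
  opp y hy c hc z hz := by rw [← hf hy, ← hf hc, ← hf hz]; exact h.opp y hy c hc z hz
  mid y hy c hc z hz := by rw [← hf hy, ← hf hc, ← hf hz]; exact h.mid y hy c hc z hz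

lemma LocIsomOn.ne {f : V → V'} {F : Set V} (h : LocIsomOn G G' f F) {y c z : V} (hy : y ∈ F)
    (hc : c ∈ F) (hz : z ∈ F) (h1 : G.Adj y c) (h2 : G.Adj y z) (hne : c ≠ z) : f c ≠ f z := by
  by_cases h3 : G.Adj c z
  · exact (h.adj c hc z hz h3).ne
  rcases opp_or_isMid (y := y) hne h3 with h4 | h4
  · exact (h.opp y hy c hc z hz h1 h2 h4).1
  · obtain ⟨w, hw⟩ := h.mid y hy c hc z hz h1 h2 h4
    exact hw.1

lemma LocIsomOn.not_adj {f : V → V'} {F : Set V} (h : LocIsomOn G G' f F) {y c z : V} (hy : y ∈ F)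
    (hc : c ∈ F) (hz : z ∈ F) (h1 : G.Adj y c) (h2 : G.Adj y z) (h3 : ¬ G.Adj c z) :
    ¬ G'.Adj (f c) (f z) := by
  by_cases hne : c = z
  · subst hne; exact G'.irrefl
  rcases opp_or_isMid (y := y) hne h3 with h4 | h4
  · exact (h.opp y hy c hc z hz h1 h2 h4).2.1
  · obtain ⟨w, hw⟩ := h.mid y hy c hc z hz h1 h2 h4
    exact hw.2.1

lemma LocIsomOn.isMid {f : V → V'} {F : Set V} (h : LocIsomOn G G' f F) {y c z w : V} (hy : y ∈ F)
    (hc : c ∈ F) (hz : z ∈ F) (hw : w ∈ F) (h1 : G.Adj y c) (h2 : G.Adj y z)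
    (hm : IsMid G y c z w) : IsMid G' (f y) (f c) (f z) (f w) :=
  ⟨h.ne hy hc hz h1 h2 hm.1, h.not_adj hy hc hz h1 h2 hm.2.1, h.adj y hy w hw hm.2.2.1,
    h.adj c hc w hw hm.2.2.2.1, h.adj w hw z hz hm.2.2.2.2⟩

/-- A local isometry on a convex set preserves distances and the sets of closer neighbours. -/
theorem LocIsomOn.dist_downSet (hG : FlatGraph G) (hG' : FlatGraph G') {f : V → V'} {F : Set V}
    (hF : GConvex G F) (h : LocIsomOn G G' f F) {u : V} (hu : u ∈ F) :
    ∀ z ∈ F, G'.dist (f u) (f z) = G.dist u z ∧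
      downSet G' (f u) (f z) = f '' downSet G u z := by
  suffices H : ∀ n, ∀ z ∈ F, G.dist u z = n → G'.dist (f u) (f z) = G.dist u z ∧
      downSet G' (f u) (f z) = f '' downSet G u z from fun z hz => H _ z hz rfl
  intro n
  induction n with
  | zero =>
    intro z hz hn
    rw [hG.connected.dist_eq_zero_iff] at hn
    subst hn
    simp [downSet_self]
  | succ n ih =>
    intro z hz hn
    have huz : u ≠ z := by rintro rfl; simp at hn
    obtain ⟨y, hy⟩ := hG.downSet_nonempty huz
    have hyF := hF.downSet_subset hu hz hy
    have hyn : G.dist u y = n := by have := hy.2; omega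
    obtain ⟨ih1, ih2⟩ := ih y hyF hyn
    have hadj := h.adj y hyF z hz hy.1.symm
    -- `UpStep` speaks of positions with `u ≠ y`, so neighbours of `u` are treated apart.
    by_cases huy : u = y
    · subst huy
      refine ⟨?_, ?_⟩
      · rw [SimpleGraph.dist_eq_one_iff_adj.2 hadj, SimpleGraph.dist_eq_one_iff_adj.2 hy.1.symm]
      · rw [downSet_of_adj hG.connected hy.1.symm, downSet_of_adj hG'.connected hadj,
          Set.image_singleton]
    · have huy' : f u ≠ f y := by
        intro h'
        rw [h', SimpleGraph.dist_self, eq_comm, hG.connected.dist_eq_zero_iff] at ih1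
        exact huy ih1
      obtain ⟨S, hS⟩ := hG.exists_upStep huy hy
      obtain ⟨h1, h2⟩ := hG.downSet_of_upStep huy hy.1.symm hS
      have hdF := hF.downSet_subset hu hyF
      -- The step from `y` to `z` only involves closer neighbours of `y` and a midpoint. Convexity
      -- puts them in `F`, so `f` carries the step to one of the same kind.
      have hS' : UpStep G' (f u) (f y) (f z) (f '' S) := by
        cases hS with
        | straight c hc ho =>
          have hcF : c ∈ F := hdF (by rw [hc]; rfl)
          have hyc : G.Adj y c := (hc ▸ (rfl : c ∈ ({c} : Set V)) : c ∈ downSet G u y).1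
          rw [Set.image_singleton]
          exact .straight (f c) (by rw [ih2, hc, Set.image_singleton])
            (h.opp y hyF c hcF z hz hyc hy.1.symm ho)
        | turn c w hc hm =>
          have hcF : c ∈ F := hdF (by rw [hc]; rfl)
          have hyc : G.Adj y c := (hc ▸ (rfl : c ∈ ({c} : Set V)) : c ∈ downSet G u y).1
          rw [Set.image_pair]
          exact .turn (f c) (f w) (by rw [ih2, hc, Set.image_singleton])
            (h.isMid hyF hcF hz (hF.mem_of_isMid hcF hz hm) hyc hy.1.symm hm)
        | interior c₁ c₂ w hne hc ho hm =>
          have m1 : c₁ ∈ downSet G u y := by rw [hc]; exact Set.mem_insert _ _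
          have m2 : c₂ ∈ downSet G u y := by rw [hc]; exact Set.mem_insert_of_mem _ rfl
          rw [Set.image_pair]
          exact .interior (f c₁) (f c₂) (f w) (h.ne hyF (hdF m1) (hdF m2) m1.1 m2.1 hne)
            (by rw [ih2, hc, Set.image_pair])
            (h.opp y hyF c₁ (hdF m1) z hz m1.1 hy.1.symm ho)
            (h.isMid hyF (hdF m2) hz (hF.mem_of_isMid (hdF m2) hz hm) m2.1 hy.1.symm hm)
      obtain ⟨h3, h4⟩ := hG'.downSet_of_upStep huy' hadj hS'
      exact ⟨by rw [h3, ih1, h1], by rw [h4, h2]⟩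

/-! ### The squared Euclidean distance in terms of the graph -/

/-- `SqDist G u y D` says that `D` is the squared Euclidean distance from `u` to `y`. It is computed
recursively from the graph distance and the sets of closer neighbours. -/
inductive SqDist (G : SimpleGraph V) (u : V) : V → ℤ → Prop
  | self : SqDist G u u 0
  | axis (y c : V) : downSet G u y = {c} → SqDist G u y ((G.dist u y : ℤ) ^ 2)
  -- For `D = m² + mn + n²` the values at `(m - 1, n)` and `(m, n - 1)` add up to `2D - 3(m + n) +
  -- 2`, and `m + n` is the graph distance.
  | interior (y c₁ c₂ : V) (a b D : ℤ) : c₁ ≠ c₂ → downSet G u y = {c₁, c₂} → SqDist G u c₁ a →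
      SqDist G u c₂ b → 2 * D = a + b + 3 * G.dist u y - 2 → SqDist G u y D

/-- The size of `downSet` decides which constructor applies, and the interior formula is symmetric
in the two closer neighbours. -/
lemma SqDist.unique {u y : V} {D D' : ℤ} (h : SqDist G u y D) (h' : SqDist G u y D') : D = D' := by
  induction h generalizing D' with
  | self =>
    cases h' with
    | self => rfl
    | axis _ c hc => rw [downSet_self] at hc; exact absurd hc (Set.singleton_ne_empty c).symm
    | interior _ c₁ c₂ a b D _ hc =>
      rw [downSet_self] at hc; exact absurd hc (Set.insert_nonempty _ _).ne_empty.symm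
  | axis y c hc =>
    cases h' with
    | self => rw [downSet_self] at hc; exact absurd hc (Set.singleton_ne_empty c).symm
    | axis => rfl
    | interior _ c₁ c₂ a b D hne hc' =>
      rw [hc] at hc'; exact absurd hc'.symm (pair_ne_singleton hne)
  | interior y c₁ c₂ a b D hne hc h1 h2 hD ih1 ih2 =>
    cases h' with
    | self => rw [downSet_self] at hc; exact absurd hc (Set.insert_nonempty _ _).ne_empty.symm
    | axis _ c hc' => rw [hc] at hc'; exact absurd hc' (pair_ne_singleton hne)
    | interior _ c₁' c₂' a' b' _ hne' hc' h1' h2' hD' =>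
      rw [hc, Set.pair_eq_pair_iff] at hc'
      rcases hc' with ⟨rfl, rfl⟩ | ⟨rfl, rfl⟩
      · have := ih1 h1'; have := ih2 h2'; omega
      · have := ih1 h2'; have := ih2 h1'; omega

lemma SqDist.map {f : V → V'} {F : Set V} (hF : GConvex G F)
    {u : V} (hu : u ∈ F) (h : ∀ z ∈ F, G'.dist (f u) (f z) = G.dist u z ∧
      downSet G' (f u) (f z) = f '' downSet G u z) (hinj : Set.InjOn f F) {y : V} (hy : y ∈ F) {D : ℤ}
    (hD : SqDist G u y D) : SqDist G' (f u) (f y) D := by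
  induction hD with
  | self => exact .self
  | axis y c hc =>
    rw [← (h y hy).1]
    exact .axis _ (f c) (by rw [(h y hy).2, hc, Set.image_singleton])
  | interior y c₁ c₂ a b D hne hc h1 h2 hD ih1 ih2 =>
    have m1 : c₁ ∈ F := hF.downSet_subset hu hy (by rw [hc]; exact Set.mem_insert _ _)
    have m2 : c₂ ∈ F := hF.downSet_subset hu hy (by rw [hc]; exact Set.mem_insert_of_mem _ rfl)
    refine .interior _ (f c₁) (f c₂) a b D (fun h' => hne (hinj m1 m2 h')) ?_ (ih1 m1) (ih2 m2) ?_
    · rw [(h y hy).2, hc, Set.image_pair]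
    · rw [(h y hy).1, hD]

lemma LocIsomOn.injOn (hG : FlatGraph G) (hG' : FlatGraph G') {f : V → V'} {F : Set V}
    (hF : GConvex G F) (h : LocIsomOn G G' f F) : Set.InjOn f F := by
  intro u hu z hz he
  have := (h.dist_downSet hG hG' hF hu z hz).1
  rw [he, SimpleGraph.dist_self, eq_comm, hG.connected.dist_eq_zero_iff] at this
  exact this

lemma LocIsomOn.sqDist (hG : FlatGraph G) (hG' : FlatGraph G') {f : V → V'} {F : Set V}
    (hF : GConvex G F) (h : LocIsomOn G G' f F) {u y : V} (hu : u ∈ F) (hy : y ∈ F) {D : ℤ}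
    (hD : SqDist G u y D) : SqDist G' (f u) (f y) D :=
  hD.map hF hu (h.dist_downSet hG hG' hF hu) (h.injOn hG hG' hF) hy

lemma latticeSqNorm_neg (a : ℤ × ℤ) : latticeSqNorm (-a) = latticeSqNorm a := by
  simp only [latticeSqNorm, Prod.fst_neg, Prod.snd_neg]; ring

lemma IsFlat.sqDist_sector {φ : ℤ × ℤ → V} (hφ : IsFlat G φ) : ∀ k : ℕ, ∀ m n : ℤ, 0 < m → 0 ≤ n →
    m + n = k → SqDist G (φ 0) (φ (m, n)) (latticeSqNorm (m, n)) := by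
  -- The recursion from `(1, n)` leaves the half-open sector at `(0, n)`, which is on the axis of
  -- the rotated flat.
  have hax : ∀ n : ℤ, 0 < n → SqDist G (φ 0) (φ (0, n)) (latticeSqNorm (0, n)) := by
    intro n hn
    have hr : IsFlat G (φ ∘ hexRot.toEquiv) := by
      refine hφ.comp _ (fun a b => ?_)
      simp only [hexRot, hexDist, AddEquiv.toEquiv_eq_coe, EquivLike.coe_coe, AddEquiv.coe_mk,
        Equiv.coe_fn_mk, Prod.mk_sub_mk, Prod.fst_sub, Prod.snd_sub]
      omega
    have h := hr.downSet_axis hn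
    have := SqDist.axis _ _ h
    rw [hr.dist_eq] at this
    have e0 : hexRot (0, 0) = ((0, 0) : ℤ × ℤ) := by simp [hexRot]
    have e1 : hexRot (n, 0) = ((0, n) : ℤ × ℤ) := by simp [hexRot]
    have e2 : latticeSqNorm (0, n) = (hexDist ((n, 0) - 0) : ℤ) ^ 2 := by
      have : (hexDist (((n, 0) : ℤ × ℤ) - 0) : ℤ) = n := by
        simp only [hexDist, sub_zero]; omega
      rw [this]; simp [latticeSqNorm]
    rw [e2]
    simpa [e0, e1, Prod.zero_eq_mk] using this
  intro k
  induction k with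
  | zero => intro m n hm hn h; omega
  | succ k ih =>
    intro m n hm hn hk
    rcases hn.eq_or_lt with rfl | hn'
    · have := SqDist.axis _ _ (hφ.downSet_axis hm)
      rw [hφ.dist_eq] at this
      convert this using 1
      have : (hexDist (((m, 0) : ℤ × ℤ) - 0) : ℤ) = m := by
        simp only [hexDist, sub_zero]; omega
      rw [this]; simp [latticeSqNorm]
    · have hd := hφ.downSet_interior hm hn'
      refine .interior _ _ _ (latticeSqNorm (m - 1, n)) (latticeSqNorm (m, n - 1)) _
        (hφ.sector_ne m n) hd ?_ (ih m (n - 1) hm (by omega) (by push_cast at hk; omega)) ?_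
      · by_cases h1 : m = 1
        · subst h1; exact hax n hn'
        · exact ih (m - 1) n (by omega) hn (by push_cast at hk; omega)
      · have : (G.dist (φ 0) (φ (m, n)) : ℤ) = m + n := by
          rw [hφ.dist_eq]; simp only [hexDist, sub_zero]; omega
        rw [this]; simp only [latticeSqNorm]; ring

lemma IsFlat.sqDist {φ : ℤ × ℤ → V} (hφ : IsFlat G φ) (a b : ℤ × ℤ) :
    SqDist G (φ a) (φ b) (latticeSqNorm (b - a)) := by
  by_cases hab : b - a = 0
  · rw [sub_eq_zero] at hab
    subst hab
    have : latticeSqNorm (b - b) = 0 := by simp [latticeSqNorm]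
    rw [this]; exact .self
  obtain ⟨e, h1, h2, m, n, hm, hn, hmn⟩ := exists_sector (b - a) hab
  have hflat : IsFlat G (φ ∘ (e.toEquiv.trans (Equiv.addRight a))) :=
    hφ.comp _ (fun x y => by simp [← map_sub, h1])
  have := hflat.sqDist_sector (m + n).toNat m n hm hn (by omega)
  rw [← h2 (m, n), hmn] at this
  simpa [hmn] using this

lemma FlatGraph.exists_flat_pair (hG : FlatGraph G) {u y : V} (h : u ≠ y) :
    ∃ φ, IsFlat G φ ∧ ∃ a b, φ a = u ∧ φ b = y := by
  obtain ⟨c, hc, -⟩ := hG.downSet_nonempty h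
  obtain ⟨φ, hφ, ⟨a, ha⟩, ⟨b, hb⟩, -⟩ := hG.exists_flat u y c c hc (Or.inl rfl)
  exact ⟨φ, hφ, a, b, ha, hb⟩

lemma FlatGraph.exists_sqDist (hG : FlatGraph G) (u y : V) : ∃ D, SqDist G u y D := by
  by_cases h : u = y
  · subst h; exact ⟨0, .self⟩
  · obtain ⟨φ, hφ, a, b, rfl, rfl⟩ := hG.exists_flat_pair h
    exact ⟨_, hφ.sqDist a b⟩

lemma latticeSqNorm_eq_one_iff (a : ℤ × ℤ) : latticeSqNorm a = 1 ↔ a ∈ hexDirs := by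
  obtain ⟨m, n⟩ := a
  constructor
  · intro h
    simp only [latticeSqNorm] at h
    have h1 : m ^ 2 ≤ 1 := by nlinarith [sq_nonneg (m + 2 * n)]
    have h2 : n ^ 2 ≤ 1 := by nlinarith [sq_nonneg (2 * m + n)]
    have h4 : -1 ≤ m ∧ m ≤ 1 := ⟨by nlinarith, by nlinarith⟩
    have h5 : -1 ≤ n ∧ n ≤ 1 := ⟨by nlinarith, by nlinarith⟩
    obtain ⟨h6, h7⟩ := h4
    obtain ⟨h8, h9⟩ := h5
    interval_cases m <;> interval_cases n <;> first | decide | (norm_num at h)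
  · have : ∀ a ∈ hexDirs, latticeSqNorm a = 1 := by decide
    exact this _

lemma FlatGraph.sqDist_one_iff (hG : FlatGraph G) {u y : V} : SqDist G u y 1 ↔ G.Adj u y := by
  constructor
  · intro h
    have hne : u ≠ y := by rintro rfl; simpa using h.unique .self
    obtain ⟨φ, hφ, a, b, rfl, rfl⟩ := hG.exists_flat_pair hne
    rw [hφ.adj_iff, ← latticeSqNorm_eq_one_iff]
    exact (hφ.sqDist a b).unique h
  · intro h
    obtain ⟨φ, hφ, a, b, rfl, rfl⟩ := hG.exists_flat_pair h.ne
    rw [hφ.adj_iff, ← latticeSqNorm_eq_one_iff] at h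
    rw [← h]; exact hφ.sqDist a b

lemma FlatGraph.exists_flat_link (hG : FlatGraph G) {y c z : V} (hc : G.Adj y c)
    (hz : G.Adj y z) : ∃ φ, IsFlat G φ ∧ φ 0 = y ∧ ∃ ε ∈ hexDirs, ∃ δ ∈ hexDirs,
      c = φ (0 + ε) ∧ z = φ (0 + δ) := by
  obtain ⟨φ, hφ, rfl, hc', hz', -⟩ := hG.exists_flat_center c y z z hz (Or.inl rfl)
  obtain ⟨ε, hε, rfl⟩ := hφ.exists_dir_of_adj hc' hc
  obtain ⟨δ, hδ, rfl⟩ := hφ.exists_dir_of_adj hz' hz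
  exact ⟨φ, hφ, rfl, ε, hε, δ, hδ, rfl, rfl⟩

/-- Between two neighbours of a vertex, link distances 1, 2, 3 correspond to squared distances 1, 3,
4. Hence Euclidean distances determine the local data in `LocIsomOn`. -/
lemma FlatGraph.sqDist_three_iff (hG : FlatGraph G) {y c z : V} (hc : G.Adj y c)
    (hz : G.Adj y z) : SqDist G c z 3 ↔ ∃ w, IsMid G y c z w := by
  obtain ⟨φ, hφ, rfl, ε, hε, δ, hδ, rfl, rfl⟩ := hG.exists_flat_link hc hz
  have key : ∀ ε ∈ hexDirs, ∀ δ ∈ hexDirs, latticeSqNorm (δ - ε) = 3 ↔ ε + δ ∈ hexDirs := by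
    decide
  have h := hφ.sqDist (0 + ε) (0 + δ)
  rw [add_sub_add_left_eq_sub] at h
  simp only [hφ.isMid_iff 0 hε hδ, exists_and_left, exists_eq, and_true, ← key ε hε δ hδ]
  exact ⟨fun h' => h.unique h', fun h' => h' ▸ h⟩

lemma FlatGraph.sqDist_four_iff (hG : FlatGraph G) {y c z : V} (hc : G.Adj y c)
    (hz : G.Adj y z) : SqDist G c z 4 ↔ Opp G y c z := by
  obtain ⟨φ, hφ, rfl, ε, hε, δ, hδ, rfl, rfl⟩ := hG.exists_flat_link hc hz
  have key : ∀ ε ∈ hexDirs, ∀ δ ∈ hexDirs, latticeSqNorm (δ - ε) = 4 ↔ δ = -ε := by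
    decide
  have h := hφ.sqDist (0 + ε) (0 + δ)
  rw [add_sub_add_left_eq_sub] at h
  rw [hφ.opp_iff 0 hε hδ, ← key ε hε δ hδ]
  exact ⟨fun h' => h.unique h', fun h' => h' ▸ h⟩

/-- Maps that preserve the squared distance are local isometries. -/
lemma LocIsomOn.of_sqDist (hG : FlatGraph G) (hG' : FlatGraph G') {f : V → V'} {F : Set V}
    (h : ∀ x ∈ F, ∀ y ∈ F, ∀ D, SqDist G x y D → SqDist G' (f x) (f y) D) :
    LocIsomOn G G' f F := by
  have hadj : ∀ x ∈ F, ∀ y ∈ F, G.Adj x y → G'.Adj (f x) (f y) := fun x hx y hy hxy =>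
    hG'.sqDist_one_iff.1 (h x hx y hy 1 (hG.sqDist_one_iff.2 hxy))
  refine ⟨hadj, fun y hy c hc z hz h1 h2 ho => ?_, fun y hy c hc z hz h1 h2 ho => ?_⟩
  · exact (hG'.sqDist_four_iff (hadj _ hy _ hc h1) (hadj _ hy _ hz h2)).1
      (h _ hc _ hz _ ((hG.sqDist_four_iff h1 h2).2 ho))
  · exact (hG'.sqDist_three_iff (hadj _ hy _ hc h1) (hadj _ hy _ hz h2)).1
      (h _ hc _ hz _ ((hG.sqDist_three_iff h1 h2).2 ho))

end LocalIsometries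

/-! ### The model apartment as a graph -/

section Descent

variable {V : Type*} {G : SimpleGraph V}

/-- A function that is 1-Lipschitz and can always be decreased is the graph distance. -/
lemma dist_eq_of_descent {u : V} (f : V → ℕ) (hu : f u = 0) (hf : ∀ v w, G.Adj v w → f w ≤ f v + 1)
    (hz : ∀ v, f v = 0 → v = u) (hd : ∀ v, f v ≠ 0 → ∃ w, G.Adj v w ∧ f w + 1 = f v) (v : V) :
    G.Reachable u v ∧ G.dist u v = f v := by
  have hlow : ∀ {a b : V} (p : G.Walk a b), f b ≤ f a + p.length := by
    intro a b p
    induction p with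
    | nil => simp
    | cons h p ih => have := hf _ _ h; simp only [SimpleGraph.Walk.length_cons]; omega
  have hup : ∀ n, ∀ v, f v = n → ∃ p : G.Walk u v, p.length = n := by
    intro n
    induction n with
    | zero => intro v hv; obtain rfl := hz v hv; exact ⟨.nil, rfl⟩
    | succ n ih =>
      intro v hv
      obtain ⟨w, hw, hw'⟩ := hd v (by omega)
      obtain ⟨p, hp⟩ := ih w (by omega)
      exact ⟨p.concat hw.symm, by simp [hp]⟩
  obtain ⟨p, hp⟩ := hup _ v rfl
  refine ⟨p.reachable, le_antisymm ((G.dist_le p).trans hp.le) ?_⟩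
  obtain ⟨p', hp'⟩ := p.reachable.exists_walk_length_eq_dist
  have := hlow p'
  omega

end Descent

/-- The 1-skeleton of the model apartment. -/
def hexGraph : SimpleGraph (ℤ × ℤ) where
  Adj a b := b - a ∈ hexDirs
  symm := ⟨fun a b h => by
    have : ∀ ε ∈ hexDirs, -ε ∈ hexDirs := by decide
    rw [← neg_sub]; exact this _ h⟩
  loopless := ⟨fun a h => by rw [sub_self] at h; revert h; decide⟩

lemma hexGraph_adj {a b : ℤ × ℤ} : hexGraph.Adj a b ↔ b - a ∈ hexDirs := Iff.rfl

lemma hexDist_add_le (a b : ℤ × ℤ) : hexDist (a + b) ≤ hexDist a + hexDist b := by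
  have h : ∀ c : ℤ × ℤ, c.1.natAbs ≤ hexDist c ∧ c.2.natAbs ≤ hexDist c ∧
      (c.1 + c.2).natAbs ≤ hexDist c := fun c => by
    simp only [hexDist]; omega
  obtain ⟨h1, h2, h3⟩ := h a
  obtain ⟨h4, h5, h6⟩ := h b
  refine max_le (max_le ?_ ?_) ?_ <;> simp only [Prod.fst_add, Prod.snd_add] <;> omega

lemma hexGraph_dist (a b : ℤ × ℤ) :
    hexGraph.Reachable a b ∧ hexGraph.dist a b = hexDist (b - a) := by
  refine dist_eq_of_descent (fun b => hexDist (b - a)) (by simp [hexDist]) ?_ ?_ ?_ b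
  · intro v w h
    rw [hexGraph_adj, mem_hexDirs_iff] at h
    have := hexDist_add_le (v - a) (w - v)
    rwa [h, sub_add_sub_cancel'] at this
  · intro v hv
    rwa [hexDist_eq_zero, sub_eq_zero] at hv
  · intro v hv
    rw [Ne, hexDist_eq_zero] at hv
    obtain ⟨e, h1, -, m, n, hm, hn, hmn⟩ := exists_sector (v - a) hv
    -- In sector coordinates a step by `(-1, 0)` always shortens the vector.
    refine ⟨v + e (-1, 0), ?_, ?_⟩
    · rw [hexGraph_adj, mem_hexDirs_iff, add_sub_cancel_left, h1]; decide
    · have : v + e (-1, 0) - a = e ((m, n) + (-1, 0)) := by rw [map_add, hmn]; abel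
      rw [this, h1, ← hmn, h1]
      simp only [hexDist, Prod.mk_add_mk]; omega

lemma hexGraph_isFlat : IsFlat hexGraph id where
  dist_eq a b := (hexGraph_dist a b).2
  convex _ _ w _ := ⟨w, rfl⟩

lemma hexGraph_flatGraph : FlatGraph hexGraph where
  connected := { preconnected := fun a b => (hexGraph_dist a b).1 }
  exists_flat u x y z _ _ := ⟨id, hexGraph_isFlat, by simp⟩

lemma latticeSqNorm_sub_le_one (a b : ℤ × ℤ) :
    latticeSqNorm (a - b) ≤ 1 ↔ a = b ∨ hexGraph.Adj a b := by
  have h0 : ∀ c : ℤ × ℤ, latticeSqNorm c ≤ 1 ↔ c = 0 ∨ latticeSqNorm c = 1 := by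
    rintro ⟨m, n⟩
    constructor
    · intro h
      have h1 : 0 ≤ latticeSqNorm (m, n) := by
        simp only [latticeSqNorm]; nlinarith [sq_nonneg (m + 2 * n), sq_nonneg m]
      by_cases h2 : latticeSqNorm (m, n) = 1
      · exact Or.inr h2
      · have h3 : latticeSqNorm (m, n) = 0 := by omega
        simp only [latticeSqNorm] at h3
        have h4 : m ^ 2 = 0 := by nlinarith [sq_nonneg (m + 2 * n), sq_nonneg m]
        have h5 : n ^ 2 = 0 := by nlinarith [sq_nonneg (2 * m + n), sq_nonneg n]
        simp at h4 h5
        simp [h4, h5]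
    · rintro (h | h)
      · rw [h]; simp [latticeSqNorm]
      · exact h.le
  rw [h0, sub_eq_zero, latticeSqNorm_eq_one_iff, ← hexGraph_adj, hexGraph.adj_comm]

lemma mem_modelApartment_faces (s : Finset (ℤ × ℤ)) : s ∈ modelApartment.faces ↔
    s.Nonempty ∧ ∀ v ∈ s, ∀ w ∈ s, v = w ∨ hexGraph.Adj v w := by
  simp only [← latticeSqNorm_sub_le_one]; exact Iff.rfl

/-- An injective simplicial self-map of the lattice that fixes a triangle is the identity. -/
lemma hexGraph_rigid {g : ℤ × ℤ → ℤ × ℤ} (hg : Function.Injective g)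
    (hadj : ∀ a b, hexGraph.Adj a b → hexGraph.Adj (g a) (g b)) {a₀ a₁ a₂ : ℤ × ℤ}
    (h01 : hexGraph.Adj a₀ a₁) (h02 : hexGraph.Adj a₀ a₂) (h12 : hexGraph.Adj a₁ a₂)
    (f0 : g a₀ = a₀) (f1 : g a₁ = a₁) (f2 : g a₂ = a₂) : ∀ a, g a = a := by
  -- the reflection of a vertex of a fixed triangle in the opposite edge is fixed
  have refl : ∀ a b c, hexGraph.Adj a b → hexGraph.Adj a c → hexGraph.Adj b c → g a = a → g b = b →
      g c = c → g (a + b - c) = a + b - c := by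
    intro a b c hab hac hbc ha hb hc
    -- An edge of the lattice lies in two triangles only, so the image of the reflected vertex is
    -- either that vertex or `c`; injectivity excludes `c`.
    have key : ∀ ε ∈ hexDirs, ∀ δ ∈ hexDirs, δ - ε ∈ hexDirs → ∀ η ∈ hexDirs, η - ε ∈ hexDirs →
        η = δ ∨ η = ε - δ := by decide
    have key2 : ∀ ε ∈ hexDirs, ∀ δ ∈ hexDirs, δ - ε ∈ hexDirs → ε - δ ∈ hexDirs ∧
      -δ ∈ hexDirs ∧ ε - δ ≠ δ := by decide
    simp only [hexGraph_adj] at *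
    have hd := key2 (b - a) hab (c - a) hac (by rwa [sub_sub_sub_cancel_right])
    have e1 : b - a - (c - a) = (a + b - c) - a := by abel
    have e2 : -(c - a) = (a + b - c) - b := by abel
    rw [e1, e2] at hd
    have k1 := hadj a (a + b - c) hd.1
    have k2 := hadj b (a + b - c) hd.2.1
    rw [ha] at k1
    rw [hb] at k2
    rcases key (b - a) hab (c - a) hac (by rwa [sub_sub_sub_cancel_right]) (g (a + b - c) - a) k1
      (by rwa [sub_sub_sub_cancel_right]) with h | h
    · rw [sub_left_inj] at h
      have := hg (h.trans hc.symm)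
      exact absurd (by rw [this]) hd.2.2
    · rw [e1, sub_left_inj] at h; exact h
  -- The standard triangle at `a` is fixed. Repeated reflections spread this property to all four
  -- translates by coordinate vectors.
  let P : ℤ × ℤ → Prop := fun a => g a = a ∧ g (a + (1, 0)) = a + (1, 0) ∧ g (a + (0, 1)) = a + (0, 1)
  have aj : ∀ a b : ℤ × ℤ, b - a ∈ hexDirs → hexGraph.Adj a b := fun a b h => h
  have mv : ∀ a ε δ η κ : ℤ × ℤ, ε ∈ hexDirs ∪ {0} → δ - ε ∈ hexDirs → η - ε ∈ hexDirs →
      η - δ ∈ hexDirs → ε + δ - η = κ → g (a + ε) = a + ε → g (a + δ) = a + δ →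
      g (a + η) = a + η → g (a + κ) = a + κ := by
    intro a ε δ η κ _ h1 h2 h3 h4 g1 g2 g3
    have := refl (a + ε) (a + δ) (a + η) (aj _ _ (by rwa [add_sub_add_left_eq_sub]))
      (aj _ _ (by rwa [add_sub_add_left_eq_sub])) (aj _ _ (by rwa [add_sub_add_left_eq_sub])) g1 g2 g3
    rw [← h4]; convert this using 2 <;> abel
  have big : ∀ a, P a → g (a + (1, 1)) = a + (1, 1) ∧ g (a + (1, -1)) = a + (1, -1) ∧
      g (a + (-1, 1)) = a + (-1, 1) ∧ g (a + (2, 0)) = a + (2, 0) ∧ g (a + (0, 2)) = a + (0, 2) ∧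
      g (a + (-1, 0)) = a + (-1, 0) ∧ g (a + (0, -1)) = a + (0, -1) := by
    rintro a ⟨p0, p1, p2⟩
    have p0' : g (a + 0) = a + 0 := by simpa using p0
    have q1 := mv a (1, 0) (0, 1) 0 (1, 1) (by decide) (by decide) (by decide) (by decide) (by decide)
      p1 p2 p0'
    have q2 := mv a 0 (1, 0) (0, 1) (1, -1) (by decide) (by decide) (by decide) (by decide)
      (by decide) p0' p1 p2
    have q3 := mv a 0 (0, 1) (1, 0) (-1, 1) (by decide) (by decide) (by decide) (by decide)
      (by decide) p0' p2 p1
    have q4 := mv a (1, 0) (1, 1) (0, 1) (2, 0) (by decide) (by decide) (by decide) (by decide)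
      (by decide) p1 q1 p2
    have q5 := mv a (0, 1) (1, 1) (1, 0) (0, 2) (by decide) (by decide) (by decide) (by decide)
      (by decide) p2 q1 p1
    have q6 := mv a 0 (-1, 1) (0, 1) (-1, 0) (by decide) (by decide) (by decide) (by decide)
      (by decide) p0' q3 p2
    have q7 := mv a 0 (1, -1) (1, 0) (0, -1) (by decide) (by decide) (by decide) (by decide)
      (by decide) p0' q2 p1
    exact ⟨q1, q2, q3, q4, q5, q6, q7⟩
  have hmove : ∀ a, P a → P (a + (1, 0)) ∧ P (a + (-1, 0)) ∧ P (a + (0, 1)) ∧ P (a + (0, -1)) := by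
    intro a ha
    obtain ⟨q1, q2, q3, q4, q5, q6, q7⟩ := big a ha
    obtain ⟨p0, p1, p2⟩ := ha
    refine ⟨⟨p1, ?_, ?_⟩, ⟨q6, ?_, ?_⟩, ⟨p2, ?_, ?_⟩, ⟨q7, ?_, ?_⟩⟩ <;>
      simpa [add_assoc, Prod.mk_zero_zero] using ‹_›
  -- The given triangle or its reflection in an edge is a translate of the standard triangle.
  obtain ⟨b, hb⟩ : ∃ b, P b := by
    have key : ∀ ε ∈ hexDirs, ∀ δ ∈ hexDirs, δ - ε ∈ hexDirs → ∃ κ : ℤ × ℤ,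
        κ ∈ ({0, (-1, 0), (0, -1), (-1, -1), (-1, 1), (1, -1)} : Finset (ℤ × ℤ)) ∧
        ({κ, κ + (1, 0), κ + (0, 1)} : Finset (ℤ × ℤ)) ⊆ {0, ε, δ, ε - δ} := by decide
    obtain ⟨κ, -, hκ⟩ := key (a₁ - a₀) h01 (a₂ - a₀) h02 (by
      rw [sub_sub_sub_cancel_right]; exact h12)
    have h3 := refl a₀ a₁ a₂ h01 h02 h12 f0 f1 f2
    have all : ∀ η ∈ ({0, a₁ - a₀, a₂ - a₀, a₁ - a₀ - (a₂ - a₀)} : Finset (ℤ × ℤ)),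
        g (a₀ + η) = a₀ + η := by
      intro η hη
      simp only [Finset.mem_insert, Finset.mem_singleton] at hη
      rcases hη with rfl | rfl | rfl | rfl
      · simpa using f0
      · simpa using f1
      · simpa using f2
      · convert h3 using 2 <;> abel
    refine ⟨a₀ + κ, all _ (hκ (by simp)), ?_, ?_⟩
    · rw [add_assoc]; exact all _ (hκ (by simp))
    · rw [add_assoc]; exact all _ (hκ (by simp))
  have h1 : ∀ n : ℕ, ∀ a, P a → P (a + ((n : ℤ), 0)) ∧ P (a + (-(n : ℤ), 0)) ∧
      P (a + (0, (n : ℤ))) ∧ P (a + (0, -(n : ℤ))) := by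
    intro n
    induction n with
    | zero => intro a ha; simpa [Prod.mk_zero_zero] using ha
    | succ n ih =>
      intro a ha
      obtain ⟨i1, i2, i3, i4⟩ := ih a ha
      refine ⟨?_, ?_, ?_, ?_⟩
      · convert (hmove _ i1).1 using 1; simp [add_assoc]
      · convert (hmove _ i2).2.1 using 1; simp [add_assoc]; ring
      · convert (hmove _ i3).2.2.1 using 1; simp [add_assoc]
      · convert (hmove _ i4).2.2.2 using 1; simp [add_assoc]; ring
  intro a
  have hx : P (b + (a.1 - b.1, 0)) := by
    rcases Int.eq_nat_or_neg (a.1 - b.1) with ⟨n, hn | hn⟩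
    · rw [hn]; exact (h1 n b hb).1
    · rw [hn]; exact (h1 n b hb).2.1
  have hy : P (b + (a.1 - b.1, 0) + (0, a.2 - b.2)) := by
    rcases Int.eq_nat_or_neg (a.2 - b.2) with ⟨n, hn | hn⟩
    · rw [hn]; exact (h1 n _ hx).2.2.1
    · rw [hn]; exact (h1 n _ hx).2.2.2
  have : b + (a.1 - b.1, 0) + (0, a.2 - b.2) = a := by ext <;> simp
  rw [this] at hy
  exact hy.1

/-! ### Apartments of a building are flats -/

lemma dist_map_le {V V' : Type*} {G : SimpleGraph V} {G' : SimpleGraph V'} (f : G →g G') {a b : V}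
    (h : G.Reachable a b) : G'.dist (f a) (f b) ≤ G.dist a b := by
  obtain ⟨p, hp⟩ := h.exists_walk_length_eq_dist
  rw [← hp, ← SimpleGraph.Walk.length_map f p]
  exact SimpleGraph.dist_le _

section Building

variable {V : Type*} {X : AbstractSimplicialComplex V} {𝒜 : Set (Set (Finset V))}

/-- A parametrization of an apartment by the lattice. -/
structure IsChart (A : Set (Finset V)) (ψ : ℤ × ℤ → V) : Prop where
  inj : Function.Injective ψ
  mem_iff : ∀ s, s ∈ A ↔ ∃ s₀ ∈ modelApartment.faces, s = s₀.map ⟨ψ, inj⟩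

lemma ApartmentEmbedding.isChart (φ : ApartmentEmbedding X) : IsChart φ.imageFaces φ.toFun where
  inj := φ.inj'
  mem_iff s := by
    constructor
    · rintro ⟨s₀, h, rfl⟩; exact ⟨s₀, h, rfl⟩
    · rintro ⟨s₀, h, rfl⟩; exact ⟨s₀, h, rfl⟩

namespace IsChart

variable {A : Set (Finset V)} {ψ φ : ℤ × ℤ → V}

lemma exists_of_mem (h : IsChart A ψ) {s : Finset V} (hs : s ∈ A) {v : V} (hv : v ∈ s) :
    v ∈ Set.range ψ := by
  obtain ⟨s₀, -, rfl⟩ := (h.mem_iff s).1 hs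
  obtain ⟨a, -, rfl⟩ := Finset.mem_map.1 hv
  exact ⟨a, rfl⟩

lemma singleton_mem_iff (h : IsChart A ψ) (v : V) : {v} ∈ A ↔ v ∈ Set.range ψ := by
  refine ⟨fun hv => h.exists_of_mem hv (Finset.mem_singleton_self v), ?_⟩
  rintro ⟨a, rfl⟩
  exact (h.mem_iff _).2 ⟨{a}, modelApartment.singleton_mem a, by simp⟩

lemma adj_of_mem (h : IsChart A ψ) {s : Finset V} (hs : s ∈ A) {a b : ℤ × ℤ} (ha : ψ a ∈ s)
    (hb : ψ b ∈ s) : a = b ∨ hexGraph.Adj a b := by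
  obtain ⟨s₀, hs₀, rfl⟩ := (h.mem_iff s).1 hs
  rw [Finset.mem_map] at ha hb
  obtain ⟨a', ha', ha⟩ := ha
  obtain ⟨b', hb', hb⟩ := hb
  obtain rfl := h.inj ha
  obtain rfl := h.inj hb
  exact ((mem_modelApartment_faces _).1 hs₀).2 _ ha' _ hb'

lemma map_mem (h : IsChart A ψ) {s₀ : Finset (ℤ × ℤ)} (hs : s₀.Nonempty)
    (hadj : ∀ v ∈ s₀, ∀ w ∈ s₀, v = w ∨ hexGraph.Adj v w) : s₀.map ⟨ψ, h.inj⟩ ∈ A :=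
  (h.mem_iff _).2 ⟨s₀, (mem_modelApartment_faces _).2 ⟨hs, hadj⟩, rfl⟩

/-- Two charts of the same apartment differ by an automorphism of the lattice. -/
lemma exists_equiv (h : IsChart A ψ) (h' : IsChart A φ) : ∃ g : ℤ × ℤ ≃ ℤ × ℤ,
    (∀ a, φ a = ψ (g a)) ∧ ∀ a b, hexGraph.Adj (g a) (g b) ↔ hexGraph.Adj a b := by
  have hr : ∀ a, ∃ b, φ a = ψ b := fun a => by
    obtain ⟨b, hb⟩ := (h.singleton_mem_iff (φ a)).1 ((h'.singleton_mem_iff _).2 ⟨a, rfl⟩)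
    exact ⟨b, hb.symm⟩
  have hr' : ∀ a, ∃ b, ψ a = φ b := fun a => by
    obtain ⟨b, hb⟩ := (h'.singleton_mem_iff (ψ a)).1 ((h.singleton_mem_iff _).2 ⟨a, rfl⟩)
    exact ⟨b, hb.symm⟩
  choose g hg using hr
  choose g' hg' using hr'
  have key : ∀ {ψ φ : ℤ × ℤ → V} (_ : IsChart A ψ) (_ : IsChart A φ) {a b c d : ℤ × ℤ},
      φ a = ψ c → φ b = ψ d → hexGraph.Adj a b → hexGraph.Adj c d := by
    intro ψ φ h h' a b c d h1 h2 hab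
    have hm := h'.map_mem (s₀ := {a, b}) (by simp) (by
      intro v hv w hw
      simp only [Finset.mem_insert, Finset.mem_singleton] at hv hw
      rcases hv with rfl | rfl <;> rcases hw with rfl | rfl <;> simp [hab, hab.symm])
    rcases h.adj_of_mem (a := c) (b := d) hm (by simp [← h1]) (by simp [← h2]) with h3 | h3
    · subst h3; exact absurd (h'.inj (h1.trans h2.symm)) hab.ne
    · exact h3
  refine ⟨⟨g, g', fun a => h'.inj ?_, fun a => h.inj ?_⟩, hg, fun a b => ⟨?_, ?_⟩⟩
  · rw [← hg', ← hg]
  · rw [← hg, ← hg']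
  · exact key h' h (hg a).symm (hg b).symm
  · exact key h h' (hg a) (hg b)

lemma comp (h : IsChart A ψ) (g : ℤ × ℤ ≃ ℤ × ℤ)
    (hg : ∀ a b, hexGraph.Adj (g a) (g b) ↔ hexGraph.Adj a b) : IsChart A (ψ ∘ g) where
  inj := h.inj.comp g.injective
  mem_iff s := by
    rw [h.mem_iff]
    constructor
    · rintro ⟨s₀, hs, rfl⟩
      refine ⟨s₀.map g.symm.toEmbedding, ?_, ?_⟩
      · rw [mem_modelApartment_faces] at hs ⊢
        refine ⟨Finset.map_nonempty.2 hs.1, fun v hv w hw => ?_⟩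
        rw [Finset.mem_map_equiv, Equiv.symm_symm] at hv hw
        have := hs.2 _ hv _ hw
        rwa [g.apply_eq_iff_eq, hg] at this
      · rw [Finset.map_map]; congr 1; ext a; simp
    · rintro ⟨s₀, hs, rfl⟩
      refine ⟨s₀.map g.toEmbedding, ?_, ?_⟩
      · rw [mem_modelApartment_faces] at hs ⊢
        refine ⟨Finset.map_nonempty.2 hs.1, fun v hv w hw => ?_⟩
        rw [Finset.mem_map_equiv] at hv hw
        have := hs.2 _ hv _ hw
        rwa [← hg, g.symm.apply_eq_iff_eq, g.apply_symm_apply, g.apply_symm_apply] at this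
      · rw [Finset.map_map]; congr 1

end IsChart

lemma pair_mem_faces [DecidableEq V] {v w : V} (h : (skeleton X).Adj v w) :
    ({v, w} : Finset V) ∈ X.faces := by
  obtain ⟨-, s, hs, hv, hw⟩ := h
  exact (X.isRelLowerSet_faces hs).2 (by
    intro x hx
    simp only [Finset.mem_insert, Finset.mem_singleton] at hx
    rcases hx with rfl | rfl <;> assumption) (by simp)

/-! ### Compatible charts, retractions, and convexity of apartments -/

namespace IsApartmentSystem

variable (h𝒜 : IsApartmentSystem X 𝒜)
include h𝒜

lemma subset_faces {A : Set (Finset V)} (hA : A ∈ 𝒜) : A ⊆ X.faces := by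
  obtain ⟨φ, rfl⟩ := h𝒜.copy A hA
  rintro _ ⟨s, hs, rfl⟩
  exact φ.map_mem s hs

/-- The axiom only supplies some pair of charts that agree on the intersection; the given chart
differs from its member of the pair by a lattice automorphism, which is then applied to the other
chart. -/
lemma exists_compatible {A A' : Set (Finset V)} (hA : A ∈ 𝒜) (hA' : A' ∈ 𝒜) {φ : ℤ × ℤ → V}
    (hφ : IsChart A φ) : ∃ ψ, IsChart A' ψ ∧ ∀ a b, φ a = ψ b → a = b := by
  obtain ⟨φ₀, ψ₀, h1, h2, h3⟩ := h𝒜.iso A hA A' hA'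
  have c1 : IsChart A φ₀.toFun := h1 ▸ φ₀.isChart
  have c2 : IsChart A' ψ₀.toFun := h2 ▸ ψ₀.isChart
  obtain ⟨g, hg, hg'⟩ := c1.exists_equiv hφ
  refine ⟨_, c2.comp g hg', fun a b hab => ?_⟩
  have hm : {φ₀.toFun (g a)} ∈ A' := by
    rw [← hg, hab]; exact (c2.singleton_mem_iff _).2 ⟨_, rfl⟩
  have h4 := h3 _ hm
  rw [← hg, hab] at h4
  exact g.injective (c2.inj h4)

/-- A chart and a simplex lie in a common apartment around a given simplex of the chart. -/
lemma exists_chart_extending {A : Set (Finset V)} (hA : A ∈ 𝒜) {φ : ℤ × ℤ → V}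
    (hφ : IsChart A φ) {s t : Finset V} (hs : s ∈ X.faces) (ht : t ∈ X.faces) :
    ∃ A' ∈ 𝒜, ∃ ψ, IsChart A' ψ ∧ (∀ a b, φ a = ψ b → a = b) ∧ (∀ a, φ a ∈ s → ψ a = φ a) ∧
      s ∈ A' ∧ t ∈ A' := by
  obtain ⟨A', hA', hs', ht'⟩ := h𝒜.common s hs t ht
  obtain ⟨ψ, hψ, hc⟩ := h𝒜.exists_compatible hA hA' hφ
  refine ⟨A', hA', ψ, hψ, hc, fun a ha => ?_, hs', ht'⟩
  obtain ⟨b, hb⟩ := hψ.exists_of_mem hs' ha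
  rw [hc a b hb.symm, hb, ← hc a b hb.symm]

/-- Apartments are full subcomplexes: an edge of `X` between two of their vertices lies in some
apartment, and a compatible chart of it gives the two vertices the same coordinates. -/
lemma chart_adj_iff {A : Set (Finset V)} (hA : A ∈ 𝒜) {φ : ℤ × ℤ → V} (hφ : IsChart A φ)
    (a b : ℤ × ℤ) : (skeleton X).Adj (φ a) (φ b) ↔ hexGraph.Adj a b := by
  classical
  constructor
  · intro h
    have hs := pair_mem_faces h
    obtain ⟨A', hA', ψ, hψ, -, he, hs', -⟩ := h𝒜.exists_chart_extending hA hφ hs hs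
    rcases hψ.adj_of_mem (a := a) (b := b) hs' (by rw [he a (by simp)]; simp)
      (by rw [he b (by simp)]; simp) with h3 | h3
    · subst h3; exact absurd rfl h.ne
    · exact h3
  · intro h
    refine ⟨fun h' => h.ne (hφ.inj h'), _, h𝒜.subset_faces hA (hφ.map_mem (s₀ := {a, b}) (by simp) (by
      intro v hv w hw
      simp only [Finset.mem_insert, Finset.mem_singleton] at hv hw
      rcases hv with rfl | rfl <;> rcases hw with rfl | rfl <;> simp [h, h.symm])), by simp, by simp⟩

/-- By rigidity of the lattice, `ψ` must be the chart of `A'` compatible with `φ`, since both agree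
with `φ` on a triangle. -/
lemma eq_of_agree {A A' : Set (Finset V)} (hA : A ∈ 𝒜) (hA' : A' ∈ 𝒜) {φ ψ : ℤ × ℤ → V}
    (hφ : IsChart A φ) (hψ : IsChart A' ψ) {a₀ a₁ a₂ : ℤ × ℤ}
    (h01 : hexGraph.Adj a₀ a₁) (h02 : hexGraph.Adj a₀ a₂) (h12 : hexGraph.Adj a₁ a₂)
    (f0 : φ a₀ = ψ a₀) (f1 : φ a₁ = ψ a₁) (f2 : φ a₂ = ψ a₂) {a b : ℤ × ℤ} (hab : φ a = ψ b) :
    a = b := by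
  obtain ⟨χ, hχ, hc⟩ := h𝒜.exists_compatible hA hA' hφ
  obtain ⟨g, hg, hg'⟩ := hχ.exists_equiv hψ
  have hid := hexGraph_rigid g.injective (fun a b => (hg' a b).2) h01 h02 h12
    (hc _ _ (f0.trans (hg _))).symm (hc _ _ (f1.trans (hg _))).symm (hc _ _ (f2.trans (hg _))).symm
  have := hc a (g b) (hab.trans (hg b))
  rwa [hid] at this

/-- The retraction onto an apartment centred at one of its chambers. -/
lemma exists_retraction {A : Set (Finset V)} (hA : A ∈ 𝒜) {φ : ℤ × ℤ → V} (hφ : IsChart A φ)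
    {a₀ a₁ a₂ : ℤ × ℤ} (h01 : hexGraph.Adj a₀ a₁) (h02 : hexGraph.Adj a₀ a₂)
    (h12 : hexGraph.Adj a₁ a₂) : ∃ ρ : V → ℤ × ℤ, (∀ a, ρ (φ a) = a) ∧
      (∀ v w, (skeleton X).Adj v w → hexGraph.Adj (ρ v) (ρ w)) ∧
      ∀ v, ρ v = a₀ ∨ ρ v = a₁ ∨ ρ v = a₂ → v ∈ Set.range φ := by
  classical
  let C : Finset V := ({a₀, a₁, a₂} : Finset (ℤ × ℤ)).map ⟨φ, hφ.inj⟩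
  have hC : C ∈ X.faces := h𝒜.subset_faces hA (hφ.map_mem (by simp) (by
    intro v hv w hw
    simp only [Finset.mem_insert, Finset.mem_singleton] at hv hw
    rcases hv with rfl | rfl | rfl <;> rcases hw with rfl | rfl | rfl <;>
      simp [h01, h02, h12, h01.symm, h02.symm, h12.symm]))
  have m0 : φ a₀ ∈ C := by simp [C]
  have m1 : φ a₁ ∈ C := by simp [C]
  have m2 : φ a₂ ∈ C := by simp [C]
  -- The retraction of `v` is its coordinate in any chart that agrees with `φ` on the chamber `C`;
  -- `eq_of_agree` makes the choice irrelevant.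
  have hex : ∀ v, ∃ b, ∃ A' ∈ 𝒜, ∃ ψ, IsChart A' ψ ∧ (∀ a, φ a ∈ C → ψ a = φ a) ∧ ψ b = v := by
    intro v
    obtain ⟨A', hA', ψ, hψ, -, he, -, ht⟩ :=
      h𝒜.exists_chart_extending hA hφ hC (X.singleton_mem v)
    obtain ⟨b, hb⟩ := (hψ.singleton_mem_iff v).1 ht
    exact ⟨b, A', hA', ψ, hψ, he, hb⟩
  choose ρ Aρ hAρ ψρ hψρ heρ hρ using hex
  have huniq : ∀ {A' : Set (Finset V)} {ψ : ℤ × ℤ → V} (_ : A' ∈ 𝒜) (_ : IsChart A' ψ)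
      (_ : ∀ a, φ a ∈ C → ψ a = φ a) (b : ℤ × ℤ), ρ (ψ b) = b := by
    intro A' ψ hA' hψ he b
    refine h𝒜.eq_of_agree (hAρ (ψ b)) hA' (hψρ (ψ b)) hψ h01 h02 h12 ?_ ?_ ?_ (hρ (ψ b))
    · rw [heρ _ _ m0, he _ m0]
    · rw [heρ _ _ m1, he _ m1]
    · rw [heρ _ _ m2, he _ m2]
  refine ⟨ρ, huniq hA hφ (fun _ _ => rfl), fun v w hvw => ?_, fun v hv => ?_⟩
  · obtain ⟨A', hA', ψ, hψ, -, he, -, ht⟩ :=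
      h𝒜.exists_chart_extending hA hφ hC (pair_mem_faces hvw)
    obtain ⟨a, rfl⟩ := hψ.exists_of_mem ht (v := v) (by simp)
    obtain ⟨b, rfl⟩ := hψ.exists_of_mem ht (v := w) (by simp)
    rw [huniq hA' hψ he, huniq hA' hψ he]
    exact (h𝒜.chart_adj_iff hA' hψ a b).1 hvw
  · rw [← hρ v]
    rcases hv with h | h | h <;> rw [h]
    · exact ⟨a₀, (heρ v _ m0).symm⟩
    · exact ⟨a₁, (heρ v _ m1).symm⟩
    · exact ⟨a₂, (heρ v _ m2).symm⟩

/-- Both the chart and the retraction onto it are 1-Lipschitz, and the retraction is a left inverse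
of the chart. -/
lemma dist_chart {A : Set (Finset V)} (hA : A ∈ 𝒜) {φ : ℤ × ℤ → V} (hφ : IsChart A φ)
    (a b : ℤ × ℤ) : (skeleton X).Reachable (φ a) (φ b) ∧
      (skeleton X).dist (φ a) (φ b) = hexDist (b - a) := by
  let f : hexGraph →g skeleton X := ⟨φ, fun h => (h𝒜.chart_adj_iff hA hφ _ _).2 h⟩
  obtain ⟨h1, h2⟩ := hexGraph_dist a b
  have hr : (skeleton X).Reachable (φ a) (φ b) := h1.map f
  refine ⟨hr, le_antisymm (h2 ▸ dist_map_le f h1) ?_⟩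
  obtain ⟨ρ, hρ, hadj, -⟩ := h𝒜.exists_retraction hA hφ (a₀ := 0) (a₁ := (1, 0)) (a₂ := (0, 1))
    (by rw [hexGraph_adj]; decide) (by rw [hexGraph_adj]; decide) (by rw [hexGraph_adj]; decide)
  have := dist_map_le (⟨ρ, fun h => hadj _ _ h⟩ : skeleton X →g hexGraph) hr
  simp only [RelHom.coeFn_mk, hρ, h2] at this
  exact this

lemma connected [Nonempty V] : (skeleton X).Connected where
  preconnected v w := by
    obtain ⟨A, hA, hv, hw⟩ := h𝒜.common _ (X.singleton_mem v) _ (X.singleton_mem w)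
    obtain ⟨φ, rfl⟩ := h𝒜.copy A hA
    obtain ⟨a, rfl⟩ := (φ.isChart.singleton_mem_iff v).1 hv
    obtain ⟨b, rfl⟩ := (φ.isChart.singleton_mem_iff w).1 hw
    exact (h𝒜.dist_chart hA φ.isChart a b).1

/-- Retract from the chamber at `c` that points towards `b`. The image of `w` is a neighbour of `c`
closer to `b`, so it is a vertex of that chamber, and vertices retracting into the chamber belong to
the apartment. -/
lemma mem_range_of_adj_of_dist_lt [Nonempty V] {A : Set (Finset V)} (hA : A ∈ 𝒜) {φ : ℤ × ℤ → V}
    (hφ : IsChart A φ) {b c : ℤ × ℤ} {w : V} (hadj : (skeleton X).Adj (φ c) w)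
    (hlt : (skeleton X).dist w (φ b) < (skeleton X).dist (φ c) (φ b)) : w ∈ Set.range φ := by
  have hbc : b - c ≠ 0 := by
    intro h
    rw [(h𝒜.dist_chart hA hφ c b).2, h] at hlt
    simp [hexDist] at hlt
  obtain ⟨e, h1, -, m, n, hm, hn, hmn⟩ := exists_sector (b - c) hbc
  have hdir : ∀ x : ℤ × ℤ, e x ∈ hexDirs ↔ x ∈ hexDirs := fun x => by
    rw [mem_hexDirs_iff, mem_hexDirs_iff, h1]
  obtain ⟨ρ, hρ, hρadj, hρr⟩ := h𝒜.exists_retraction hA hφ (a₀ := c) (a₁ := c + e (1, 0))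
    (a₂ := c + e (0, 1)) (by rw [hexGraph_adj, add_sub_cancel_left, hdir]; decide)
    (by rw [hexGraph_adj, add_sub_cancel_left, hdir]; decide)
    (by rw [hexGraph_adj, add_sub_add_left_eq_sub, ← map_sub, hdir]; decide)
  apply hρr
  have hd := dist_map_le (⟨ρ, fun h => hρadj _ _ h⟩ : skeleton X →g hexGraph)
    (h𝒜.connected.preconnected w (φ b))
  simp only [RelHom.coeFn_mk, hρ] at hd
  rw [(hexGraph_dist _ _).2] at hd
  have hcw := hρadj _ _ hadj
  rw [hρ, hexGraph_adj] at hcw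
  obtain ⟨δ, hδ⟩ := e.surjective (ρ w - c)
  have hw : ρ w = c + e δ := by rw [hδ]; abel
  rw [← hδ, hdir] at hcw
  rw [(h𝒜.dist_chart hA hφ c b).2, ← hmn, h1] at hlt
  have hd2 : b - ρ w = e ((m, n) - δ) := by rw [map_sub, hmn, hw]; abel
  rw [hd2, h1] at hd
  have hlt' := hd.trans_lt hlt
  simp only [hexDirs, Finset.mem_insert, Finset.mem_singleton] at hcw
  rw [hw]
  rcases hcw with rfl | rfl | rfl | rfl | rfl | rfl
  · simp
  · simp
  all_goals
    exfalso
    simp only [hexDist, Prod.mk_sub_mk] at hlt'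
    omega

lemma isFlat [Nonempty V] {A : Set (Finset V)} (hA : A ∈ 𝒜) {φ : ℤ × ℤ → V} (hφ : IsChart A φ) :
    IsFlat (skeleton X) φ where
  dist_eq a b := (h𝒜.dist_chart hA hφ a b).2
  convex := by
    have hc := h𝒜.connected
    suffices H : ∀ n, ∀ a b w, (skeleton X).dist (φ a) w = n → (skeleton X).dist (φ a) w +
        (skeleton X).dist w (φ b) = (skeleton X).dist (φ a) (φ b) → w ∈ Set.range φ from
      fun a b w h => H _ a b w rfl h
    intro n
    induction n with
    | zero => intro a b w h _; rw [hc.dist_eq_zero_iff] at h; exact ⟨a, h⟩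
    | succ n ih =>
      -- Each geodesic from `φ a` through `w` to `φ b` stays in the flat: its first step decreases
      -- the distance to `φ b`, so the previous lemma applies, and induction continues from there.
      intro a b w hn h
      obtain ⟨p, hp⟩ := hc.exists_walk_length_eq_dist (φ a) w
      cases p with
      | nil => exact ⟨a, rfl⟩
      | @cons _ x _ hadj q =>
        rw [SimpleGraph.Walk.length_cons] at hp
        have h1 := SimpleGraph.dist_le q
        have h2 := hc.dist_triangle (u := φ a) (v := x) (w := w)
        have h3 := hc.dist_triangle (u := x) (v := w) (w := φ b)
        have h4 := hc.dist_triangle (u := φ a) (v := x) (w := φ b)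
        have h5 := SimpleGraph.dist_eq_one_iff_adj.2 hadj
        obtain ⟨c, rfl⟩ := h𝒜.mem_range_of_adj_of_dist_lt hA hφ (b := b) hadj (by omega)
        exact ih c b w (by omega) (by omega)

/-- The edge `x`, `y` and the vertex `z` share an apartment, and in the lattice pairwise adjacent
vertices span a simplex. -/
lemma triangle_mem_faces [DecidableEq V] {x y z : V} (hxy : (skeleton X).Adj x y)
    (hxz : (skeleton X).Adj x z) (hyz : (skeleton X).Adj y z) : ({x, y, z} : Finset V) ∈ X.faces := by
  obtain ⟨A, hA, h1, h2⟩ := h𝒜.common _ (pair_mem_faces hxy) _ (X.singleton_mem z)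
  obtain ⟨φ, rfl⟩ := h𝒜.copy A hA
  obtain ⟨a, rfl⟩ := φ.isChart.exists_of_mem h1 (v := x) (by simp)
  obtain ⟨b, rfl⟩ := φ.isChart.exists_of_mem h1 (v := y) (by simp)
  obtain ⟨c, rfl⟩ := (φ.isChart.singleton_mem_iff z).1 h2
  rw [h𝒜.chart_adj_iff hA φ.isChart] at hxy hxz hyz
  have := h𝒜.subset_faces hA (φ.isChart.map_mem (s₀ := {a, b, c}) (by simp) (by
    intro v hv w hw
    simp only [Finset.mem_insert, Finset.mem_singleton] at hv hw
    rcases hv with rfl | rfl | rfl <;> rcases hw with rfl | rfl | rfl <;>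
      simp [hxy, hxz, hyz, hxy.symm, hxz.symm, hyz.symm]))
  simpa using this

lemma flatGraph [Nonempty V] : FlatGraph (skeleton X) where
  connected := h𝒜.connected
  exists_flat u x y z hxy hz := by
    classical
    have hs : ({x, y, z} : Finset V) ∈ X.faces := by
      rcases hz with rfl | ⟨h1, h2⟩
      · simpa using pair_mem_faces hxy
      · exact h𝒜.triangle_mem_faces hxy h1 h2
    obtain ⟨A, hA, h1, h2⟩ := h𝒜.common _ (X.singleton_mem u) _ hs
    obtain ⟨φ, rfl⟩ := h𝒜.copy A hA
    exact ⟨_, h𝒜.isFlat hA φ.isChart, φ.isChart.exists_of_mem h1 (by simp),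
      φ.isChart.exists_of_mem h2 (by simp), φ.isChart.exists_of_mem h2 (by simp),
      φ.isChart.exists_of_mem h2 (by simp)⟩

/-- A building of type `Ã₂` is a flag complex. -/
lemma mem_faces_iff [Nonempty V] (s : Finset V) :
    s ∈ X.faces ↔ s.Nonempty ∧ ∀ v ∈ s, ∀ w ∈ s, v = w ∨ (skeleton X).Adj v w := by
  classical
  constructor
  · intro hs
    refine ⟨(X.isRelLowerSet_faces hs).1, fun v hv w hw => ?_⟩
    by_cases h : v = w
    · exact Or.inl h
    · exact Or.inr ⟨h, s, hs, hv, hw⟩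
  · rintro ⟨hne, hs⟩
    obtain ⟨x, hx⟩ := hne
    by_cases h1 : ∃ y ∈ s, y ≠ x
    · obtain ⟨y, hy, hyx⟩ := h1
      have hxy := (hs x hx y hy).resolve_left hyx.symm
      by_cases h2 : ∃ z ∈ s, z ≠ x ∧ z ≠ y
      · obtain ⟨z, hz, hzx, hzy⟩ := h2
        have hxz := (hs x hx z hz).resolve_left hzx.symm
        have hyz := (hs y hy z hz).resolve_left hzy.symm
        have : s = {x, y, z} := by
          apply le_antisymm
          · intro t ht
            simp only [Finset.mem_insert, Finset.mem_singleton]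
            by_contra hcon
            push Not at hcon
            -- A fourth vertex would give a complete subgraph on four vertices.
            exact h𝒜.flatGraph.not_adj_of_path ((hs x hx y hy).resolve_left hyx.symm)
              ((hs x hx z hz).resolve_left hzx.symm) ((hs x hx t ht).resolve_left hcon.1.symm)
              hyz ((hs z hz t ht).resolve_left hcon.2.2.symm)
              ((hs y hy t ht).resolve_left hcon.2.1.symm)
          · intro t ht
            simp only [Finset.mem_insert, Finset.mem_singleton] at ht
            rcases ht with rfl | rfl | rfl <;> assumption
        rw [this]
        exact h𝒜.triangle_mem_faces hxy hxz hyz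
      · push Not at h2
        have : s = {x, y} := by
          apply le_antisymm
          · intro t ht
            simp only [Finset.mem_insert, Finset.mem_singleton]
            by_cases h : t = x
            · exact Or.inl h
            · exact Or.inr (h2 t ht h)
          · intro t ht
            simp only [Finset.mem_insert, Finset.mem_singleton] at ht
            rcases ht with rfl | rfl <;> assumption
        rw [this]
        exact pair_mem_faces hxy
    · push Not at h1
      have : s = {x} := Finset.eq_singleton_iff_unique_mem.2 ⟨hx, h1⟩
      rw [this]; exact X.singleton_mem x

/-- The image need not belong to `𝒜`, and only injectivity and simpliciality are available. They
suffice, because non-backtracking paths of length two and three in links are geodesic. -/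
lemma locIsomOn_embedding [Nonempty V] (φ : ApartmentEmbedding X) :
    LocIsomOn hexGraph (skeleton X) φ.toFun Set.univ := by
  have hX := h𝒜.flatGraph
  have hadj : ∀ a b, hexGraph.Adj a b → (skeleton X).Adj (φ.toFun a) (φ.toFun b) := by
    intro a b h
    refine ⟨fun h' => h.ne (φ.inj' h'), _, φ.map_mem {a, b} ((mem_modelApartment_faces _).2 ⟨by simp,
      by
        intro v hv w hw
        simp only [Finset.mem_insert, Finset.mem_singleton] at hv hw
        rcases hv with rfl | rfl <;> rcases hw with rfl | rfl <;> simp [h, h.symm]⟩), ?_, ?_⟩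
    · exact Finset.mem_map.2 ⟨a, by simp, rfl⟩
    · exact Finset.mem_map.2 ⟨b, by simp, rfl⟩
  refine ⟨fun x _ y _ => hadj x y, ?_, ?_⟩
  · intro y _ c _ z _ hc hz ho
    have ho' : z - y = -(c - y) := (hexGraph_isFlat.opp_iff y hc hz).1 (by simpa using ho)
    have key : ∀ ε ∈ hexDirs, ∃ δ ∈ hexDirs, ∃ η ∈ hexDirs, δ - ε ∈ hexDirs ∧ η - δ ∈ hexDirs ∧
        -ε - η ∈ hexDirs ∧ ε ≠ η ∧ δ ≠ -ε := by decide
    obtain ⟨δ, hδ, η, hη, k1, k2, k3, k4, k5⟩ := key (c - y) hc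
    have aj : ∀ ε δ : ℤ × ℤ, δ - ε ∈ hexDirs → hexGraph.Adj (y + ε) (y + δ) := fun ε δ h => by
      rw [hexGraph_adj, add_sub_add_left_eq_sub]; exact h
    have aj0 : ∀ δ : ℤ × ℤ, δ ∈ hexDirs → hexGraph.Adj y (y + δ) := fun δ h => by
      rw [hexGraph_adj, add_sub_cancel_left]; exact h
    have e3 : z = y + -(c - y) := by rw [← ho']; abel
    refine hX.opp_of_path (m := φ.toFun (y + δ)) (y := φ.toFun (y + η)) (hadj _ _ hc)
      (hadj _ _ (aj0 _ hδ)) (hadj _ _ (aj0 _ hη)) (hadj _ _ hz) ?_ (hadj _ _ (aj _ _ k2)) ?_ ?_ ?_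
    · exact hadj _ _ (by rw [hexGraph_adj]; convert k1 using 1; abel)
    · rw [e3]; exact hadj _ _ (aj _ _ k3)
    · intro h; exact k4 (by rw [φ.inj' h]; abel)
    · intro h; exact k5 (by have := φ.inj' h; rw [e3] at this; exact add_left_cancel this)
  · rintro y _ c _ z _ hc hz ⟨w, hw⟩
    exact ⟨φ.toFun w, hX.isMid_of_path (hadj _ _ hc) (hadj _ _ hw.2.2.1) (hadj _ _ hz)
      (hadj _ _ hw.2.2.2.1) (hadj _ _ hw.2.2.2.2) (fun h => hw.1 (φ.inj' h))⟩

lemma sqDist_embedding [Nonempty V] (φ : ApartmentEmbedding X) (a b : ℤ × ℤ) :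
    SqDist (skeleton X) (φ.toFun a) (φ.toFun b) (latticeSqNorm (b - a)) :=
  (h𝒜.locIsomOn_embedding φ).sqDist hexGraph_flatGraph h𝒜.flatGraph (fun _ _ _ _ _ _ => trivial)
    trivial trivial (hexGraph_isFlat.sqDist a b)

/-- `SqDist` is intrinsic to the graph, so all embedded lattices through `x` and `y` give the same
value and the infimum runs over one point. -/
lemma euclDist_eq [Nonempty V] {x y : V} {D : ℤ} (h : SqDist (skeleton X) x y D) :
    euclDist X x y = Real.sqrt D := by
  have : {r | ∃ (φ : ApartmentEmbedding X) (a b : ℤ × ℤ),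
      φ.toFun a = x ∧ φ.toFun b = y ∧ r = modelApartment.dist a b} = {Real.sqrt D} := by
    ext r
    constructor
    · rintro ⟨φ, a, b, rfl, rfl, rfl⟩
      have := (h𝒜.sqDist_embedding φ a b).unique h
      rw [← this, ← latticeSqNorm_neg, neg_sub]; rfl
    · rintro rfl
      obtain ⟨A, hA, hv, hw⟩ := h𝒜.common _ (X.singleton_mem x) _ (X.singleton_mem y)
      obtain ⟨φ, rfl⟩ := h𝒜.copy A hA
      obtain ⟨a, rfl⟩ := (φ.isChart.singleton_mem_iff x).1 hv
      obtain ⟨b, rfl⟩ := (φ.isChart.singleton_mem_iff y).1 hw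
      refine ⟨φ, a, b, rfl, rfl, ?_⟩
      have := (h𝒜.sqDist_embedding φ a b).unique h
      rw [← this, ← latticeSqNorm_neg, neg_sub]; rfl
  rw [euclDist, this, csInf_singleton]

end IsApartmentSystem

end Building

/-! ### Counting in links -/

lemma ncard_biUnion_const {ι α : Type*} {S : Set ι} (hS : S.Finite) {T : ι → Set α} {k : ℕ}
    (hfin : ∀ i ∈ S, (T i).Finite) (hT : ∀ i ∈ S, (T i).ncard = k)
    (hdisj : ∀ i ∈ S, ∀ j ∈ S, ∀ x, x ∈ T i → x ∈ T j → i = j) :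
    (⋃ i ∈ S, T i).Finite ∧ (⋃ i ∈ S, T i).ncard = S.ncard * k := by
  induction S, hS using Set.Finite.induction_on with
  | empty => simp
  | @insert i S hi hS ih =>
    obtain ⟨h1, h2⟩ := ih (fun j hj => hfin j (Set.mem_insert_of_mem _ hj))
      (fun j hj => hT j (Set.mem_insert_of_mem _ hj))
      (fun j hj l hl => hdisj j (Set.mem_insert_of_mem _ hj) l (Set.mem_insert_of_mem _ hl))
    rw [Set.biUnion_insert]
    refine ⟨(hfin i (Set.mem_insert _ _)).union h1, ?_⟩
    rw [Set.ncard_union_eq _ (hfin i (Set.mem_insert _ _)) h1, h2, hT i (Set.mem_insert _ _),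
      Set.ncard_insert_of_notMem hi hS]
    · ring
    · rw [Set.disjoint_left]
      intro x hx hx'
      simp only [Set.mem_iUnion, exists_prop] at hx'
      obtain ⟨j, hj, hxj⟩ := hx'
      exact hi (hdisj i (Set.mem_insert _ _) j (Set.mem_insert_of_mem _ hj) x hx hxj ▸ hj)

section Links

variable {V : Type*} {G : SimpleGraph V}

/-- The perspectivity of a projective plane: a link neighbour `a` of `x` goes to the midpoint of `z`
and `a`. It is injective because two preimages of one vertex would form a 4-cycle with it and `x`.
-/
lemma FlatGraph.ncard_le_of_opp (hG : FlatGraph G) {y x z : V} (hx : G.Adj y x) (hz : G.Adj y z)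
    (ho : Opp G y x z) (hfin : (G.commonNeighbors y z).Finite) :
    (G.commonNeighbors y x).ncard ≤ (G.commonNeighbors y z).ncard := by
  have hex : ∀ a : V, ∃ m, a ∈ G.commonNeighbors y x → IsMid G y z a m := by
    intro a
    by_cases ha : a ∈ G.commonNeighbors y x
    · obtain ⟨m, hm⟩ := hG.exists_isMid_of_opp hz hx ha.1 ho.symm ha.2
      exact ⟨m, fun _ => hm⟩
    · exact ⟨a, fun h => absurd h ha⟩
  choose f hf using hex
  refine Set.ncard_le_ncard_of_injOn f (fun a ha => ?_) (fun a ha b hb hab => ?_) hfin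
  · have := hf a ha
    exact ⟨this.2.2.1, this.2.2.2.1⟩
  · by_contra hne
    have h1 := hG.isMid_of_path ha.1 hx hb.1 ha.2.symm hb.2 hne
    have h2 := hG.isMid_of_path ha.1 (hf a ha).2.2.1 hb.1 (hf a ha).2.2.2.2.symm
      (hab ▸ (hf b hb).2.2.2.2) hne
    have h3 := hG.isMid_unique ha.1 hb.1 h1 h2
    exact ho.2.1 (h3 ▸ (hf a ha).2.2.2.1.symm)

lemma FlatGraph.ncard_eq_of_opp (hG : FlatGraph G)
    (hfin : ∀ x y, G.Adj x y → (G.commonNeighbors x y).Finite)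
    {y x z : V} (hx : G.Adj y x) (hz : G.Adj y z) (ho : Opp G y x z) :
    (G.commonNeighbors y x).ncard = (G.commonNeighbors y z).ncard :=
  le_antisymm (hG.ncard_le_of_opp hx hz ho (hfin _ _ hz))
    (hG.ncard_le_of_opp hz hx ho.symm (hfin _ _ hx))

/-- In a thick flat graph all edges lie in the same number of triangles. -/
lemma FlatGraph.ncard_const (hG : FlatGraph G)
    (hfin : ∀ x y, G.Adj x y → (G.commonNeighbors x y).Finite)
    (hthick : ∀ x y, G.Adj x y → 3 ≤ (G.commonNeighbors x y).ncard) {x y z w : V}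
    (hxy : G.Adj x y) (hzw : G.Adj z w) :
    (G.commonNeighbors x y).ncard = (G.commonNeighbors z w).ncard := by
  have opp := fun {y x z : V} => hG.ncard_eq_of_opp hfin (y := y) (x := x) (z := z)
  -- two neighbours of a vertex of the link
  have two : ∀ {y x z : V}, G.Adj y x → G.Adj y z → (∃ m, IsMid G y x z m) →
      (G.commonNeighbors y x).ncard = (G.commonNeighbors y z).ncard := by
    rintro y x z hx hz ⟨m, hm⟩
    obtain ⟨φ, hφ, rfl, ε, hε, δ, hδ, rfl, rfl⟩ := hG.exists_flat_link hx hz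
    rw [hφ.isMid_iff 0 hε hδ] at hm
    have key : ∀ ε ∈ hexDirs, ∀ δ ∈ hexDirs, ε + δ ∈ hexDirs → (-ε ∈ hexDirs ∧ -δ ∈ hexDirs ∧
        -(ε + δ) ∈ hexDirs ∧ (-δ) - ε ∈ hexDirs ∧ (-ε) - δ ∈ hexDirs ∧
        (-(ε + δ)) - (-δ) ∈ hexDirs ∧ (-(ε + δ)) - (-ε) ∈ hexDirs ∧ ε ≠ -(ε + δ) ∧
        δ ≠ -(ε + δ)) := by decide
    obtain ⟨k1, k2, k3, k4, k5, k6, k7, k8, k9⟩ := key ε hε δ hδ hm.1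
    have h3 := hthick _ _ (hφ.adj_dir 0 k3)
    -- Thickness provides a third link neighbour `g` of the antipode of the midpoint, off the
    -- hexagon. Paths through `-δ` and `-ε` show that it is opposite to both `ε` and `δ`.
    obtain ⟨g, hg, hg'⟩ : ∃ g ∈ G.commonNeighbors (φ 0) (φ (0 + -(ε + δ))),
        g ∉ ({φ (0 + -δ), φ (0 + -ε)} : Set V) := by
      by_contra hcon
      push Not at hcon
      have := Set.ncard_le_ncard (s := G.commonNeighbors (φ 0) (φ (0 + -(ε + δ))))
        (t := {φ (0 + -δ), φ (0 + -ε)}) hcon (by simp)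
      have h4 := Set.ncard_insert_le (φ (0 + -δ)) {φ (0 + -ε)}
      rw [Set.ncard_singleton] at h4
      omega
    simp only [Set.mem_insert_iff, Set.mem_singleton_iff, not_or] at hg'
    have o1 : Opp G (φ 0) (φ (0 + ε)) g := hG.opp_of_path hx (hφ.adj_dir 0 k2) (hφ.adj_dir 0 k3)
      hg.1 ((hφ.adj_dirs_iff 0 _ _).2 k4) ((hφ.adj_dirs_iff 0 _ _).2 k6) hg.2
      (by rw [Ne, hφ.eq_iff]; simpa using k8) (fun h => hg'.1 h.symm)
    have o2 : Opp G (φ 0) (φ (0 + δ)) g := hG.opp_of_path hz (hφ.adj_dir 0 k1) (hφ.adj_dir 0 k3)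
      hg.1 ((hφ.adj_dirs_iff 0 _ _).2 k5) ((hφ.adj_dirs_iff 0 _ _).2 k7) hg.2
      (by rw [Ne, hφ.eq_iff]; simpa using k9) (fun h => hg'.2 h.symm)
    rw [opp hx hg.1 o1, opp hz hg.1 o2]
  have adj : ∀ {y x z : V}, G.Adj y x → G.Adj y z → G.Adj x z →
      (G.commonNeighbors y x).ncard = (G.commonNeighbors y z).ncard := by
    intro y x z hx hz hxz
    obtain ⟨φ, hφ, rfl, ε, hε, δ, hδ, rfl, rfl⟩ := hG.exists_flat_link hx hz
    rw [hφ.adj_dirs_iff] at hxz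
    have key : ∀ ε ∈ hexDirs, ∀ δ ∈ hexDirs, δ - ε ∈ hexDirs → -ε ∈ hexDirs ∧ -ε + δ ∈ hexDirs := by
      decide
    obtain ⟨k1, k2⟩ := key ε hε δ hδ hxz
    -- Replacing `ε` by its antipode preserves the count and changes link distance one into two.
    rw [opp hx (hφ.adj_dir 0 k1) ((hφ.opp_iff 0 hε k1).2 rfl)]
    exact two (hφ.adj_dir 0 k1) hz ⟨_, (hφ.isMid_iff 0 k1 hδ _).2 ⟨k2, rfl⟩⟩
  have star : ∀ {y x z : V}, G.Adj y x → G.Adj y z →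
      (G.commonNeighbors y x).ncard = (G.commonNeighbors y z).ncard := by
    intro y x z hx hz
    by_cases h1 : x = z
    · rw [h1]
    by_cases h2 : G.Adj x z
    · exact adj hx hz h2
    rcases opp_or_isMid (y := y) h1 h2 with h3 | h3
    · exact opp hx hz h3
    · exact two hx hz h3
  obtain ⟨p⟩ := hG.connected.preconnected x z
  induction p generalizing y with
  | nil => exact star hxy hzw
  | cons h p ih =>
    rw [star hxy h, G.commonNeighbors_symm]
    exact ih h.symm hzw

/-- Flat graphs in which every edge lies in exactly `q + 1` triangles. -/
structure RegularFlatGraph (G : SimpleGraph V) (q : ℕ) : Prop where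
  flatGraph : FlatGraph G
  two_le : 2 ≤ q
  ncard_eq : ∀ x y, G.Adj x y → (G.commonNeighbors x y).ncard = q + 1

namespace RegularFlatGraph

variable {q : ℕ} (hG : RegularFlatGraph G q)
include hG

lemma finite_commonNeighbors {x y : V} (h : G.Adj x y) : (G.commonNeighbors x y).Finite :=
  Set.finite_of_ncard_ne_zero (by rw [hG.ncard_eq x y h]; omega)

lemma ncard_commonNeighbors_diff {x y z : V} (h : G.Adj x y) (hz : z ∈ G.commonNeighbors x y) :
    (G.commonNeighbors x y \ {z}).ncard = q := by
  rw [Set.ncard_sdiff_singleton_of_mem hz, hG.ncard_eq x y h]; rfl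

/-- Fix a link neighbour `a` of `x`. Each vertex opposite to `x` is the end of a unique path `x`,
`a`, `b`, `z` without backtracking, with `q` choices for `b` and then `q` for `z`. -/
lemma ncard_opp {x y : V} (h : G.Adj y x) :
    {z | G.Adj y z ∧ Opp G y x z}.Finite ∧ {z | G.Adj y z ∧ Opp G y x z}.ncard = q * q := by
  have hF := hG.flatGraph
  obtain ⟨a, ha⟩ : (G.commonNeighbors y x).Nonempty := by
    rw [← Set.ncard_pos (hG.finite_commonNeighbors h), hG.ncard_eq _ _ h]; omega
  have hxa : x ∈ G.commonNeighbors y a := ⟨h, ha.2.symm⟩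
  have heq : {z | G.Adj y z ∧ Opp G y x z} =
      ⋃ b ∈ G.commonNeighbors y a \ {x}, G.commonNeighbors y b \ {a} := by
    ext z
    simp only [Set.mem_iUnion, exists_prop, Set.mem_ofPred_eq]
    constructor
    · rintro ⟨hz, ho⟩
      obtain ⟨b, hb⟩ := hF.exists_isMid_of_opp hz h ha.1 ho.symm ha.2
      refine ⟨b, ⟨⟨hb.2.2.1, hb.2.2.2.2.symm⟩, ?_⟩, ⟨hz, hb.2.2.2.1.symm⟩, ?_⟩
      · rintro rfl; exact ho.2.1 hb.2.2.2.1.symm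
      · rintro rfl; exact hb.1 rfl
    · rintro ⟨b, ⟨hb, hbx⟩, hz, hza⟩
      exact ⟨hz.1, hF.opp_of_path h ha.1 hb.1 hz.1 ha.2 hb.2 hz.2 (fun h' => hbx h'.symm)
        (fun h' => hza h'.symm)⟩
  have hcount := ncard_biUnion_const (S := G.commonNeighbors y a \ {x})
    (T := fun b => G.commonNeighbors y b \ {a}) (k := q)
    ((hG.finite_commonNeighbors ha.1).subset Set.sdiff_subset)
    (fun b hb => (hG.finite_commonNeighbors hb.1.1).subset Set.sdiff_subset)
    (fun b hb => hG.ncard_commonNeighbors_diff hb.1.1 ⟨ha.1, hb.1.2.symm⟩)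
    (by
      intro b hb c hc z hz hz'
      by_contra hbc
      have hza : z ≠ a := hz.2
      have h1 := hF.isMid_of_path hz.1.1 hb.1.1 ha.1 hz.1.2.symm hb.1.2.symm hza
      have h2 := hF.isMid_of_path hz.1.1 hc.1.1 ha.1 hz'.1.2.symm hc.1.2.symm hza
      exact hbc (hF.isMid_unique hz.1.1 ha.1 h1 h2))
  rw [heq]
  refine ⟨hcount.1, hcount.2.trans ?_⟩
  rw [hG.ncard_commonNeighbors_diff ha.1 hxa]

/-- The number of neighbours of each vertex. -/
lemma ncard_neighborSet {x y : V} (h : G.Adj y x) :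
    (G.neighborSet y).Finite ∧ (G.neighborSet y).ncard = 1 + (q + 1) + (q + 1) * q + q * q := by
  have hF := hG.flatGraph
  have hcount := ncard_biUnion_const (S := G.commonNeighbors y x)
    (T := fun b => G.commonNeighbors y b \ {x}) (k := q) (hG.finite_commonNeighbors h)
    (fun b hb => (hG.finite_commonNeighbors hb.1).subset Set.sdiff_subset)
    (fun b hb => hG.ncard_commonNeighbors_diff hb.1 ⟨h, hb.2.symm⟩)
    (by
      intro b hb c hc z hz hz'
      by_contra hbc
      have hzx : z ≠ x := hz.2
      have h1 := hF.isMid_of_path hz.1.1 hb.1 h hz.1.2.symm hb.2.symm hzx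
      have h2 := hF.isMid_of_path hz.1.1 hc.1 h hz'.1.2.symm hc.2.symm hzx
      exact hbc (hF.isMid_unique hz.1.1 h h1 h2))
  have hopp := hG.ncard_opp h
  have hc := hG.finite_commonNeighbors h
  -- The link is split by the distance 0, 1, 2, 3 from `x`; the sizes are `1`, `q + 1`, `(q + 1) q`,
  -- `q²`.
  have heq : G.neighborSet y = (({x} ∪ G.commonNeighbors y x) ∪
      (⋃ b ∈ G.commonNeighbors y x, G.commonNeighbors y b \ {x})) ∪
      {z | G.Adj y z ∧ Opp G y x z} := by
    ext z
    simp only [Set.mem_iUnion, exists_prop, Set.mem_ofPred_eq, Set.mem_union, Set.mem_singleton_iff,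
      SimpleGraph.mem_neighborSet]
    constructor
    · intro hz
      by_cases h1 : x = z
      · exact Or.inl (Or.inl (Or.inl h1.symm))
      by_cases h2 : G.Adj x z
      · exact Or.inl (Or.inl (Or.inr ⟨hz, h2⟩))
      rcases opp_or_isMid (y := y) h1 h2 with h3 | ⟨w, hw⟩
      · exact Or.inr ⟨hz, h3⟩
      · exact Or.inl (Or.inr ⟨w, ⟨hw.2.2.1, hw.2.2.2.1⟩, ⟨hz, hw.2.2.2.2⟩, fun h' => h1 h'.symm⟩)
    · rintro (((rfl | h') | ⟨b, hb, hz⟩) | h')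
      · exact h
      · exact h'.1
      · exact hz.1.1
      · exact h'.1
  have f1 : ({x} ∪ G.commonNeighbors y x).Finite := (Set.finite_singleton x).union hc
  have f2 := f1.union hcount.1
  have f3 := f2.union hopp.1
  rw [heq]
  refine ⟨f3, ?_⟩
  rw [Set.ncard_union_eq _ f2 hopp.1, Set.ncard_union_eq _ f1 hcount.1,
    Set.ncard_union_eq _ (Set.finite_singleton x) hc, hopp.2, hcount.2, hG.ncard_eq _ _ h,
    Set.ncard_singleton]
  · rw [Set.disjoint_singleton_left]; exact fun h' => G.irrefl h'.2
  · rw [Set.disjoint_left]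
    rintro z hz hz'
    simp only [Set.mem_iUnion, exists_prop] at hz'
    obtain ⟨b, hb, hz'⟩ := hz'
    rcases hz with hz | hz
    · exact hz'.2 hz
    · exact hF.not_adj_of_path h hb.1 hz'.1.1 hb.2 hz'.1.2 hz.2
  · rw [Set.disjoint_left]
    rintro z hz ⟨-, hz'⟩
    rcases hz with (hz | hz) | hz
    · exact hz'.1 hz.symm
    · exact hz'.2.1 hz.2
    · simp only [Set.mem_iUnion, exists_prop] at hz
      obtain ⟨b, hb, hz⟩ := hz
      exact hz'.2.2 b hb.1 hb.2 hz.1.2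

lemma countable : Countable V := by
  obtain ⟨v⟩ := hG.flatGraph.connected.nonempty
  have hfin : ∀ n : ℕ, {w | G.dist v w ≤ n}.Countable := by
    intro n
    induction n with
    | zero =>
      refine (Set.countable_singleton v).mono (fun w hw => ?_)
      have : G.dist v w = 0 := Nat.le_zero.1 hw
      exact (hG.flatGraph.connected.dist_eq_zero_iff.1 this).symm
    | succ n ih =>
      have : {w | G.dist v w ≤ n + 1} ⊆ {w | G.dist v w ≤ n} ∪
          ⋃ u ∈ {w | G.dist v w ≤ n}, G.neighborSet u := by
        intro w hw
        by_cases h : v = w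
        · subst h; left; simp
        · obtain ⟨c, hc, hd⟩ := hG.flatGraph.downSet_nonempty h
          right
          simp only [Set.mem_iUnion, exists_prop]
          have hw' : G.dist v w ≤ n + 1 := hw
          exact ⟨c, show G.dist v c ≤ n by omega, hc.symm⟩
      refine Set.Countable.mono this (ih.union (ih.biUnion fun u _ => ?_))
      by_cases hu : ∃ x, G.Adj u x
      · obtain ⟨x, hx⟩ := hu
        exact (hG.ncard_neighborSet hx).1.countable
      · push Not at hu
        have : G.neighborSet u = ∅ := Set.eq_empty_of_forall_notMem hu
        rw [this]; exact Set.countable_empty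
  rw [← Set.countable_univ_iff]
  refine (Set.countable_iUnion hfin).mono (fun w _ => ?_)
  exact Set.mem_iUnion.2 ⟨G.dist v w, le_refl (G.dist v w)⟩

end RegularFlatGraph

end Links

/-! ### Regularity of the 1-skeleton of a building of finite thickness -/

section Thickness

variable {V : Type*} {X : AbstractSimplicialComplex V} {𝒜 : Set (Set (Finset V))}

lemma IsApartmentSystem.trianglesAt_eq (h𝒜 : IsApartmentSystem X 𝒜) [DecidableEq V] {x y : V}
    (hxy : (skeleton X).Adj x y) :
    trianglesAt X {x, y} = (fun z => ({x, y, z} : Finset V)) '' (skeleton X).commonNeighbors x y := by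
  ext t
  constructor
  · rintro ⟨ht, hc, hs⟩
    have hne : ({x, y} : Finset V).card = 2 := Finset.card_pair hxy.ne
    have hd : (t \ {x, y}).card = 1 := by rw [Finset.card_sdiff_of_subset hs]; omega
    obtain ⟨z, hz⟩ := Finset.card_eq_one.1 hd
    have hzt : z ∈ t \ {x, y} := by rw [hz]; simp
    simp only [Finset.mem_sdiff, Finset.mem_insert, Finset.mem_singleton, not_or] at hzt
    refine ⟨z, ⟨⟨hzt.2.1 ∘ Eq.symm, t, ht, hs (by simp), hzt.1⟩,
      ⟨hzt.2.2 ∘ Eq.symm, t, ht, hs (by simp), hzt.1⟩⟩, ?_⟩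
    ext w
    constructor
    · intro hw
      simp only [Finset.mem_insert, Finset.mem_singleton] at hw
      rcases hw with rfl | rfl | rfl
      · exact hs (by simp)
      · exact hs (by simp)
      · exact hzt.1
    · intro hw
      by_cases h : w ∈ ({x, y} : Finset V)
      · simp only [Finset.mem_insert, Finset.mem_singleton] at h ⊢; tauto
      · have : w ∈ t \ {x, y} := Finset.mem_sdiff.2 ⟨hw, h⟩
        rw [hz] at this
        simp only [Finset.mem_insert, Finset.mem_singleton] at this ⊢; tauto
  · rintro ⟨z, hz, rfl⟩
    have h1 : (skeleton X).Adj x z := hz.1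
    have h2 : (skeleton X).Adj y z := hz.2
    refine ⟨h𝒜.triangle_mem_faces hxy h1 h2, ?_, ?_⟩
    · exact Finset.card_eq_three.2 ⟨x, y, z, hxy.ne, h1.ne, h2.ne, rfl⟩
    · intro w hw
      simp only [Finset.mem_insert, Finset.mem_singleton] at hw ⊢; tauto

lemma injOn_triangle [DecidableEq V] {G : SimpleGraph V} {x y : V} :
    Set.InjOn (fun z => ({x, y, z} : Finset V)) (G.commonNeighbors x y) := by
  intro z hz w hw h
  have : z ∈ ({x, y, w} : Finset V) := by
    rw [← show ({x, y, z} : Finset V) = {x, y, w} from h]; simp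
  simp only [Finset.mem_insert, Finset.mem_singleton] at this
  rcases this with h | h | h
  · exact absurd h.symm hz.1.ne
  · exact absurd h.symm hz.2.ne
  · exact h

/-- The number `q + 1` is given at one edge only; `ncard_const` spreads it to all edges, and
thickness yields `2 ≤ q`. -/
lemma IsApartmentSystem.regular (h𝒜 : IsApartmentSystem X 𝒜) {q : ℕ} (hq : HasThickness X q) :
    RegularFlatGraph (skeleton X) q := by
  classical
  obtain ⟨hfin, e, he, hcard, hn⟩ := hq
  obtain ⟨x, y, hxy, rfl⟩ := Finset.card_eq_two.1 hcard
  have : Nonempty V := ⟨x⟩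
  have hadj : (skeleton X).Adj x y := ⟨hxy, _, he, by simp, by simp⟩
  have hF := h𝒜.flatGraph
  have hfin' : ∀ x y, (skeleton X).Adj x y → ((skeleton X).commonNeighbors x y).Finite := by
    intro x y h
    have := hfin _ (pair_mem_faces h) (Finset.card_pair h.ne)
    rw [h𝒜.trianglesAt_eq h] at this
    exact this.of_finite_image injOn_triangle
  have hnc : ∀ x y, (skeleton X).Adj x y →
      (trianglesAt X {x, y}).ncard = ((skeleton X).commonNeighbors x y).ncard := by
    intro x y h
    rw [h𝒜.trianglesAt_eq h, injOn_triangle.ncard_image]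
  have hthick : ∀ x y, (skeleton X).Adj x y → 3 ≤ ((skeleton X).commonNeighbors x y).ncard := by
    intro x y h
    have h3 := h𝒜.thick _ (pair_mem_faces h) (Finset.card_pair h.ne)
    rw [h𝒜.trianglesAt_eq h, Set.InjOn.encard_image injOn_triangle,
      ← (hfin' x y h).cast_ncard_eq] at h3
    exact_mod_cast h3
  refine ⟨hF, ?_, fun z w hzw => ?_⟩
  · have := hthick x y hadj
    rw [← hnc x y hadj, hn] at this; omega
  · rw [hF.ncard_const hfin' hthick hzw hadj, ← hnc x y hadj, hn]

end Thickness

/-! ### Trees -/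

section Trees

variable {W : Type*} {T : SimpleGraph W}

/-- Geodesics from `o` through either neighbour are paths from `o` to `t`; these coincide in a tree,
and with them their penultimate vertices. -/
lemma tree_parent_unique (hT : T.IsTree) {o t s s' : W} (hs : T.Adj t s) (hs' : T.Adj t s')
    (hd : T.dist o s + 1 = T.dist o t) (hd' : T.dist o s' + 1 = T.dist o t) : s = s' := by
  obtain ⟨p, hp⟩ := hT.1.exists_walk_length_eq_dist o s
  obtain ⟨p', hp'⟩ := hT.1.exists_walk_length_eq_dist o s'
  have h1 := (p.concat hs.symm).isPath_of_length_eq_dist (by simp [hp, hd])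
  have h2 := (p'.concat hs'.symm).isPath_of_length_eq_dist (by simp [hp', hd'])
  have h3 : p.concat hs.symm = p'.concat hs'.symm :=
    congrArg Subtype.val ((hT.2.subsingleton_path _ _).elim ⟨_, h1⟩ ⟨_, h2⟩)
  have h4 := congrArg SimpleGraph.Walk.penultimate h3
  simpa using h4

lemma tree_dist_adj (hT : T.IsTree) (o : W) {s t : W} (h : T.Adj s t) :
    T.dist o t = T.dist o s + 1 ∨ T.dist o s = T.dist o t + 1 :=
  (hT.dist_eq_dist_add_one_of_adj o h).symm

lemma tree_dist_eq_add_one (hT : T.IsTree) {o r s t : W} (hr : T.Adj t r)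
    (hd : T.dist o r + 1 = T.dist o t) (hs : T.Adj t s) (hne : s ≠ r) :
    T.dist o s = T.dist o t + 1 := by
  rcases tree_dist_adj hT o hs with h | h
  · exact h
  · exact absurd (tree_parent_unique hT hs hr h.symm hd) hne

lemma tree_exists_parent (hT : T.IsTree) {o t : W} (h : o ≠ t) :
    ∃ r, T.Adj t r ∧ T.dist o r + 1 = T.dist o t := by
  obtain ⟨p, hp⟩ := hT.1.exists_walk_length_eq_dist t o
  cases p with
  | nil => exact absurd rfl h
  | @cons _ c _ hadj q =>
    refine ⟨c, hadj, ?_⟩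
    rw [SimpleGraph.Walk.length_cons, SimpleGraph.dist_comm] at hp
    have h1 := T.dist_le q
    rw [SimpleGraph.dist_comm] at h1
    rcases tree_dist_adj hT o hadj with h | h <;> omega

lemma tree_even (hT : T.IsTree) (o s t : W) : Even (T.dist o s + T.dist o t + T.dist s t) := by
  obtain ⟨p⟩ := hT.1.preconnected s t
  induction p with
  | nil => simp
  | @cons u v w h p ih =>
    have h1 := tree_dist_adj hT o h
    have h2 := tree_dist_adj hT w h
    rw [SimpleGraph.dist_comm (u := w), SimpleGraph.dist_comm (u := w) (v := u)] at h2
    rw [Nat.even_iff] at *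
    omega

/-- A path that leaves `w` in a direction that does not lead to `o` leads away from `o`. -/
lemma tree_dist_add (hT : T.IsTree) {o x : W} : ∀ n : ℕ, ∀ w a r : W, T.dist w x = n →
    T.Adj w a → T.dist x a + 1 = T.dist x w → T.Adj w r → T.dist o r + 1 = T.dist o w → a ≠ r →
    T.dist o x = T.dist o w + T.dist w x := by
  intro n
  induction n with
  | zero => intro w a r hn _ hxa; rw [SimpleGraph.dist_comm] at hn; omega
  | succ n ih =>
    intro w a r hn ha hxa hr hor hne
    have h1 := tree_dist_eq_add_one hT hr hor ha hne
    have hwx : T.dist x w = n + 1 := by rw [SimpleGraph.dist_comm]; exact hn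
    by_cases hax : x = a
    · subst hax
      rw [h1, SimpleGraph.dist_eq_one_iff_adj.2 ha]
    · obtain ⟨b, hb, hxb⟩ := tree_exists_parent hT hax
      have hbw : b ≠ w := by rintro rfl; omega
      have := ih a b w (by rw [SimpleGraph.dist_comm]; omega) hb hxb ha.symm (by omega) hbw
      rw [this, h1, SimpleGraph.dist_comm (u := a), hn]; omega

/-- The median property: a point between `x` and `y` is between `o` and one of `x`, `y`. -/
lemma tree_between (hT : T.IsTree) {x y w : W} (h : T.dist x w + T.dist w y = T.dist x y) (o : W) :
    T.dist o w + T.dist w x = T.dist o x ∨ T.dist o w + T.dist w y = T.dist o y := by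
  by_cases hwx : x = w
  · subst hwx; left; simp
  by_cases hwy : y = w
  · subst hwy; right; simp
  by_cases how : o = w
  · subst how; left; simp
  obtain ⟨r, hr, hor⟩ := tree_exists_parent hT how
  obtain ⟨a, ha, hxa⟩ := tree_exists_parent hT hwx
  obtain ⟨b, hb, hyb⟩ := tree_exists_parent hT hwy
  by_cases har : a = r
  · have hbr : b ≠ r := by
      rintro rfl
      subst har
      have := hT.1.dist_triangle (u := x) (v := a) (w := y)
      rw [T.dist_comm (u := a), ] at this
      rw [T.dist_comm (u := w)] at h
      omega
    right
    rw [tree_dist_add hT _ w b r rfl hb hyb hr hor hbr]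
  · left
    rw [tree_dist_add hT _ w a r rfl ha hxa hr hor har]

/-- The median property of `w'`, seen from `w`, expresses the distance between the two as a
difference of equal numbers. -/
lemma tree_between_unique (hT : T.IsTree) {x y w w' : W}
    (h : T.dist x w + T.dist w y = T.dist x y) (h' : T.dist x w' + T.dist w' y = T.dist x y)
    (he : T.dist x w = T.dist x w') : w = w' := by
  rw [← hT.1.dist_eq_zero_iff]
  have := tree_between hT h' w
  rw [T.dist_comm (u := w) (v := x), T.dist_comm (u := w') (v := x)] at this
  omega

/-- Bi-infinite geodesics. -/
def IsLine (T : SimpleGraph W) (γ : ℤ → W) : Prop := ∀ i j, T.dist (γ i) (γ j) = (j - i).natAbs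

lemma isLine_of_local (hT : T.IsTree) {γ : ℤ → W} (h1 : ∀ i, T.Adj (γ i) (γ (i + 1)))
    (h2 : ∀ i, γ i ≠ γ (i + 1 + 1)) : IsLine T γ := by
  have key : ∀ n : ℕ, ∀ i, T.dist (γ i) (γ (i + n)) = n ∧
      T.dist (γ i) (γ (i + n + 1)) = n + 1 := by
    intro n
    induction n with
    | zero => intro i; simp [SimpleGraph.dist_eq_one_iff_adj, h1]
    | succ n ih =>
      intro i
      have e : i + ((n + 1 : ℕ) : ℤ) = i + n + 1 := by push_cast; ring
      rw [e]
      obtain ⟨h3, h4⟩ := ih i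
      refine ⟨h4, ?_⟩
      rw [tree_dist_eq_add_one hT (h1 (i + n)).symm (by omega) (h1 (i + n + 1)) (h2 (i + n)).symm, h4]
  intro i j
  rcases le_total i j with h | h
  · have := (key (j - i).natAbs i).1
    have e : i + ((j - i).natAbs : ℤ) = j := by omega
    rwa [e] at this
  · have := (key (j - i).natAbs j).1
    have e : j + ((j - i).natAbs : ℤ) = i := by omega
    rwa [e, T.dist_comm] at this

lemma IsLine.mem_range (hT : T.IsTree) {γ : ℤ → W} (h : IsLine T γ) {i j : ℤ} {w : W}
    (hw : T.dist (γ i) w + T.dist w (γ j) = T.dist (γ i) (γ j)) : w ∈ Set.range γ := by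
  have hd : ∀ i j, T.dist (γ i) (γ j) = (j - i).natAbs := h
  rw [h] at hw
  rcases le_total i j with hij | hij
  · refine ⟨i + T.dist (γ i) w, tree_between_unique hT (x := γ i) (y := γ j) ?_ ?_ ?_⟩
    · simp only [hd]; omega
    · rw [h]; exact hw
    · rw [h]; omega
  · refine ⟨i - T.dist (γ i) w, tree_between_unique hT (x := γ i) (y := γ j) ?_ ?_ ?_⟩
    · simp only [hd]; omega
    · rw [h]; exact hw
    · rw [h]; omega

/-- In a tree without leaves, any two vertices lie on a bi-infinite geodesic. -/
lemma exists_line (hT : T.IsTree) (hleaf : ∀ s t, ∃ c, T.Adj t c ∧ c ≠ s) (a b : W) :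
    ∃ γ : ℤ → W, IsLine T γ ∧ a ∈ Set.range γ ∧ b ∈ Set.range γ := by
  -- The next vertex of a walk that came to `p.2` from `p.1`: it never turns back, and it steps
  -- towards `b` whenever this is not turning back.
  have hex : ∀ p : W × W, ∃ c, T.Adj p.2 c ∧ c ≠ p.1 ∧
      ∀ c', T.Adj p.2 c' → T.dist b c' + 1 = T.dist b p.2 → c' ≠ p.1 → c = c' := by
    rintro ⟨s, t⟩
    by_cases h : ∃ c', T.Adj t c' ∧ T.dist b c' + 1 = T.dist b t ∧ c' ≠ s
    · obtain ⟨c, h1, h2, h3⟩ := h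
      exact ⟨c, h1, h3, fun c' h4 h5 _ => tree_parent_unique hT h1 h4 h2 h5⟩
    · obtain ⟨c, h1, h2⟩ := hleaf s t
      exact ⟨c, h1, h2, fun c' h3 h4 h5 => absurd ⟨c', h3, h4, h5⟩ h⟩
  choose nb hnb1 hnb2 hnb3 using hex
  let F : W × W → ℕ → W × W := fun p n => (fun p => (p.2, nb p))^[n] p
  have hF : ∀ p n, F p (n + 1) = ((F p n).2, nb (F p n)) := fun p n =>
    Function.iterate_succ_apply' _ _ _
  have hF0 : ∀ p, F p 0 = p := fun p => rfl
  obtain ⟨p, hp, hpb⟩ : ∃ p, T.Adj a p ∧ T.dist b p = T.dist b a + 1 := by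
    by_cases hab : b = a
    · obtain ⟨p, hp, -⟩ := hleaf a a
      exact ⟨p, hp, by subst hab; simp [SimpleGraph.dist_eq_one_iff_adj, hp]⟩
    · obtain ⟨r, hr, hor⟩ := tree_exists_parent hT hab
      obtain ⟨c, hc, hcr⟩ := hleaf r a
      exact ⟨c, hc, tree_dist_eq_add_one hT hr hor hc hcr⟩
  -- `A` starts as if coming from a neighbour `p` of `a` farther from `b`, and so runs to `b`. `B`
  -- starts at `a` as if coming from the second vertex of `A`, so the two rays join without
  -- backtracking.
  let A : ℕ → W × W := F (p, a)
  let B : ℕ → W × W := F ((A 1).2, a)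
  have hAB : (B 0).2 = (A 0).2 := rfl
  have hB0 : (B 0).1 = (A 1).2 := rfl
  have hA1 : ∀ n, T.Adj (A n).2 (A (n + 1)).2 := fun n => by
    show T.Adj (F (p, a) n).2 (F (p, a) (n + 1)).2
    rw [hF]; exact hnb1 _
  have hA2 : ∀ n, (A (n + 1)).2 ≠ (A n).1 := fun n => by
    show (F (p, a) (n + 1)).2 ≠ (F (p, a) n).1
    rw [hF]; exact hnb2 _
  have hA3 : ∀ n, (A (n + 1)).1 = (A n).2 := fun n => by
    show (F (p, a) (n + 1)).1 = (F (p, a) n).2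
    rw [hF]
  have hB1 : ∀ n, T.Adj (B n).2 (B (n + 1)).2 := fun n => by
    show T.Adj (F _ n).2 (F _ (n + 1)).2
    rw [hF]; exact hnb1 _
  have hB2 : ∀ n, (B (n + 1)).2 ≠ (B n).1 := fun n => by
    show (F _ (n + 1)).2 ≠ (F _ n).1
    rw [hF]; exact hnb2 _
  have hB3 : ∀ n, (B (n + 1)).1 = (B n).2 := fun n => by
    show (F _ (n + 1)).1 = (F _ n).2
    rw [hF]
  let γ : ℤ → W := fun i => match i with
    | Int.ofNat n => (A n).2
    | Int.negSucc n => (B (n + 1)).2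
  have hγA : ∀ n : ℕ, γ n = (A n).2 := fun n => rfl
  have hγB : ∀ n : ℕ, γ (-n) = (B n).2 := fun n => by
    cases n with
    | zero => rfl
    | succ n => rfl
  have hline : IsLine T γ := by
    apply isLine_of_local hT
    · intro i
      obtain ⟨n, rfl | rfl⟩ := Int.eq_nat_or_neg i
      · exact hA1 n
      · cases n with
        | zero => exact hA1 0
        | succ n =>
          have e : (-((n + 1 : ℕ) : ℤ) + 1) = -(n : ℤ) := by push_cast; ring
          rw [e, hγB, hγB]; exact (hB1 n).symm
    · intro i
      obtain ⟨n, rfl | rfl⟩ := Int.eq_nat_or_neg i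
      · have := hA2 (n + 1)
        rw [hA3] at this
        exact this.symm
      · rcases n with _ | _ | n
        · have := hA2 1
          rw [hA3] at this
          exact this.symm
        · have e : (-((0 + 1 : ℕ) : ℤ) + 1 + 1) = ((1 : ℕ) : ℤ) := by norm_num
          rw [e, hγB, hγA]
          have := hB2 0
          rwa [hB0] at this
        · have e : (-((n + 1 + 1 : ℕ) : ℤ) + 1 + 1) = -(n : ℤ) := by push_cast; ring
          rw [e, hγB, hγB]
          have := hB2 (n + 1)
          rwa [hB3] at this
  -- Until `b` is reached, the previous vertex is the farther one, so the step towards `b` is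
  -- allowed and is taken.
  have hinv : ∀ n, n ≤ T.dist b a → T.dist b (A n).2 + n = T.dist b a ∧
      T.dist b (A n).1 = T.dist b (A n).2 + 1 := by
    intro n
    induction n with
    | zero => intro _; exact ⟨rfl, hpb⟩
    | succ n ih =>
      intro hn
      obtain ⟨i1, i2⟩ := ih (by omega)
      have hne : b ≠ (A n).2 := by
        intro h; rw [← h, SimpleGraph.dist_self] at i1; omega
      obtain ⟨r, hr, hbr⟩ := tree_exists_parent hT hne
      have hr' : (A (n + 1)).2 = r := by
        show (F (p, a) (n + 1)).2 = r
        rw [hF]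
        exact hnb3 _ r hr hbr (by
          rintro rfl
          have : T.dist b (A n).1 + 1 = T.dist b (A n).2 := hbr
          omega)
      rw [hr', hA3]
      omega
  refine ⟨γ, hline, ⟨0, rfl⟩, ⟨(T.dist b a : ℕ), ?_⟩⟩
  have := (hinv (T.dist b a) le_rfl).1
  rw [hγA]
  exact (hT.1.dist_eq_zero_iff.1 (by omega)).symm

end Trees

/-! ### The graph of the model wall-tree -/

section WallTree

variable {W : Type*} {T : SimpleGraph W} {o : W}

/-- The 1-skeleton of the model wall-tree. -/
noncomputable abbrev wallGraph (T : SimpleGraph W) (o : W) : SimpleGraph (WallTreeVertex T o) :=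
  skeleton (wallTree T o).toAbstractSimplicialComplex

/-- The vertex over `t` at height `u`. -/
def wallVertex (t : W) (u : ℤ) (h : Even (u - (T.dist o t : ℤ))) : WallTreeVertex T o := ⟨(t, u), h⟩

@[simp] lemma wallVertex_fst (t : W) (u : ℤ) (h : Even (u - (T.dist o t : ℤ))) :
    (wallVertex t u h).1.1 = t := rfl

@[simp] lemma wallVertex_snd (t : W) (u : ℤ) (h : Even (u - (T.dist o t : ℤ))) :
    (wallVertex t u h).1.2 = u := rfl

lemma wall_ext {p p' : WallTreeVertex T o} (h1 : p.1.1 = p'.1.1) (h2 : p.1.2 = p'.1.2) : p = p' :=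
  Subtype.ext (Prod.ext h1 h2)

lemma wall_parity (hT : T.IsTree) (p p' : WallTreeVertex T o) :
    (p.1.2 - p'.1.2 - T.dist p.1.1 p'.1.1) % 2 = 0 := by
  have h1 := p.2
  have h2 := p'.2
  have h3 := tree_even hT o p.1.1 p'.1.1
  rw [Int.even_iff] at h1 h2
  rw [Nat.even_iff] at h3
  omega

lemma wall_parity_of (hT : T.IsTree) (p : WallTreeVertex T o) {t : W} {u : ℤ}
    (h : (p.1.2 - u - T.dist p.1.1 t) % 2 = 0) : Even (u - (T.dist o t : ℤ)) := by
  have h1 := p.2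
  have h3 := tree_even hT o p.1.1 t
  rw [Int.even_iff] at h1 ⊢
  rw [Nat.even_iff] at h3
  omega

lemma wallGraph_adj_iff_sq {p p' : WallTreeVertex T o} :
    (wallGraph T o).Adj p p' ↔ p ≠ p' ∧ wallTreeSqDist T o p p' ≤ 4 := by
  classical
  have hsymm : ∀ a b, wallTreeSqDist T o a b = wallTreeSqDist T o b a := fun a b => by
    simp only [wallTreeSqDist, T.dist_comm (u := a.1.1)]; ring
  have hself : ∀ a, wallTreeSqDist T o a a ≤ 4 := fun a => by simp [wallTreeSqDist]
  constructor
  · rintro ⟨hne, s, hs, h1, h2⟩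
    exact ⟨hne, hs.2 p h1 p' h2⟩
  · rintro ⟨hne, h⟩
    refine ⟨hne, {p, p'}, ⟨by simp, ?_⟩, by simp, by simp⟩
    intro v hv w hw
    simp only [Finset.mem_insert, Finset.mem_singleton] at hv hw
    rcases hv with rfl | rfl <;> rcases hw with rfl | rfl
    · exact hself _
    · exact h
    · rw [hsymm]; exact h
    · exact hself _

lemma wallGraph_adj_iff (hT : T.IsTree) {p p' : WallTreeVertex T o} : (wallGraph T o).Adj p p' ↔
    (p.1.1 = p'.1.1 ∧ (p.1.2 = p'.1.2 + 2 ∨ p'.1.2 = p.1.2 + 2)) ∨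
    (T.Adj p.1.1 p'.1.1 ∧ (p.1.2 = p'.1.2 + 1 ∨ p'.1.2 = p.1.2 + 1)) := by
  rw [wallGraph_adj_iff_sq]
  have hpar := wall_parity hT p p'
  constructor
  · rintro ⟨hne, h⟩
    simp only [wallTreeSqDist] at h
    generalize hk : T.dist p.1.1 p'.1.1 = k at *
    have hk1 : k ≤ 1 := by
      by_contra hcon
      push Not at hcon
      have : (2 : ℤ) ≤ k := by exact_mod_cast hcon
      nlinarith [sq_nonneg (p.1.2 - p'.1.2)]
    interval_cases k
    · left
      have ht : p.1.1 = p'.1.1 := hT.1.dist_eq_zero_iff.1 hk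
      refine ⟨ht, ?_⟩
      have h0 : p.1.2 - p'.1.2 ≠ 0 := fun h0 => hne (wall_ext ht (by omega))
      norm_num at h
      have h1 : -2 ≤ p.1.2 - p'.1.2 := by nlinarith
      have h2 : p.1.2 - p'.1.2 ≤ 2 := by nlinarith
      omega
    · right
      refine ⟨SimpleGraph.dist_eq_one_iff_adj.1 hk, ?_⟩
      norm_num at h
      have h1 : -1 ≤ p.1.2 - p'.1.2 := by nlinarith
      have h2 : p.1.2 - p'.1.2 ≤ 1 := by nlinarith
      omega
  · rintro (⟨h1, h2⟩ | ⟨h1, h2⟩)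
    · refine ⟨?_, ?_⟩
      · rintro rfl; omega
      · simp only [wallTreeSqDist, h1, SimpleGraph.dist_self]
        rcases h2 with h2 | h2 <;> rw [h2] <;> ring_nf <;> norm_num
    · refine ⟨?_, ?_⟩
      · rintro rfl; exact T.irrefl h1
      · simp only [wallTreeSqDist, SimpleGraph.dist_eq_one_iff_adj.2 h1]
        rcases h2 with h2 | h2 <;> rw [h2] <;> ring_nf <;> norm_num

/-- A slanted edge moves by one in the tree and in height, a vertical one by two in height. Slanted
edges alone suffice unless the height difference exceeds the tree distance; then vertical edges make
up for the rest. -/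
lemma wallGraph_dist_aux (hT : T.IsTree) (p p' : WallTreeVertex T o) :
    (wallGraph T o).Reachable p p' ∧ (wallGraph T o).dist p p' =
      max (T.dist p.1.1 p'.1.1) ((T.dist p.1.1 p'.1.1 + (p.1.2 - p'.1.2).natAbs) / 2) := by
  refine dist_eq_of_descent (G := wallGraph T o) (fun p' => max (T.dist p.1.1 p'.1.1)
    ((T.dist p.1.1 p'.1.1 + (p.1.2 - p'.1.2).natAbs) / 2)) (by simp) ?_ ?_ ?_ p'
  · intro v w h
    rw [wallGraph_adj_iff hT] at h
    rcases h with ⟨h1, h2⟩ | ⟨h1, h2⟩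
    · rw [h1]
      generalize T.dist p.1.1 w.1.1 = k
      omega
    · have := tree_dist_adj hT p.1.1 h1
      generalize T.dist p.1.1 w.1.1 = k at *
      generalize T.dist p.1.1 v.1.1 = l at *
      omega
  · intro v hv
    have hk : T.dist p.1.1 v.1.1 = 0 := by omega
    have hpar := wall_parity hT p v
    exact wall_ext (hT.1.dist_eq_zero_iff.1 hk).symm (by omega)
  · intro v hv
    have hpar := wall_parity hT p v
    by_cases hk : p.1.1 = v.1.1
    · rw [hk, SimpleGraph.dist_self] at hv hpar
      rcases lt_or_ge p.1.2 v.1.2 with hlt | hge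
      · refine ⟨wallVertex v.1.1 (v.1.2 - 2) (wall_parity_of hT v (by simp)), ?_, ?_⟩
        · rw [wallGraph_adj_iff hT]; left; simp
        · simp only [wallVertex_fst, wallVertex_snd, hk, SimpleGraph.dist_self]; omega
      · refine ⟨wallVertex v.1.1 (v.1.2 + 2) (wall_parity_of hT v (by simp)), ?_, ?_⟩
        · rw [wallGraph_adj_iff hT]; left; simp
        · simp only [wallVertex_fst, wallVertex_snd, hk, SimpleGraph.dist_self]; omega
    · obtain ⟨r, hr, hd⟩ := tree_exists_parent hT hk
      have hvr := SimpleGraph.dist_eq_one_iff_adj.2 hr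
      rcases lt_or_ge p.1.2 v.1.2 with hlt | hge
      · refine ⟨wallVertex r (v.1.2 - 1) (wall_parity_of hT v (by rw [hvr]; omega)), ?_, ?_⟩
        · rw [wallGraph_adj_iff hT]; right; simp [hr]
        · simp only [wallVertex_fst, wallVertex_snd]; omega
      · refine ⟨wallVertex r (v.1.2 + 1) (wall_parity_of hT v (by rw [hvr]; omega)), ?_, ?_⟩
        · rw [wallGraph_adj_iff hT]; right; simp [hr]
        · simp only [wallVertex_fst, wallVertex_snd]; omega

/-- Parity makes the division exact; the doubled form is linear and can be passed to `omega`. -/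
lemma wallGraph_dist (hT : T.IsTree) (p p' : WallTreeVertex T o) :
    2 * (wallGraph T o).dist p p' =
      max (2 * T.dist p.1.1 p'.1.1) (T.dist p.1.1 p'.1.1 + (p.1.2 - p'.1.2).natAbs) := by
  rw [(wallGraph_dist_aux hT p p').2]
  have := wall_parity hT p p'
  omega

lemma wallGraph_connected (hT : T.IsTree) : (wallGraph T o).Connected where
  preconnected p p' := (wallGraph_dist_aux hT p p').1
  nonempty := ⟨wallVertex o 0 (by simp)⟩

/-- Geodesics of the wall-tree project to geodesics of the tree. -/
lemma wall_between (hT : T.IsTree) {x y w : WallTreeVertex T o} (h : (wallGraph T o).dist x w +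
    (wallGraph T o).dist w y = (wallGraph T o).dist x y) :
    T.dist x.1.1 w.1.1 + T.dist w.1.1 y.1.1 = T.dist x.1.1 y.1.1 := by
  have h1 := wallGraph_dist hT x w
  have h2 := wallGraph_dist hT w y
  have h3 := wallGraph_dist hT x y
  have h4 := hT.1.dist_triangle (u := x.1.1) (v := w.1.1) (w := y.1.1)
  omega

/-- Lattice coordinates over a line: `(1, 0)` is an ascending slanted edge and `(0, 1)` a vertical
one. The shift `c` adjusts the parity of the heights. -/
lemma line_isFlat (hT : T.IsTree) {γ : ℤ → W} (hγ : IsLine T γ) :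
    ∃ φ : ℤ × ℤ → WallTreeVertex T o, IsFlat (wallGraph T o) φ ∧
      (∀ a b, wallTreeSqDist T o (φ a) (φ b) = 4 * latticeSqNorm (b - a)) ∧
      ∀ p : WallTreeVertex T o, p.1.1 ∈ Set.range γ → p ∈ Set.range φ := by
  have hd : ∀ i j, T.dist (γ i) (γ j) = (j - i).natAbs := hγ
  let c : ℤ := T.dist o (γ 0)
  have hpar : ∀ m n : ℤ, Even (m + 2 * n + c - (T.dist o (γ m) : ℤ)) := by
    intro m n
    have h3 := tree_even hT o (γ 0) (γ m)
    rw [hd, Nat.even_iff] at h3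
    rw [Int.even_iff]
    omega
  let φ : ℤ × ℤ → WallTreeVertex T o := fun a => wallVertex (γ a.1) (a.1 + 2 * a.2 + c) (hpar a.1 a.2)
  have hmem : ∀ p : WallTreeVertex T o, p.1.1 ∈ Set.range γ → p ∈ Set.range φ := by
    rintro p ⟨m, hm⟩
    have h1 := p.2
    have h3 := tree_even hT o (γ 0) (γ m)
    rw [← hm, Int.even_iff] at h1
    rw [hd, Nat.even_iff] at h3
    refine ⟨(m, (p.1.2 - m - c) / 2), wall_ext hm ?_⟩
    simp only [φ, wallVertex_snd]
    omega
  refine ⟨φ, ⟨fun a b => ?_, fun a b w hw => ?_⟩, fun a b => ?_, hmem⟩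
  · have := wallGraph_dist hT (φ a) (φ b)
    simp only [φ, wallVertex_fst, wallVertex_snd, hd] at this
    simp only [hexDist, Prod.fst_sub, Prod.snd_sub]
    generalize (wallGraph T o).dist _ _ = D at *
    generalize hx : b.1 - a.1 = x at *
    have e : a.1 + 2 * a.2 + c - (b.1 + 2 * b.2 + c) = -(x + 2 * (b.2 - a.2)) := by omega
    rw [e] at this
    generalize b.2 - a.2 = y at *
    omega
  · apply hmem
    have := wall_between hT hw
    exact hγ.mem_range hT this
  · simp only [φ, wallTreeSqDist, wallVertex_fst, wallVertex_snd, hd, latticeSqNorm, Prod.fst_sub,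
      Prod.snd_sub, Int.natCast_natAbs, sq_abs]
    ring

/-- Every vertex has at least three neighbours, and finitely many. -/
structure ThickTree (T : SimpleGraph W) (q : ℕ) : Prop where
  isTree : T.IsTree
  two_le : 2 ≤ q
  encard_eq : ∀ t, (T.neighborSet t).encard = q + 1

namespace ThickTree

variable {q : ℕ} (hT : ThickTree T q)
include hT

lemma finite_neighborSet (t : W) : (T.neighborSet t).Finite :=
  Set.finite_of_encard_eq_coe (k := q + 1) (by simpa using hT.encard_eq t)

lemma ncard_neighborSet (t : W) : (T.neighborSet t).ncard = q + 1 := by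
  have := hT.encard_eq t
  rw [← (hT.finite_neighborSet t).cast_ncard_eq] at this
  exact_mod_cast this

lemma exists_adj_ne (s t : W) : ∃ c, T.Adj t c ∧ c ≠ s := by
  by_contra hcon
  push Not at hcon
  have h1 := Set.ncard_le_ncard (s := T.neighborSet t) (t := {s}) (fun c hc => hcon c hc) (by simp)
  have := hT.two_le
  rw [hT.ncard_neighborSet, Set.ncard_singleton] at h1
  omega

lemma exists_flat_sq (u x y z : WallTreeVertex T o) (hxy : (wallGraph T o).Adj x y)
    (hz : z = y ∨ ((wallGraph T o).Adj x z ∧ (wallGraph T o).Adj y z)) :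
    ∃ φ, IsFlat (wallGraph T o) φ ∧
      (∀ a b, wallTreeSqDist T o (φ a) (φ b) = 4 * latticeSqNorm (b - a)) ∧
      u ∈ Set.range φ ∧ x ∈ Set.range φ ∧ y ∈ Set.range φ ∧ z ∈ Set.range φ := by
  have hTT := hT.isTree
  -- the columns of `x`, `y`, `z` are contained in an edge `{s, t}`
  obtain ⟨s, t, hst, hxs, hys, hzs⟩ : ∃ s t, (s = t ∨ T.Adj s t) ∧ (x.1.1 = s ∨ x.1.1 = t) ∧
      (y.1.1 = s ∨ y.1.1 = t) ∧ (z.1.1 = s ∨ z.1.1 = t) := by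
    rw [wallGraph_adj_iff hTT] at hxy
    rcases hz with rfl | ⟨h1, h2⟩
    · rcases hxy with ⟨h, -⟩ | ⟨h, -⟩
      · exact ⟨x.1.1, z.1.1, Or.inl h, by simp⟩
      · exact ⟨x.1.1, z.1.1, Or.inr h, by simp⟩
    · rw [wallGraph_adj_iff hTT] at h1 h2
      rcases hxy with ⟨h, -⟩ | ⟨h, -⟩
      · rcases h1 with ⟨h', -⟩ | ⟨h', -⟩
        · exact ⟨x.1.1, x.1.1, Or.inl rfl, by simp [← h, ← h']⟩
        · exact ⟨x.1.1, z.1.1, Or.inr h', by simp [← h]⟩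
      · rcases h1 with ⟨h', -⟩ | ⟨h', -⟩
        · exact ⟨x.1.1, y.1.1, Or.inr h, by simp [← h']⟩
        · rcases h2 with ⟨h'', -⟩ | ⟨h'', -⟩
          · exact ⟨x.1.1, y.1.1, Or.inr h, by simp [← h'']⟩
          -- Three different columns would form a triangle in the tree.
          · exfalso
            have e1 := SimpleGraph.dist_eq_one_iff_adj.2 h
            have e2 := SimpleGraph.dist_eq_one_iff_adj.2 h'
            have := tree_dist_adj hTT x.1.1 h''
            omega
  obtain ⟨γ, hγ, hu, hs, ht⟩ : ∃ γ, IsLine T γ ∧ u.1.1 ∈ Set.range γ ∧ s ∈ Set.range γ ∧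
      t ∈ Set.range γ := by
    -- A line through the column of `u` and the farther end of the edge also contains the nearer
    -- end.
    have key : ∀ s t, T.Adj s t → T.dist u.1.1 t = T.dist u.1.1 s + 1 → ∃ γ, IsLine T γ ∧
        u.1.1 ∈ Set.range γ ∧ s ∈ Set.range γ ∧ t ∈ Set.range γ := by
      intro s t hst hd
      obtain ⟨γ, hγ, ⟨i, hi⟩, ⟨j, hj⟩⟩ := exists_line hTT hT.exists_adj_ne u.1.1 t
      refine ⟨γ, hγ, ⟨i, hi⟩, hγ.mem_range hTT (i := i) (j := j) ?_, ⟨j, hj⟩⟩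
      rw [hi, hj, hd, SimpleGraph.dist_eq_one_iff_adj.2 hst]
    rcases hst with rfl | hst
    · obtain ⟨γ, hγ, h1, h2⟩ := exists_line hTT hT.exists_adj_ne u.1.1 s
      exact ⟨γ, hγ, h1, h2, h2⟩
    · rcases tree_dist_adj hTT u.1.1 hst with h | h
      · exact key s t hst h
      · obtain ⟨γ, hγ, h1, h2, h3⟩ := key t s hst.symm h
        exact ⟨γ, hγ, h1, h3, h2⟩
  obtain ⟨φ, hφ, hsq, hmem⟩ := line_isFlat (o := o) hTT hγ
  have hst' : ∀ r, r = s ∨ r = t → r ∈ Set.range γ := by rintro r (rfl | rfl) <;> assumption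
  exact ⟨φ, hφ, hsq, hmem u hu, hmem x (hst' _ hxs), hmem y (hst' _ hys), hmem z (hst' _ hzs)⟩

lemma flatGraph (o : W) : FlatGraph (wallGraph T o) where
  connected := wallGraph_connected hT.isTree
  exists_flat u x y z hxy hz := by
    obtain ⟨φ, hφ, -, h⟩ := hT.exists_flat_sq u x y z hxy hz
    exact ⟨φ, hφ, h⟩

lemma exists_sqDist (p p' : WallTreeVertex T o) :
    ∃ D : ℤ, SqDist (wallGraph T o) p p' D ∧ wallTreeSqDist T o p p' = 4 * D := by
  by_cases h : p = p'
  · subst h; exact ⟨0, .self, by simp [wallTreeSqDist]⟩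
  · obtain ⟨c, hc, -⟩ := (hT.flatGraph o).downSet_nonempty h
    obtain ⟨φ, hφ, hsq, ⟨a, rfl⟩, ⟨b, rfl⟩, -⟩ := hT.exists_flat_sq p p' c c hc (Or.inl rfl)
    exact ⟨_, hφ.sqDist a b, hsq a b⟩

lemma dist_eq_sqrt {p p' : WallTreeVertex T o} {D : ℤ} (h : SqDist (wallGraph T o) p p' D) :
    (wallTree T o).dist p p' = Real.sqrt D := by
  obtain ⟨D', h1, h2⟩ := hT.exists_sqDist p p'
  obtain rfl := h.unique h1
  show Real.sqrt (wallTreeSqDist T o p p') / 2 = Real.sqrt D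
  rw [h2]
  push_cast
  rw [Real.sqrt_mul (by norm_num), show (4 : ℝ) = 2 ^ 2 by norm_num, Real.sqrt_sq (by norm_num)]
  ring

lemma sqDist_nonneg {p p' : WallTreeVertex T o} {D : ℤ} (h : SqDist (wallGraph T o) p p' D) :
    0 ≤ D := by
  obtain ⟨D', h1, h2⟩ := hT.exists_sqDist p p'
  obtain rfl := h.unique h1
  have : 0 ≤ wallTreeSqDist T o p p' := by unfold wallTreeSqDist; positivity
  omega

lemma finite_wall_neighborSet (p : WallTreeVertex T o) : ((wallGraph T o).neighborSet p).Finite := by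
  have hfin : ((insert p.1.1 (T.neighborSet p.1.1)) ×ˢ
      ({p.1.2 - 2, p.1.2 - 1, p.1.2 + 1, p.1.2 + 2} : Set ℤ)).Finite :=
    ((hT.finite_neighborSet _).insert _).prod (by simp)
  refine Set.Finite.of_finite_image (f := fun p : WallTreeVertex T o => p.1)
    (hfin.subset ?_) (fun a _ b _ h => Subtype.ext h)
  rintro _ ⟨w, hw, rfl⟩
  have hw' : (wallGraph T o).Adj p w := hw
  rw [wallGraph_adj_iff hT.isTree] at hw'
  refine ⟨?_, ?_⟩
  · rcases hw' with ⟨h, -⟩ | ⟨h, -⟩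
    · exact Or.inl h.symm
    · exact Or.inr h
  · simp only [Set.mem_insert_iff, Set.mem_singleton_iff]
    rcases hw' with ⟨-, h⟩ | ⟨-, h⟩ <;> omega

lemma finite_ball (p : WallTreeVertex T o) (n : ℕ) :
    {w | (wallGraph T o).dist p w ≤ n}.Finite := by
  induction n with
  | zero =>
    refine (Set.finite_singleton p).subset (fun w hw => ?_)
    have : (wallGraph T o).dist p w = 0 := Nat.le_zero.1 hw
    exact ((hT.flatGraph o).connected.dist_eq_zero_iff.1 this).symm
  | succ n ih =>
    have : {w | (wallGraph T o).dist p w ≤ n + 1} ⊆ {w | (wallGraph T o).dist p w ≤ n} ∪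
        ⋃ u ∈ {w | (wallGraph T o).dist p w ≤ n}, (wallGraph T o).neighborSet u := by
      intro w hw
      by_cases h : p = w
      · subst h; left; simp
      · obtain ⟨c, hc, hd⟩ := (hT.flatGraph o).downSet_nonempty h
        right
        simp only [Set.mem_iUnion, exists_prop]
        have hw' : (wallGraph T o).dist p w ≤ n + 1 := hw
        exact ⟨c, show (wallGraph T o).dist p c ≤ n by omega, hc.symm⟩
    exact (ih.union (ih.biUnion fun u _ => hT.finite_wall_neighborSet u)).subset this

/-- The third vertices at a vertical edge lie in distinct neighbouring columns, at most `q + 1` in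
number. At a slanted edge there are at most two, distinguished by their heights. -/
lemma ncard_commonNeighbors_le {p p' : WallTreeVertex T o} (h : (wallGraph T o).Adj p p') :
    ((wallGraph T o).commonNeighbors p p').Finite ∧
      ((wallGraph T o).commonNeighbors p p').ncard ≤ q + 1 := by
  have hfin : ((wallGraph T o).commonNeighbors p p').Finite :=
    (hT.finite_wall_neighborSet p).subset Set.inter_subset_left
  refine ⟨hfin, ?_⟩
  have hTT := hT.isTree
  have h' := h
  rw [wallGraph_adj_iff hTT] at h'
  rcases h' with ⟨h1, h2⟩ | ⟨h1, h2⟩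
  · rw [← hT.ncard_neighborSet p.1.1]
    refine Set.ncard_le_ncard_of_injOn (fun w => w.1.1) (fun w hw => ?_) (fun w hw v hv hwv => ?_)
      (hT.finite_neighborSet _)
    · have a1 : (wallGraph T o).Adj p w := hw.1
      have a2 : (wallGraph T o).Adj p' w := hw.2
      rw [wallGraph_adj_iff hTT] at a1 a2
      rcases a1 with ⟨b1, b2⟩ | ⟨b1, b2⟩
      · rcases a2 with ⟨c1, c2⟩ | ⟨c1, c2⟩
        · omega
        · rw [← h1, b1] at c1; exact absurd c1 T.irrefl
      · exact b1
    · have a1 : (wallGraph T o).Adj p w := hw.1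
      have a2 : (wallGraph T o).Adj p' w := hw.2
      have a3 : (wallGraph T o).Adj p v := hv.1
      have a4 : (wallGraph T o).Adj p' v := hv.2
      rw [wallGraph_adj_iff hTT] at a1 a2 a3 a4
      refine wall_ext hwv ?_
      omega
  · have hle : ((wallGraph T o).commonNeighbors p p').ncard ≤
        (({p.1.2 + (p.1.2 - p'.1.2), p'.1.2 + (p'.1.2 - p.1.2)} : Set ℤ)).ncard := by
      refine Set.ncard_le_ncard_of_injOn (fun w => w.1.2) (fun w hw => ?_)
        (fun w hw v hv hwv => ?_) (by simp)
      · have a1 : (wallGraph T o).Adj p w := hw.1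
        have a2 : (wallGraph T o).Adj p' w := hw.2
        rw [wallGraph_adj_iff hTT] at a1 a2
        have hp1 := SimpleGraph.dist_eq_one_iff_adj.2 h1
        simp only [Set.mem_insert_iff, Set.mem_singleton_iff]
        rcases a1 with ⟨b1, b2⟩ | ⟨b1, b2⟩
        · rcases a2 with ⟨c1, c2⟩ | ⟨c1, c2⟩
          · rw [b1, c1, SimpleGraph.dist_self] at hp1; omega
          · omega
        · rcases a2 with ⟨c1, c2⟩ | ⟨c1, c2⟩
          · omega
          · exfalso
            have e2 := SimpleGraph.dist_eq_one_iff_adj.2 b1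
            have := tree_dist_adj hTT p.1.1 c1
            omega
      · have a1 : (wallGraph T o).Adj p w := hw.1
        have a2 : (wallGraph T o).Adj p' w := hw.2
        have a3 : (wallGraph T o).Adj p v := hv.1
        have a4 : (wallGraph T o).Adj p' v := hv.2
        rw [wallGraph_adj_iff hTT] at a1 a2 a3 a4
        have hwv' : w.1.2 = v.1.2 := hwv
        refine wall_ext ?_ hwv
        rcases a1 with ⟨b1, b2⟩ | ⟨b1, b2⟩
        · rcases a3 with ⟨c1, c2⟩ | ⟨c1, c2⟩
          · rw [← b1, ← c1]
          · omega
        · rcases a3 with ⟨c1, c2⟩ | ⟨c1, c2⟩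
          · omega
          · have hp1 := SimpleGraph.dist_eq_one_iff_adj.2 h1
            have e1 := SimpleGraph.dist_eq_one_iff_adj.2 b1
            have e2 := SimpleGraph.dist_eq_one_iff_adj.2 c1
            rcases a2 with ⟨d1, d2⟩ | ⟨d1, d2⟩
            · rcases a4 with ⟨f1, f2⟩ | ⟨f1, f2⟩
              · rw [← d1, ← f1]
              · have := tree_dist_adj hTT p.1.1 f1; omega
            · have := tree_dist_adj hTT p.1.1 d1; omega
    have h2 := Set.ncard_insert_le (p.1.2 + (p.1.2 - p'.1.2)) {p'.1.2 + (p'.1.2 - p.1.2)}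
    rw [Set.ncard_singleton] at h2
    have := hT.two_le
    omega

end ThickTree

end WallTree

/-! ### Counting extensions of local isometries -/

section Extensions

variable {V V' : Type*} {G : SimpleGraph V} {G' : SimpleGraph V'}

/-- The local isometries on `K'` that coincide with `f` outside of `K' \ K`. -/
def extensions (G : SimpleGraph V) (G' : SimpleGraph V') (f : V → V') (K K' : Set V) :
    Set (V → V') :=
  {f' | LocIsomOn G G' f' K' ∧ ∀ v, v ∉ K' \ K → f' v = f v}

/-- Every local isometry on `K` has exactly `n > 0` extensions to `K'`. -/
structure ExtNum (G : SimpleGraph V) (G' : SimpleGraph V') (K K' : Set V) (n : ℕ) : Prop where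
  subset : K ⊆ K'
  pos : 0 < n
  ncard_eq : ∀ f, LocIsomOn G G' f K → (extensions G G' f K K').ncard = n

lemma ExtNum.finite {K K' : Set V} {n : ℕ} (h : ExtNum G G' K K' n) {f : V → V'}
    (hf : LocIsomOn G G' f K) : (extensions G G' f K K').Finite :=
  Set.finite_of_ncard_pos (by rw [h.ncard_eq f hf]; exact h.pos)

lemma extNum_refl (K : Set V) : ExtNum G G' K K 1 where
  subset := le_rfl
  pos := one_pos
  ncard_eq f hf := by
    have : extensions G G' f K K = {f} := by
      ext f'
      simp only [extensions, sdiff_self, Set.bot_eq_empty, Set.mem_empty_iff_false, not_false_eq_true,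
        forall_const, Set.mem_ofPred_eq, Set.mem_singleton_iff]
      exact ⟨fun h => funext h.2, by rintro rfl; exact ⟨hf, fun _ => rfl⟩⟩
    rw [this, Set.ncard_singleton]

lemma extensions_trans {K K' K'' : Set V} (h : K ⊆ K') (h' : K' ⊆ K'') (f : V → V') :
    extensions G G' f K K'' = ⋃ f' ∈ extensions G G' f K K', extensions G G' f' K' K'' := by
  classical
  ext f''
  simp only [Set.mem_iUnion, exists_prop]
  constructor
  · rintro ⟨h1, h2⟩
    -- The intermediate map is `f''` cut off at `K'`, with the values of `f` outside as `extensions`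
    -- demands.
    refine ⟨fun v => if v ∈ K' then f'' v else f v, ⟨?_, ?_⟩, h1, ?_⟩
    · exact (h1.mono h').congr (fun v hv => by simp [hv])
    · intro v hv
      by_cases hv' : v ∈ K'
      · have : v ∈ K := by by_contra hk; exact hv ⟨hv', hk⟩
        simp only [hv', if_true]
        exact h2 v (fun h => h.2 this)
      · simp [hv']
    · intro v hv
      by_cases hv' : v ∈ K'
      · simp [hv']
      · simp only [hv', if_false]
        exact h2 v (fun h => hv ⟨h.1, hv'⟩)
  · rintro ⟨f', ⟨-, h2⟩, h3, h4⟩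
    refine ⟨h3, fun v hv => ?_⟩
    rw [h4 v (fun h5 => hv ⟨h5.1, fun h6 => h5.2 (h h6)⟩), h2 v (fun h5 => hv ⟨h' h5.1, h5.2⟩)]

lemma ExtNum.trans {K K' K'' : Set V} {n m : ℕ} (h : ExtNum G G' K K' n)
    (h' : ExtNum G G' K' K'' m) : ExtNum G G' K K'' (n * m) where
  subset := h.subset.trans h'.subset
  pos := Nat.mul_pos h.pos h'.pos
  ncard_eq f hf := by
    rw [extensions_trans h.subset h'.subset, (ncard_biUnion_const (h.finite hf)
      (fun f' hf' => h'.finite hf'.1) (fun f' hf' => h'.ncard_eq f' hf'.1) ?_).2, h.ncard_eq f hf]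
    intro f₁ hf₁ f₂ hf₂ f'' h1 h2
    funext v
    by_cases hv : v ∈ K'
    · rw [← h1.2 v (fun h => h.2 hv), h2.2 v (fun h => h.2 hv)]
    · rw [hf₁.2 v (fun h => hv h.1), hf₂.2 v (fun h => hv h.1)]

lemma locIsomOn_singleton (f : V → V') (p : V) : LocIsomOn G G' f {p} where
  adj := by rintro x rfl y rfl h; exact absurd h G.irrefl
  opp := by rintro x rfl y rfl z rfl h; exact absurd h G.irrefl
  mid := by rintro x rfl y rfl z rfl h; exact absurd h G.irrefl

/-- The condition in `ExtNum` is not vacuous: every map is a local isometry on one vertex, so a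
constant map realises both counts. -/
lemma ExtNum.unique [Nonempty V'] {p : V} {K : Set V} {n m : ℕ} (h : ExtNum G G' {p} K n)
    (h' : ExtNum G G' {p} K m) : n = m := by
  obtain ⟨v⟩ := ‹Nonempty V'›
  rw [← h.ncard_eq (fun _ => v) (locIsomOn_singleton _ p),
    h'.ncard_eq (fun _ => v) (locIsomOn_singleton _ p)]

-- An extension to one more vertex is its value there, so only admissible values have to be counted.
open Classical in
lemma ExtNum.of_insert {K : Set V} {w : V} (hw : w ∉ K) {n : ℕ} (hn : 0 < n)
    (h : ∀ f, LocIsomOn G G' f K →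
      {v' | LocIsomOn G G' (Function.update f w v') (insert w K)}.ncard = n) :
    ExtNum G G' K (insert w K) n where
  subset := Set.subset_insert _ _
  pos := hn
  ncard_eq f hf := by
    have : extensions G G' f K (insert w K) = (fun v' => Function.update f w v') ''
        {v' | LocIsomOn G G' (Function.update f w v') (insert w K)} := by
      ext f'
      constructor
      · rintro ⟨h1, h2⟩
        have : Function.update f w (f' w) = f' := by
          funext v
          by_cases hv : v = w
          · subst hv; simp
          · rw [Function.update_of_ne hv]
            refine (h2 v ?_).symm
            rintro ⟨rfl | h3, h4⟩
            · exact hv rfl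
            · exact h4 h3
        exact ⟨f' w, by rw [Set.mem_ofPred_eq, this]; exact h1, this⟩
      · rintro ⟨v', h1, rfl⟩
        refine ⟨h1, fun v hv => Function.update_of_ne ?_ _ _⟩
        rintro rfl
        exact hv ⟨Set.mem_insert _ _, hw⟩
    rw [this, Set.InjOn.ncard_image, h f hf]
    intro a _ b _ hab
    simpa using congrFun hab w

-- New conditions arise only in the link of `w`, and in the links of its neighbours with `w` as one
-- of the two vertices compared; the symmetry of `Opp` and `IsMid` covers the other order.
open Classical in
lemma LocIsomOn.insert {f : V → V'} {K : Set V} {w : V} {v' : V'} (hf : LocIsomOn G G' f K)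
    (hw : w ∉ K) (hadj : ∀ y ∈ K, G.Adj w y → G'.Adj v' (f y))
    (hopp : ∀ c ∈ K, ∀ z ∈ K, G.Adj w c → G.Adj w z → Opp G w c z → Opp G' v' (f c) (f z))
    (hmid : ∀ c ∈ K, ∀ z ∈ K, G.Adj w c → G.Adj w z → (∃ m, IsMid G w c z m) →
      ∃ m, IsMid G' v' (f c) (f z) m)
    (hopp' : ∀ y ∈ K, ∀ c ∈ K, G.Adj y c → G.Adj y w → Opp G y c w → Opp G' (f y) (f c) v')
    (hmid' : ∀ y ∈ K, ∀ c ∈ K, G.Adj y c → G.Adj y w → (∃ m, IsMid G y c w m) →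
      ∃ m, IsMid G' (f y) (f c) v' m) :
    LocIsomOn G G' (Function.update f w v') (insert w K) := by
  have e : ∀ x ∈ K, Function.update f w v' x = f x := fun x hx =>
    Function.update_of_ne (fun h : x = w => hw (h ▸ hx)) _ _
  have e' : Function.update f w v' w = v' := Function.update_self ..
  constructor
  · rintro x (rfl | hx) y (rfl | hy) h
    · exact absurd h G.irrefl
    · rw [e', e y hy]; exact hadj y hy h
    · rw [e', e x hx]; exact (hadj x hx h.symm).symm
    · rw [e x hx, e y hy]; exact hf.adj x hx y hy h
  · rintro y (rfl | hy) c (rfl | hc) z (rfl | hz) h1 h2 h3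
    · exact absurd h1 G.irrefl
    · exact absurd h1 G.irrefl
    · exact absurd h2 G.irrefl
    · rw [e', e c hc, e z hz]; exact hopp c hc z hz h1 h2 h3
    · exact absurd rfl h3.1
    · rw [e', e y hy, e z hz]; exact (hopp' y hy z hz h2 h1 h3.symm).symm
    · rw [e', e y hy, e c hc]; exact hopp' y hy c hc h1 h2 h3
    · rw [e y hy, e c hc, e z hz]; exact hf.opp y hy c hc z hz h1 h2 h3
  · rintro y (rfl | hy) c (rfl | hc) z (rfl | hz) h1 h2 ⟨m, h3⟩
    · exact absurd h1 G.irrefl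
    · exact absurd h1 G.irrefl
    · exact absurd h2 G.irrefl
    · rw [e', e c hc, e z hz]; exact hmid c hc z hz h1 h2 ⟨m, h3⟩
    · exact absurd rfl h3.1
    · rw [e', e y hy, e z hz]
      obtain ⟨m', hm'⟩ := hmid' y hy z hz h2 h1 ⟨m, h3.symm⟩
      exact ⟨m', hm'.symm⟩
    · rw [e', e y hy, e c hc]; exact hmid' y hy c hc h1 h2 ⟨m, h3⟩
    · rw [e y hy, e c hc, e z hz]; exact hf.mid y hy c hc z hz h1 h2 ⟨m, h3⟩

/-! ### Extensions to one more vertex -/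

section Generic

variable {q : ℕ} {K : Set V} {w : V}

/-- Adding a vertex whose only neighbour `y` in `K` is isolated in `K`. -/
lemma RegularFlatGraph.extNum_isolated (hG' : RegularFlatGraph G' q) [Nontrivial V'] (hw : w ∉ K)
    {y : V} (hy : y ∈ K) (hwy : G.Adj w y) (hnb : ∀ v ∈ K, G.Adj w v → v = y)
    (hiso : ∀ v ∈ K, ¬ G.Adj y v) :
    ExtNum G G' K (insert w K) (1 + (q + 1) + (q + 1) * q + q * q) := by
  classical
  refine ExtNum.of_insert hw (by positivity) (fun f hf => ?_)
  have : {v' | LocIsomOn G G' (Function.update f w v') (insert w K)} = G'.neighborSet (f y) := by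
    ext v'
    have hwy' : y ≠ w := fun h => hw (h ▸ hy)
    constructor
    · intro h
      have := h.adj y (Set.mem_insert_of_mem _ hy) w (Set.mem_insert _ _) hwy.symm
      rwa [Function.update_self, Function.update_of_ne hwy'] at this
    · intro h
      refine hf.insert hw ?_ ?_ ?_ ?_ ?_
      · intro v hv h'; rw [hnb v hv h']; exact h.symm
      · intro c hc z hz h1 h2 h3; exact absurd ((hnb c hc h1).trans (hnb z hz h2).symm) h3.1
      · rintro c hc z hz h1 h2 ⟨m, h3⟩; exact absurd ((hnb c hc h1).trans (hnb z hz h2).symm) h3.1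
      · intro v hv c hc h1 h2; rw [hnb v hv h2.symm] at h1; exact absurd h1 (hiso c hc)
      · intro v hv c hc h1 h2; rw [hnb v hv h2.symm] at h1; exact absurd h1 (hiso c hc)
  obtain ⟨x, hx⟩ := hG'.flatGraph.connected.preconnected.exists_adj_of_nontrivial (f y)
  rw [this, (hG'.ncard_neighborSet hx).2]

/-- Adding a vertex whose only neighbour `y` in `K` has in `K` exactly one neighbour, opposite to the
added vertex. -/
lemma RegularFlatGraph.extNum_end (hG' : RegularFlatGraph G' q) (hw : w ∉ K) {y x : V}
    (hy : y ∈ K) (hwy : G.Adj w y) (hnb : ∀ v ∈ K, G.Adj w v → v = y) (hx : x ∈ K)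
    (hxy : G.Adj y x) (ho : Opp G y x w) (huniq : ∀ v ∈ K, G.Adj y v → v = x) :
    ExtNum G G' K (insert w K) (q * q) := by
  classical
  have h2 := hG'.two_le
  refine ExtNum.of_insert hw (by positivity) (fun f hf => ?_)
  have : {v' | LocIsomOn G G' (Function.update f w v') (insert w K)} =
      {v' | G'.Adj (f y) v' ∧ Opp G' (f y) (f x) v'} := by
    ext v'
    have hwy' : y ≠ w := fun h => hw (h ▸ hy)
    have hwx' : x ≠ w := fun h => hw (h ▸ hx)
    constructor
    · intro h
      have h1 := h.adj y (Set.mem_insert_of_mem _ hy) w (Set.mem_insert _ _) hwy.symm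
      have h2 := h.opp y (Set.mem_insert_of_mem _ hy) x (Set.mem_insert_of_mem _ hx) w
        (Set.mem_insert _ _) hxy hwy.symm ho
      rw [Function.update_self, Function.update_of_ne hwy'] at h1 h2
      rw [Function.update_of_ne hwx'] at h2
      exact ⟨h1, h2⟩
    · rintro ⟨h, h'⟩
      refine hf.insert hw ?_ ?_ ?_ ?_ ?_
      · intro v hv h'; rw [hnb v hv h']; exact h.symm
      · intro c hc z hz h1 h2 h3; exact absurd ((hnb c hc h1).trans (hnb z hz h2).symm) h3.1
      · rintro c hc z hz h1 h2 ⟨m, h3⟩; exact absurd ((hnb c hc h1).trans (hnb z hz h2).symm) h3.1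
      · intro v hv c hc h1 h2 _
        obtain rfl := hnb v hv h2.symm
        rw [huniq c hc h1]; exact h'
      · rintro v hv c hc h1 h2 ⟨m, h3⟩
        obtain rfl := hnb v hv h2.symm
        rw [huniq c hc h1] at h3
        exact absurd h3 ho.not_isMid
  rw [this, (hG'.ncard_opp (hf.adj y hy x hx hxy)).2]

/-- The conditions at one end `y₁` of an edge `y₁ y₂` for adding a vertex adjacent to the edge. -/
lemma LocIsomOn.fold_end (hG : FlatGraph G) (hG' : FlatGraph G') {f : V → V'}
    (hf : LocIsomOn G G' f K) (hK : GConvex G K) {y₁ y₂ : V} (hy₁ : y₁ ∈ K)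
    (hy₂ : y₂ ∈ K) (h₁ : G.Adj w y₁) (h₂ : G.Adj w y₂) (h₁₂ : G.Adj y₁ y₂) {v' : V'}
    (hv₁ : G'.Adj (f y₁) v') (hv₂ : G'.Adj (f y₂) v')
    (hv : ∀ e ∈ K, e ∈ G.commonNeighbors y₁ y₂ → f e ≠ v') {x : V} (hx : x ∈ K) (hxy : G.Adj y₁ x) :
    (Opp G y₁ x w → Opp G' (f y₁) (f x) v') ∧
    ((∃ m, IsMid G y₁ x w m) → ∃ m, IsMid G' (f y₁) (f x) v' m) := by
  have a₁₂ := hf.adj _ hy₁ _ hy₂ h₁₂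
  have ax := hf.adj _ hy₁ _ hx hxy
  constructor
  · intro ho
    -- The midpoint `m` of `x` and `y₂` is a third vertex at the edge and lies in `K`. As `f m ≠
    -- v'`, the path `f x`, `f m`, `f y₂`, `v'` does not backtrack.
    obtain ⟨m, hm⟩ := hG.exists_isMid_of_opp hxy h₁.symm h₁₂ ho h₂
    have hmK := hK.mem_of_isMid hx hy₂ hm
    have hm' := hf.isMid hy₁ hx hy₂ hmK hxy h₁₂ hm
    exact hG'.opp_of_path ax hm'.2.2.1 a₁₂ hv₁ hm'.2.2.2.1 hm'.2.2.2.2 hv₂ hm'.1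
      (hv m hmK ⟨hm.2.2.1, hm.2.2.2.2.symm⟩)
  · rintro ⟨m, hm⟩
    by_cases hmy : m = y₂
    · subst hmy
      exact ⟨f m, hG'.isMid_of_path ax a₁₂ hv₁ (hf.adj _ hx _ hy₂ hm.2.2.2.1) hv₂
        (hv x hx ⟨hxy, hm.2.2.2.1.symm⟩)⟩
    -- The path `x`, `m`, `w`, `y₂` makes `x` opposite to `y₂`; then the link neighbour `v'` of `f
    -- y₂` has distance two from `f x`.
    · have ho := hG.opp_of_path hxy hm.2.2.1 h₁.symm h₁₂ hm.2.2.2.1 hm.2.2.2.2 h₂ hm.1 hmy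
      exact hG'.exists_isMid_of_opp ax a₁₂ hv₁ (hf.opp _ hy₁ _ hx _ hy₂ hxy h₁₂ ho) hv₂

/-- Adding a vertex that has exactly two neighbours, adjacent to each other, in a convex set. -/
lemma RegularFlatGraph.extNum_edge (hG : FlatGraph G) (hG' : RegularFlatGraph G' q)
    (hK : GConvex G K) (hw : w ∉ K) {y₁ y₂ : V} (hy₁ : y₁ ∈ K) (hy₂ : y₂ ∈ K) (h₁ : G.Adj w y₁)
    (h₂ : G.Adj w y₂) (h₁₂ : G.Adj y₁ y₂) (hnb : ∀ v ∈ K, G.Adj w v → v = y₁ ∨ v = y₂)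
    (hfin : (G.commonNeighbors y₁ y₂).Finite) (hcard : (G.commonNeighbors y₁ y₂).ncard ≤ q + 1) :
    ∃ n, ExtNum G G' K (insert w K) n := by
  classical
  set E := G.commonNeighbors y₁ y₂ ∩ K with hE
  have hEfin : E.Finite := hfin.subset Set.inter_subset_left
  -- Of the `q + 1` triangles at the image edge, those occupied by `E` are excluded. As `w` is a
  -- common neighbour outside `K`, at least one remains.
  have hElt : E.ncard < q + 1 := by
    refine lt_of_lt_of_le (Set.ncard_lt_ncard ?_ hfin) hcard
    refine ⟨Set.inter_subset_left, fun h => hw ?_⟩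
    exact (h (show w ∈ G.commonNeighbors y₁ y₂ from ⟨h₁.symm, h₂.symm⟩)).2
  refine ⟨q + 1 - E.ncard, ExtNum.of_insert hw (by omega) (fun f hf => ?_)⟩
  have a₁₂ := hf.adj _ hy₁ _ hy₂ h₁₂
  have hinj : Set.InjOn f E := by
    intro a ha b hb hab
    by_contra hne
    exact hf.ne hy₁ ha.2 hb.2 ha.1.1 hb.1.1 hne hab
  have hsub : f '' E ⊆ G'.commonNeighbors (f y₁) (f y₂) := by
    rintro _ ⟨e, he, rfl⟩
    exact ⟨hf.adj _ hy₁ _ he.2 he.1.1, hf.adj _ hy₂ _ he.2 he.1.2⟩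
  have : {v' | LocIsomOn G G' (Function.update f w v') (insert w K)} =
      G'.commonNeighbors (f y₁) (f y₂) \ f '' E := by
    ext v'
    have hu : ∀ x ∈ K, Function.update f w v' x = f x := fun x hx =>
      Function.update_of_ne (fun h : x = w => hw (h ▸ hx)) _ _
    have hu' : Function.update f w v' w = v' := Function.update_self ..
    constructor
    · intro h
      have b₁ := h.adj y₁ (Set.mem_insert_of_mem _ hy₁) w (Set.mem_insert _ _) h₁.symm
      have b₂ := h.adj y₂ (Set.mem_insert_of_mem _ hy₂) w (Set.mem_insert _ _) h₂.symm
      rw [hu', hu _ hy₁] at b₁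
      rw [hu', hu _ hy₂] at b₂
      refine ⟨⟨b₁, b₂⟩, ?_⟩
      rintro ⟨e, he, rfl⟩
      have := h.ne (Set.mem_insert_of_mem w hy₁) (Set.mem_insert_of_mem w he.2)
        (Set.mem_insert w K) he.1.1 h₁.symm (fun h => hw (h ▸ he.2))
      rw [hu', hu _ he.2] at this
      exact this rfl
    · rintro ⟨⟨b₁, b₂⟩, hv⟩
      have hv' : ∀ e ∈ K, e ∈ G.commonNeighbors y₁ y₂ → f e ≠ v' := fun e he he' h =>
        hv ⟨e, ⟨he', he⟩, h⟩
      have hv'' : ∀ e ∈ K, e ∈ G.commonNeighbors y₂ y₁ → f e ≠ v' := fun e he he' h =>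
        hv ⟨e, ⟨⟨he'.2, he'.1⟩, he⟩, h⟩
      have hadj : ∀ c ∈ K, ∀ z ∈ K, G.Adj w c → G.Adj w z → c = z ∨ G.Adj c z := by
        intro c hc z hz h1 h2
        rcases hnb c hc h1 with rfl | rfl <;> rcases hnb z hz h2 with rfl | rfl
        · exact .inl rfl
        · exact .inr h₁₂
        · exact .inr h₁₂.symm
        · exact .inl rfl
      refine hf.insert hw ?_ ?_ ?_ ?_ ?_
      · intro v hv h'
        rcases hnb v hv h' with rfl | rfl
        · exact b₁.symm
        · exact b₂.symm
      · intro c hc z hz h1 h2 h3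
        exact ((hadj c hc z hz h1 h2).elim h3.1 h3.2.1).elim
      · rintro c hc z hz h1 h2 ⟨m, h3⟩
        exact ((hadj c hc z hz h1 h2).elim h3.1 h3.2.1).elim
      · intro y hy c hc h1 h2 h3
        rcases hnb y hy h2.symm with rfl | rfl
        · exact (hf.fold_end hG hG'.flatGraph hK hy₁ hy₂ h₁ h₂ h₁₂ b₁ b₂ hv' hc h1).1 h3
        · exact (hf.fold_end hG hG'.flatGraph hK hy₂ hy₁ h₂ h₁ h₁₂.symm b₂ b₁ hv'' hc h1).1 h3
      · intro y hy c hc h1 h2 h3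
        rcases hnb y hy h2.symm with rfl | rfl
        · exact (hf.fold_end hG hG'.flatGraph hK hy₁ hy₂ h₁ h₂ h₁₂ b₁ b₂ hv' hc h1).2 h3
        · exact (hf.fold_end hG hG'.flatGraph hK hy₂ hy₁ h₂ h₁ h₁₂.symm b₂ b₁ hv'' hc h1).2 h3
  rw [this, Set.ncard_sdiff hsub (hEfin.image f), hG'.ncard_eq _ _ a₁₂, hinj.ncard_image]

/-- The conditions at an outer neighbour `z` of the added vertex. -/
lemma LocIsomOn.corner_end (hG : FlatGraph G) (hG' : FlatGraph G') {f : V → V'}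
    (hf : LocIsomOn G G' f K) {y z : V} (hy : y ∈ K) (hz : z ∈ K) (hwy : G.Adj w y)
    (hwz : G.Adj w z) (hyz : G.Adj y z) {v' : V'} (hv₁ : G'.Adj (f y) v') (hv₂ : G'.Adj (f z) v')
    (hv : ∀ x ∈ K, G.Adj y x → G.Adj z x → f x ≠ v') {x : V} (hx : x ∈ K) (hxz : G.Adj z x)
    (hmem : Opp G z x w → ∀ m, IsMid G z x y m → m ∈ K) :
    (Opp G z x w → Opp G' (f z) (f x) v') ∧
    ((∃ m, IsMid G z x w m) → ∃ m, IsMid G' (f z) (f x) v' m) := by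
  have ayz := hf.adj _ hy _ hz hyz
  have ax := hf.adj _ hz _ hx hxz
  constructor
  · intro ho
    obtain ⟨m, hm⟩ := hG.exists_isMid_of_opp hxz hwz.symm hyz.symm ho hwy
    have hmK := hmem ho m hm
    have hm' := hf.isMid hz hx hy hmK hxz hyz.symm hm
    exact hG'.opp_of_path ax hm'.2.2.1 ayz.symm hv₂ hm'.2.2.2.1 hm'.2.2.2.2 hv₁ hm'.1
      (hv m hmK hm.2.2.2.2.symm hm.2.2.1)
  · rintro ⟨m, hm⟩
    by_cases hmy : m = y
    · subst hmy
      exact ⟨f m, hG'.isMid_of_path ax ayz.symm hv₂ (hf.adj _ hx _ hy hm.2.2.2.1) hv₁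
        (hv x hx hm.2.2.2.1.symm hxz)⟩
    · have ho := hG.opp_of_path hxz hm.2.2.1 hwz.symm hyz.symm hm.2.2.2.1 hm.2.2.2.2 hwy hm.1 hmy
      exact hG'.exists_isMid_of_opp ax ayz.symm hv₂ (hf.opp _ hz _ hx _ hy hxz hyz.symm ho) hv₁

/-- The unique extension to a vertex `w` whose neighbours in `K` form a path `z₁`, `y`, `z₂`. -/
lemma FlatGraph.extNum_corner (hG : FlatGraph G) (hG' : FlatGraph G') (hw : w ∉ K) {y z₁ z₂ : V}
    (hy : y ∈ K) (hz₁ : z₁ ∈ K) (hz₂ : z₂ ∈ K) (hwy : G.Adj w y) (hwz₁ : G.Adj w z₁)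
    (hwz₂ : G.Adj w z₂) (hyz₁ : G.Adj y z₁) (hyz₂ : G.Adj y z₂) (hne : z₁ ≠ z₂)
    (hnb : ∀ v ∈ K, G.Adj w v → v = y ∨ v = z₁ ∨ v = z₂)
    (hmy : ∀ x ∈ K, G.Adj y x → Opp G y x w → ∀ m, IsMid G y x z₂ m → m ∈ K)
    (hm₁ : ∀ x ∈ K, G.Adj z₁ x → Opp G z₁ x w → ∀ m, IsMid G z₁ x y m → m ∈ K)
    (hm₂ : ∀ x ∈ K, G.Adj z₂ x → Opp G z₂ x w → ∀ m, IsMid G z₂ x y m → m ∈ K) :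
    ExtNum G G' K (insert w K) 1 := by
  classical
  refine ExtNum.of_insert hw one_pos (fun f hf => ?_)
  have a₁ := hf.adj _ hy _ hz₁ hyz₁
  have a₂ := hf.adj _ hy _ hz₂ hyz₂
  have hwmid : IsMid G y z₁ z₂ w := hG.isMid_of_path hyz₁ hwy.symm hyz₂ hwz₁.symm hwz₂ hne
  -- The image of `w` must be the midpoint of the images of `z₁` and `z₂`: it exists because `f` is
  -- a local isometry, and it is unique.
  obtain ⟨v, hv⟩ := hf.mid _ hy _ hz₁ _ hz₂ hyz₁ hyz₂ ⟨w, hwmid⟩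
  have b₁ := hv.2.2.2.1
  have b₂ := hv.2.2.2.2.symm
  have b := hv.2.2.1
  rw [Set.ncard_eq_one]
  refine ⟨v, Set.eq_singleton_iff_unique_mem.2 ⟨?_, ?_⟩⟩
  -- Such an `x` is opposite to `z₂` in the link of `y`, so its image is not adjacent to that of
  -- `z₂`, while `v` is.
  · have hv₁ : ∀ x ∈ K, G.Adj y x → G.Adj z₁ x → f x ≠ v := by
      intro x hx h1 h2 h3
      have ho := hG.opp_of_path h1 hyz₁ hwy.symm hyz₂ h2.symm hwz₁.symm hwz₂
        (fun h => hw (h ▸ hx)) hne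
      exact (hf.opp _ hy _ hx _ hz₂ h1 hyz₂ ho).2.1 (h3 ▸ b₂.symm)
    have hv₂ : ∀ x ∈ K, G.Adj y x → G.Adj z₂ x → f x ≠ v := by
      intro x hx h1 h2 h3
      have ho := hG.opp_of_path h1 hyz₂ hwy.symm hyz₁ h2.symm hwz₂.symm hwz₁
        (fun h => hw (h ▸ hx)) hne.symm
      exact (hf.opp _ hy _ hx _ hz₁ h1 hyz₁ ho).2.1 (h3 ▸ b₁.symm)
    have hlink : ∀ c ∈ K, ∀ z ∈ K, G.Adj w c → G.Adj w z →
        (c = z ∨ G.Adj c z) ∨ (c = z₁ ∧ z = z₂ ∨ c = z₂ ∧ z = z₁) := by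
      intro c hc z hz h1 h2
      rcases hnb c hc h1 with rfl | rfl | rfl <;> rcases hnb z hz h2 with rfl | rfl | rfl <;>
        simp [hyz₁, hyz₂, hyz₁.symm, hyz₂.symm]
    have hmid : IsMid G' v (f z₁) (f z₂) (f y) := ⟨hv.1, hv.2.1, b.symm, a₁.symm, a₂⟩
    have hwmid' : IsMid G w z₁ z₂ y := ⟨hwmid.1, hwmid.2.1, hwy, hyz₁.symm, hyz₂⟩
    refine hf.insert hw ?_ ?_ ?_ ?_ ?_
    · intro x hx h
      rcases hnb x hx h with rfl | rfl | rfl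
      exacts [b.symm, b₁.symm, b₂.symm]
    · intro c hc z hz h1 h2 h3
      rcases hlink c hc z hz h1 h2 with h4 | ⟨rfl, rfl⟩ | ⟨rfl, rfl⟩
      · exact (h4.elim h3.1 h3.2.1).elim
      · exact absurd hwmid' h3.not_isMid
      · exact absurd hwmid' h3.symm.not_isMid
    · rintro c hc z hz h1 h2 ⟨m, h3⟩
      rcases hlink c hc z hz h1 h2 with h4 | ⟨rfl, rfl⟩ | ⟨rfl, rfl⟩
      · exact (h4.elim h3.1 h3.2.1).elim
      · exact ⟨_, hmid⟩
      · exact ⟨_, hmid.symm⟩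
    · intro c hc x hx h1 h2 h3
      rcases hnb c hc h2.symm with rfl | rfl | rfl
      · obtain ⟨m, hm⟩ := hG.exists_isMid_of_opp h1 h2 hyz₂ h3 hwz₂
        have hmK := hmy x hx h1 h3 m hm
        have hm' := hf.isMid hc hx hz₂ hmK h1 hyz₂ hm
        exact hG'.opp_of_path (hf.adj _ hc _ hx h1) hm'.2.2.1 a₂ b hm'.2.2.2.1 hm'.2.2.2.2 b₂
          hm'.1 (hv₂ m hmK hm.2.2.1 hm.2.2.2.2.symm)
      · exact (hf.corner_end hG hG' hy hc hwy hwz₁ hyz₁ b b₁ hv₁ hx h1 (hm₁ x hx h1)).1 h3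
      · exact (hf.corner_end hG hG' hy hc hwy hwz₂ hyz₂ b b₂ hv₂ hx h1 (hm₂ x hx h1)).1 h3
    · intro c hc x hx h1 h2 h3
      rcases hnb c hc h2.symm with rfl | rfl | rfl
      · obtain ⟨m, hm⟩ := h3
        by_cases hmz : m = z₁
        · subst hmz
          exact ⟨f m, hG'.isMid_of_path (hf.adj _ hc _ hx h1) a₁ b (hf.adj _ hx _ hz₁ hm.2.2.2.1) b₁
            (hv₁ x hx h1 hm.2.2.2.1.symm)⟩
        · have ho := hG.opp_of_path h1 hm.2.2.1 h2 hyz₁ hm.2.2.2.1 hm.2.2.2.2 hwz₁ hm.1 hmz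
          exact hG'.exists_isMid_of_opp (hf.adj _ hc _ hx h1) a₁ b
            (hf.opp _ hc _ hx _ hz₁ h1 hyz₁ ho) b₁
      · exact (hf.corner_end hG hG' hy hc hwy hwz₁ hyz₁ b b₁ hv₁ hx h1 (hm₁ x hx h1)).2 h3
      · exact (hf.corner_end hG hG' hy hc hwy hwz₂ hyz₂ b b₂ hv₂ hx h1 (hm₂ x hx h1)).2 h3
  · intro v' h
    have hu : ∀ x ∈ K, Function.update f w v' x = f x := fun x hx =>
      Function.update_of_ne (fun h : x = w => hw (h ▸ hx)) _ _
    have hu' : Function.update f w v' w = v' := Function.update_self ..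
    have c := h.adj y (Set.mem_insert_of_mem _ hy) w (Set.mem_insert _ _) hwy.symm
    have c₁ := h.adj z₁ (Set.mem_insert_of_mem _ hz₁) w (Set.mem_insert _ _) hwz₁.symm
    have c₂ := h.adj z₂ (Set.mem_insert_of_mem _ hz₂) w (Set.mem_insert _ _) hwz₂.symm
    rw [hu', hu _ hy] at c
    rw [hu', hu _ hz₁] at c₁
    rw [hu', hu _ hz₂] at c₂
    exact hG'.isMid_unique a₁ a₂ ⟨hv.1, hv.2.1, c, c₁, c₂.symm⟩ hv

end Generic

end Extensions

/-! ### Images under local isometries -/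

section Image

variable {V V' V₂ : Type*} {G : SimpleGraph V} {G' : SimpleGraph V'} {G₂ : SimpleGraph V₂}

lemma gconvex_univ : GConvex G Set.univ := fun _ _ _ _ _ _ => trivial

lemma GConvex.inter {F F' : Set V} (h : GConvex G F) (h' : GConvex G F') : GConvex G (F ∩ F') :=
  fun x hx y hy w hw => ⟨h x hx.1 y hy.1 w hw, h' x hx.2 y hy.2 w hw⟩

/-- Go from `i z` towards `w`: the first step is also a step towards `i u`, so by `dist_downSet` it
stays in the image, and induction on the distance to `w` finishes. -/
lemma LocIsomOn.gconvex_image (hG : FlatGraph G) (hG₂ : FlatGraph G₂) {i : V → V₂} {F : Set V}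
    (hF : GConvex G F) (hi : LocIsomOn G G₂ i F) : GConvex G₂ (i '' F) := by
  rintro _ ⟨u, hu, rfl⟩ _ ⟨z, hz, rfl⟩ w hw
  obtain ⟨n, hn⟩ : ∃ n, G₂.dist w (i z) = n := ⟨_, rfl⟩
  induction n generalizing z with
  | zero =>
    rw [hG₂.connected.dist_eq_zero_iff] at hn
    exact ⟨z, hz, hn.symm⟩
  | succ n ih =>
    have hne : w ≠ i z := fun h => by rw [h, SimpleGraph.dist_self] at hn; omega
    obtain ⟨c, hc, hc'⟩ := hG₂.downSet_nonempty hne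
    have h1 := hG₂.connected.dist_triangle (u := i u) (v := c) (w := i z)
    have h2 := hG₂.connected.dist_triangle (u := i u) (v := w) (w := c)
    rw [SimpleGraph.dist_eq_one_iff_adj.2 hc.symm] at h1
    have hmem : c ∈ downSet G₂ (i u) (i z) := ⟨hc, by omega⟩
    rw [(hi.dist_downSet hG hG₂ hF hu z hz).2] at hmem
    obtain ⟨c', hc₂, rfl⟩ := hmem
    exact ih c' (hF.downSet_subset hu hz hc₂) (by omega) (by omega)

lemma LocIsomOn.adj_iff (hG : FlatGraph G) (hG₂ : FlatGraph G₂) {i : V → V₂} {F : Set V}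
    (hF : GConvex G F) (hi : LocIsomOn G G₂ i F) {x y : V} (hx : x ∈ F) (hy : y ∈ F) :
    G₂.Adj (i x) (i y) ↔ G.Adj x y := by
  rw [← SimpleGraph.dist_eq_one_iff_adj, ← SimpleGraph.dist_eq_one_iff_adj,
    (hi.dist_downSet hG hG₂ hF hx y hy).1]

lemma LocIsomOn.opp_iff {i : V → V₂} {F : Set V}
    (hi : LocIsomOn G G₂ i F) {y c z : V} (hy : y ∈ F) (hc : c ∈ F) (hz : z ∈ F)
    (h1 : G.Adj y c) (h2 : G.Adj y z) : Opp G₂ (i y) (i c) (i z) ↔ Opp G y c z := by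
  refine ⟨fun h => ?_, hi.opp y hy c hc z hz h1 h2⟩
  have h3 : ¬ G.Adj c z := fun h' => h.2.1 (hi.adj c hc z hz h')
  refine (opp_or_isMid (y := y) (fun h' => h.1 (by rw [h'])) h3).resolve_right (fun h' => ?_)
  obtain ⟨m, hm⟩ := hi.mid y hy c hc z hz h1 h2 h'
  exact h.not_isMid hm

lemma LocIsomOn.exists_mid_iff {i : V → V₂} {F : Set V}
    (hi : LocIsomOn G G₂ i F) {y c z : V} (hy : y ∈ F) (hc : c ∈ F) (hz : z ∈ F)
    (h1 : G.Adj y c) (h2 : G.Adj y z) :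
    (∃ m, IsMid G₂ (i y) (i c) (i z) m) ↔ ∃ m, IsMid G y c z m := by
  refine ⟨fun ⟨m, hm⟩ => ?_, hi.mid y hy c hc z hz h1 h2⟩
  have h3 : ¬ G.Adj c z := fun h' => hm.2.1 (hi.adj c hc z hz h')
  refine (opp_or_isMid (y := y) (fun h' => hm.1 (by rw [h'])) h3).resolve_left (fun h' => ?_)
  exact (hi.opp y hy c hc z hz h1 h2 h').not_isMid hm

lemma LocIsomOn.comp_iff (hG : FlatGraph G) (hG₂ : FlatGraph G₂) {i : V → V₂} {F : Set V}
    (hF : GConvex G F) (hi : LocIsomOn G G₂ i F) {F' : Set V} (hF' : F' ⊆ F) (f : V₂ → V') :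
    LocIsomOn G G' (f ∘ i) F' ↔ LocIsomOn G₂ G' f (i '' F') := by
  constructor
  · intro h
    constructor
    · rintro _ ⟨x, hx, rfl⟩ _ ⟨y, hy, rfl⟩ hxy
      exact h.adj x hx y hy ((hi.adj_iff hG hG₂ hF (hF' hx) (hF' hy)).1 hxy)
    · rintro _ ⟨y, hy, rfl⟩ _ ⟨c, hc, rfl⟩ _ ⟨z, hz, rfl⟩ h1 h2 ho
      rw [hi.adj_iff hG hG₂ hF (hF' hy) (hF' hc)] at h1
      rw [hi.adj_iff hG hG₂ hF (hF' hy) (hF' hz)] at h2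
      exact h.opp y hy c hc z hz h1 h2
        ((hi.opp_iff (hF' hy) (hF' hc) (hF' hz) h1 h2).1 ho)
    · rintro _ ⟨y, hy, rfl⟩ _ ⟨c, hc, rfl⟩ _ ⟨z, hz, rfl⟩ h1 h2 ho
      rw [hi.adj_iff hG hG₂ hF (hF' hy) (hF' hc)] at h1
      rw [hi.adj_iff hG hG₂ hF (hF' hy) (hF' hz)] at h2
      exact h.mid y hy c hc z hz h1 h2
        ((hi.exists_mid_iff (hF' hy) (hF' hc) (hF' hz) h1 h2).1 ho)
  · intro h
    have m := fun {x : V} (hx : x ∈ F') => Set.mem_image_of_mem i hx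
    refine ⟨fun x hx y hy hxy => h.adj _ (m hx) _ (m hy) (hi.adj x (hF' hx) y (hF' hy) hxy),
      fun y hy c hc z hz h1 h2 h3 => ?_, fun y hy c hc z hz h1 h2 h3 => ?_⟩
    · exact h.opp _ (m hy) _ (m hc) _ (m hz) (hi.adj _ (hF' hy) _ (hF' hc) h1)
        (hi.adj _ (hF' hy) _ (hF' hz) h2) (hi.opp _ (hF' hy) _ (hF' hc) _ (hF' hz) h1 h2 h3)
    · exact h.mid _ (m hy) _ (m hc) _ (m hz) (hi.adj _ (hF' hy) _ (hF' hc) h1)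
        (hi.adj _ (hF' hy) _ (hF' hz) h2) (hi.mid _ (hF' hy) _ (hF' hc) _ (hF' hz) h1 h2 h3)

/-- Numbers of extensions are invariant under local isometries of convex sets. -/
lemma ExtNum.image (hG : FlatGraph G) (hG₂ : FlatGraph G₂) {i : V → V₂} {F : Set V}
    (hF : GConvex G F) (hi : LocIsomOn G G₂ i F) {F₁ F₂ : Set V} (hF₂ : F₂ ⊆ F) {n : ℕ}
    (h : ExtNum G G' F₁ F₂ n) : ExtNum G₂ G' (i '' F₁) (i '' F₂) n where
  subset := Set.image_mono h.subset
  pos := h.pos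
  ncard_eq f hf := by
    classical
    have hinj := (hi.injOn hG hG₂ hF).mono hF₂
    have hf' := (hi.comp_iff hG hG₂ hF (h.subset.trans hF₂) f).2 hf
    rw [← h.ncard_eq _ hf']
    refine Set.ncard_congr (fun f' _ v => if v ∈ F₂ then f' (i v) else f (i v)) ?_ ?_ ?_
    · rintro f' ⟨h1, h2⟩
      refine ⟨((hi.comp_iff hG hG₂ hF hF₂ f').2 h1).congr (fun v hv => by simp [hv]), ?_⟩
      intro v hv
      by_cases hv' : v ∈ F₂
      · simp only [hv', if_true]
        refine h2 _ ?_
        rintro ⟨-, h3⟩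
        exact h3 ⟨v, by by_contra hn; exact hv ⟨hv', hn⟩, rfl⟩
      · simp [hv']
    · rintro f₁ f₂ ⟨-, h1⟩ ⟨-, h2⟩ he
      funext v
      by_cases hv : v ∈ i '' F₂
      · obtain ⟨x, hx, rfl⟩ := hv
        simpa [hx] using congrFun he x
      · rw [h1 v (fun h => hv h.1), h2 v (fun h => hv h.1)]
    · rintro g ⟨h1, h2⟩
      -- Transport `g` along `i`, and keep `f` outside the image as required of an extension.
      let j : V₂ → V' := fun v => if hv : v ∈ i '' F₂ then g hv.choose else f v
      have hj : ∀ x ∈ F₂, j (i x) = g x := by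
        intro x hx
        have hm : i x ∈ i '' F₂ := ⟨x, hx, rfl⟩
        simp only [j, hm, dif_pos]
        rw [hinj hm.choose_spec.1 hx hm.choose_spec.2]
      refine ⟨j, ⟨(hi.comp_iff hG hG₂ hF hF₂ j).1 (h1.congr fun x hx => (hj x hx).symm), ?_⟩, ?_⟩
      · intro v hv
        by_cases hv' : v ∈ i '' F₂
        · obtain ⟨x, hx, rfl⟩ := hv'
          have hx₁ : x ∈ F₁ := by
            by_contra hn
            refine hv ⟨⟨x, hx, rfl⟩, ?_⟩
            rintro ⟨x', hx', he⟩
            exact hn (hinj (h.subset hx') hx he ▸ hx')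
          rw [hj x hx, h2 x (fun h => h.2 hx₁)]; rfl
        · simp only [j, hv', dif_neg, not_false_eq_true]
      · funext v
        by_cases hv : v ∈ F₂
        · simp only [hv, if_true]; exact hj v hv
        · simp only [hv, if_false]; exact (h2 v (fun h => hv h.1)).symm

lemma locIsomOn_iso (e : G ≃g G₂) : LocIsomOn G G₂ e Set.univ where
  adj x _ y _ h := e.map_adj_iff.2 h
  opp y _ c _ z _ _ _ h := by
    refine ⟨e.injective.ne h.1, fun h' => h.2.1 (e.map_adj_iff.1 h'), fun w h1 h2 h3 => ?_⟩
    obtain ⟨w, rfl⟩ := e.surjective w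
    exact h.2.2 w (e.map_adj_iff.1 h1) (e.map_adj_iff.1 h2) (e.map_adj_iff.1 h3)
  mid y _ c _ z _ _ _ h := by
    obtain ⟨m, h⟩ := h
    exact ⟨e m, e.injective.ne h.1, fun h' => h.2.1 (e.map_adj_iff.1 h'), e.map_adj_iff.2 h.2.2.1,
      e.map_adj_iff.2 h.2.2.2.1, e.map_adj_iff.2 h.2.2.2.2⟩

/-- Vertices can be added one at a time in the order of increasing level. -/
lemma extNum_of_levels (lev : V → ℕ) {F F₂ : Set V} (hfin : F₂.Finite) {K₀ : Set V}
    (step : ∀ K w, K₀ ⊆ K → K ⊆ F₂ → w ∈ F₂ → w ∉ K → (∀ x ∈ F₂, x ∉ K → lev w ≤ lev x) →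
      (∀ v ∈ K, v ∉ F → ∀ x ∈ F₂, x ∉ K → lev v ≤ lev x) → ExtNum G G' K (insert w K) 1) :
    ∀ K, K₀ ⊆ K → K ⊆ F₂ → (∀ v ∈ K, v ∉ F → ∀ x ∈ F₂, x ∉ K → lev v ≤ lev x) →
      ExtNum G G' K F₂ 1 := by
  suffices H : ∀ n, ∀ K, (F₂ \ K).ncard = n → K₀ ⊆ K → K ⊆ F₂ →
      (∀ v ∈ K, v ∉ F → ∀ x ∈ F₂, x ∉ K → lev v ≤ lev x) → ExtNum G G' K F₂ 1 from
    fun K => H _ K rfl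
  intro n
  induction n with
  | zero =>
    intro K hn _ hK _
    rw [Set.ncard_eq_zero (hfin.subset Set.sdiff_subset), Set.sdiff_eq_empty] at hn
    rw [hK.antisymm hn]
    exact extNum_refl _
  | succ n ih =>
    intro K hn hK₀ hK hlev
    have hne : (F₂ \ K).Nonempty := by
      rw [← Set.ncard_pos (hfin.subset Set.sdiff_subset)]; omega
    obtain ⟨w, hw, hmin⟩ := Set.exists_min_image (F₂ \ K) lev (hfin.subset Set.sdiff_subset) hne
    have h1 := step K w hK₀ hK hw.1 hw.2 (fun x hx hx' => hmin x ⟨hx, hx'⟩) hlev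
    have h2 := ih (insert w K) (by
      have : F₂ \ insert w K = (F₂ \ K) \ {w} := by
        rw [Set.sdiff_sdiff, Set.union_singleton]
      rw [this, Set.ncard_sdiff_singleton_of_mem hw]; omega)
      (hK₀.trans (Set.subset_insert _ _)) (Set.insert_subset hw.1 hK) (by
        rintro v (rfl | hv) hvF x hx hxK
        · exact hmin x ⟨hx, fun h => hxK (Set.mem_insert_of_mem _ h)⟩
        · exact hlev v hv hvF x hx (fun h => hxK (Set.mem_insert_of_mem _ h)))
    simpa using h1.trans h2

end Image

/-! ### Convex sets of the wall-tree -/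

section WallConvex

variable {W : Type*} {T : SimpleGraph W} {o : W}

/-- The downward cone with apex over `n` at height `c`. A vertex on a geodesic lies, over the tree,
between `n` and one of the two ends; the distance formula then bounds its height. -/
lemma gconvex_upper (hT : T.IsTree) (n : W) (c : ℤ) :
    GConvex (wallGraph T o) {x | x.1.2 + T.dist n x.1.1 ≤ c} := by
  intro x hx y hy w hw
  rw [Set.mem_ofPred_eq] at hx hy ⊢
  have hb := wall_between hT hw
  have h1 := wallGraph_dist hT x w
  have h2 := wallGraph_dist hT w y
  have h3 := wallGraph_dist hT x y
  have h4 := hT.1.dist_triangle (u := n) (v := y.1.1) (w := w.1.1)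
  have h5 := hT.1.dist_triangle (u := n) (v := x.1.1) (w := w.1.1)
  have h6 := tree_between hT hb n
  rw [T.dist_comm (u := w.1.1) (v := x.1.1)] at h6
  rw [T.dist_comm (u := y.1.1) (v := w.1.1)] at h4
  omega

/-- The reflection of the wall-tree that exchanges up and down. -/
def wallReflect (T : SimpleGraph W) (o : W) : WallTreeVertex T o ≃ WallTreeVertex T o where
  toFun p := ⟨(p.1.1, -p.1.2), by
    have := p.2
    rw [Int.even_iff] at this ⊢
    simp only; omega⟩
  invFun p := ⟨(p.1.1, -p.1.2), by
    have := p.2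
    rw [Int.even_iff] at this ⊢
    simp only; omega⟩
  left_inv p := by apply Subtype.ext; simp
  right_inv p := by apply Subtype.ext; simp

@[simp] lemma wallReflect_fst (p : WallTreeVertex T o) : (wallReflect T o p).1.1 = p.1.1 := rfl

@[simp] lemma wallReflect_snd (p : WallTreeVertex T o) : (wallReflect T o p).1.2 = -p.1.2 := rfl

@[simp] lemma wallReflect_wallReflect (p : WallTreeVertex T o) :
    wallReflect T o (wallReflect T o p) = p := (wallReflect T o).left_inv p

/-- The reflection as an automorphism of the graph. -/
def wallReflectIso (hT : T.IsTree) (o : W) : wallGraph T o ≃g wallGraph T o where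
  toEquiv := wallReflect T o
  map_rel_iff' {a b} := by
    rw [wallGraph_adj_iff hT, wallGraph_adj_iff hT]
    simp only [wallReflect_fst, wallReflect_snd]
    have e1 : (-a.1.2 = -b.1.2 + 2 ∨ -b.1.2 = -a.1.2 + 2) ↔
      (a.1.2 = b.1.2 + 2 ∨ b.1.2 = a.1.2 + 2) := by omega
    have e2 : (-a.1.2 = -b.1.2 + 1 ∨ -b.1.2 = -a.1.2 + 1) ↔
      (a.1.2 = b.1.2 + 1 ∨ b.1.2 = a.1.2 + 1) := by omega
    rw [e1, e2]

lemma gconvex_lower (hT : T.IsTree) (n : W) (c : ℤ) :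
    GConvex (wallGraph T o) {x | c + T.dist n x.1.1 ≤ x.1.2} := by
  intro x hx y hy w hw
  rw [Set.mem_ofPred_eq] at hx hy ⊢
  have hb := wall_between hT hw
  have h1 := wallGraph_dist hT x w
  have h2 := wallGraph_dist hT w y
  have h3 := wallGraph_dist hT x y
  have h4 := hT.1.dist_triangle (u := n) (v := y.1.1) (w := w.1.1)
  have h5 := hT.1.dist_triangle (u := n) (v := x.1.1) (w := w.1.1)
  have h6 := tree_between hT hb n
  rw [T.dist_comm (u := w.1.1) (v := x.1.1)] at h6
  rw [T.dist_comm (u := y.1.1) (v := w.1.1)] at h4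
  omega

/-- By the distance formula a ball is the part of a downward and an upward cone over a ball of the
tree. -/
lemma gconvex_ball (hT : T.IsTree) (p : WallTreeVertex T o) (n : ℕ) :
    GConvex (wallGraph T o) {w | (wallGraph T o).dist p w ≤ n} := by
  have hd : GConvex (wallGraph T o) {w | T.dist p.1.1 w.1.1 ≤ n} := by
    intro x hx y hy w hw
    rw [Set.mem_ofPred_eq] at hx hy ⊢
    have := tree_between hT (wall_between hT hw) p.1.1
    omega
  convert hd.inter ((gconvex_upper hT p.1.1 (p.1.2 + 2 * n)).inter
    (gconvex_lower hT p.1.1 (p.1.2 - 2 * n))) using 1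
  ext w
  have h := wallGraph_dist hT p w
  simp only [Set.mem_ofPred_eq, Set.mem_inter_iff]
  omega

/-- The vertices in the vertical cone between two vertices of a convex set belong to it. -/
lemma GConvex.mem_of_steep (hT : T.IsTree) {F : Set (WallTreeVertex T o)}
    (hF : GConvex (wallGraph T o) F) {x p v : WallTreeVertex T o} (hx : x ∈ F) (hp : p ∈ F)
    (h : T.dist x.1.1 v.1.1 + T.dist v.1.1 p.1.1 = T.dist x.1.1 p.1.1)
    (h1 : x.1.2 + T.dist x.1.1 v.1.1 ≤ v.1.2) (h2 : v.1.2 + T.dist v.1.1 p.1.1 ≤ p.1.2) : v ∈ F := by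
  apply hF x hx p hp v
  have h3 := wallGraph_dist hT x v
  have h4 := wallGraph_dist hT v p
  have h5 := wallGraph_dist hT x p
  omega

/-- A finite convex set has a highest vertex, and lies below the cone of this vertex. -/
lemma GConvex.exists_peak (hT : T.IsTree) {F : Set (WallTreeVertex T o)}
    (hF : GConvex (wallGraph T o) F) (hfin : F.Finite) (hne : F.Nonempty) :
    ∃ p ∈ F, ∀ x ∈ F, x.1.2 + T.dist p.1.1 x.1.1 ≤ p.1.2 := by
  obtain ⟨p, hp, hmax⟩ := Set.exists_max_image F (fun p => p.1.2) hfin hne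
  refine ⟨p, hp, fun x hx => ?_⟩
  by_contra hcon
  push Not at hcon
  have hle := hmax x hx
  have hne : x.1.1 ≠ p.1.1 := fun h => by
    rw [h, SimpleGraph.dist_self] at hcon; push_cast at hcon; omega
  obtain ⟨n, hn, hd⟩ := tree_exists_parent hT hne
  have hpar := wall_parity hT p x
  have h1 := SimpleGraph.dist_eq_one_iff_adj.2 hn
  -- As `x` is above the cone, by at least two for parity reasons, a geodesic from `p` to `x` may
  -- begin with an ascending step; this contradicts maximality of `p`.
  let v : WallTreeVertex T o := wallVertex n (p.1.2 + 1) (wall_parity_of hT p (by rw [h1]; omega))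
  have hv : v ∈ F := by
    apply hF p hp x hx v
    have h3 := wallGraph_dist hT p v
    have h4 := wallGraph_dist hT v x
    have h5 := wallGraph_dist hT p x
    rw [show v.1.1 = n from rfl, show v.1.2 = p.1.2 + 1 from rfl] at h3 h4
    rw [T.dist_comm (u := x.1.1)] at hd
    rw [T.dist_comm (u := x.1.1) (v := p.1.1)] at hd
    omega
  have := hmax v hv
  simp only [v, wallVertex_snd] at this
  omega

end WallConvex

/-! ### Extension numbers of finite convex sets of the wall-tree -/

section WallSteps

variable {W : Type*} {T : SimpleGraph W} {o : W} {q : ℕ}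
  {V' : Type*} {G' : SimpleGraph V'}

namespace ThickTree

variable (hT : ThickTree T q)

include hT

/-- The corner in wall-tree coordinates: `y` and `z₁` are below and above `w` in a neighbouring
column, and `z₂` is next below `w` in its own column. `K` need not be convex while a row or column
is being filled; `hcol` and `hside` supply the few midpoints needed. -/
lemma extNum_corner (hG' : FlatGraph G') {F K : Set (WallTreeVertex T o)}
    (hF : GConvex (wallGraph T o) F) (hKF : K ⊆ F) {w y z₁ z₂ : WallTreeVertex T o} (hw : w ∉ K)
    (hy : y ∈ K) (hz₁ : z₁ ∈ K) (hz₂ : z₂ ∈ K) (hadj : T.Adj w.1.1 y.1.1) (ht₁ : z₁.1.1 = y.1.1)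
    (ht₂ : z₂.1.1 = w.1.1) (hu : y.1.2 = w.1.2 - 1) (hu₁ : z₁.1.2 = w.1.2 + 1)
    (hu₂ : z₂.1.2 = w.1.2 - 2)
    (hnb : ∀ v ∈ K, (wallGraph T o).Adj w v → v = y ∨ v = z₁ ∨ v = z₂)
    (hcol : ∀ m ∈ F, m.1.1 = y.1.1 → m ∈ K)
    (hside : ∀ x ∈ F, ∀ m ∈ F, x.1.1 = m.1.1 → m.1.1 ≠ w.1.1 → x.1.2 = w.1.2 + 2 →
      m.1.2 = w.1.2 → m ∈ K) :
    ExtNum (wallGraph T o) G' K (insert w K) 1 := by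
  have ai := fun (a b : WallTreeVertex T o) => wallGraph_adj_iff hT.isTree (p := a) (p' := b)
  have hne := hadj.ne
  have hbip : ∀ s, T.Adj s y.1.1 → T.Adj s w.1.1 → False := by
    intro s h1 h2
    have h3 := tree_even hT.isTree s y.1.1 w.1.1
    rw [SimpleGraph.dist_eq_one_iff_adj.2 h1, SimpleGraph.dist_eq_one_iff_adj.2 h2,
      SimpleGraph.dist_eq_one_iff_adj.2 hadj.symm] at h3
    exact absurd h3 (by decide)
  refine (hT.flatGraph o).extNum_corner hG' hw hy hz₁ hz₂ ((ai _ _).2 ?_) ((ai _ _).2 ?_)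
    ((ai _ _).2 ?_) ((ai _ _).2 ?_) ((ai _ _).2 ?_) ?_ hnb ?_ ?_ ?_
  · exact .inr ⟨hadj, by omega⟩
  · exact .inr ⟨ht₁ ▸ hadj, by omega⟩
  · exact .inl ⟨ht₂.symm, by omega⟩
  · exact .inl ⟨ht₁.symm, by omega⟩
  · exact .inr ⟨ht₂ ▸ hadj.symm, by omega⟩
  · rintro rfl; omega
  · intro x hx hyx ho m hm
    have hmF := hF.mem_of_isMid (hKF hx) (hKF hz₂) hm
    have h1 := (ai _ _).1 hm.2.2.1
    have h2 := (ai _ _).1 hm.2.2.2.2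
    rw [ht₂] at h2
    refine hcol m hmF ?_
    rcases h1 with h1 | h1
    · exact h1.1.symm
    · rcases h2 with h2 | h2
      · exfalso
        have hmw : m = w := wall_ext h2.1 (by omega)
        exact ho.2.1 (hmw ▸ hm.2.2.2.1)
      · exact (hbip _ h1.1.symm h2.1).elim
  · intro x hx hzx ho m hm
    have hmF := hF.mem_of_isMid (hKF hx) (hKF hy) hm
    have h1 := (ai _ _).1 hm.2.2.1
    have h2 := (ai _ _).1 hm.2.2.2.2
    have h3 := (ai _ _).1 hm.2.2.2.1
    have h4 := (ai _ _).1 hzx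
    have hmw : m ≠ w := fun h => ho.2.1 (h ▸ hm.2.2.2.1)
    have hmu : m.1.2 = w.1.2 := by
      rw [ht₁] at h1
      rcases h1 with h1 | h1
      · have := h1.1; rcases h2 with h2 | h2
        · omega
        · exact absurd (h1.1 ▸ h2.1) T.irrefl
      · rcases h2 with h2 | h2
        · exact absurd (h2.1 ▸ h1.1) T.irrefl
        · omega
    have hmt : m.1.1 ≠ w.1.1 := fun h => hmw (wall_ext h hmu)
    have hxy : x ≠ y := hm.1
    rw [ht₁] at h4
    rcases h3 with h3 | h3
    · refine hside x (hKF hx) m hmF h3.1 hmt ?_ hmu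
      omega
    · rcases h4 with h4 | h4
      · exfalso
        exact hxy (wall_ext h4.1.symm (by omega))
      · exfalso
        have h5 : T.Adj y.1.1 m.1.1 := by
          rcases h2 with h2 | h2
          · exfalso; omega
          · exact h2.1.symm
        have h6 := tree_even hT.isTree x.1.1 y.1.1 m.1.1
        rw [SimpleGraph.dist_eq_one_iff_adj.2 h3.1, SimpleGraph.dist_eq_one_iff_adj.2 h4.1.symm,
          SimpleGraph.dist_eq_one_iff_adj.2 h5] at h6
        exact absurd h6 (by decide)
  · intro x hx hzx ho m hm
    have hmF := hF.mem_of_isMid (hKF hx) (hKF hy) hm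
    have h1 := (ai _ _).1 hm.2.2.1
    have h2 := (ai _ _).1 hm.2.2.2.2
    rw [ht₂] at h1
    refine hcol m hmF ?_
    rcases h2 with h2 | h2
    · exact h2.1
    · rcases h1 with h1 | h1
      · exfalso
        have hmw : m = w := wall_ext h1.1.symm (by omega)
        exact ho.2.1 (hmw ▸ hm.2.2.2.1)
      · exact (hbip _ h2.1 h1.1.symm).elim

/-- Adding a peak `p` to a convex set that contains the vertices next to `p` in the column of `p` and
in one neighbouring column. -/
lemma extNum_insert_peak_edge (hG' : RegularFlatGraph G' q) {F : Set (WallTreeVertex T o)}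
    (hF : GConvex (wallGraph T o) F) {p y₁ y₂ : WallTreeVertex T o}
    (hcone : ∀ x ∈ F, x.1.2 + T.dist p.1.1 x.1.1 ≤ p.1.2)
    (hn : T.Adj p.1.1 y₂.1.1) (hupper : ∀ x ∈ F, x.1.2 + T.dist y₂.1.1 x.1.1 ≤ p.1.2 - 1)
    (hy₁ : y₁ ∈ F) (hy₂ : y₂ ∈ F) (ht₁ : y₁.1.1 = p.1.1) (hu₁ : y₁.1.2 = p.1.2 - 2)
    (hu₂ : y₂.1.2 = p.1.2 - 1) :
    ∃ n, ExtNum (wallGraph T o) G' F (insert p F) n := by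
  have ai := fun (a b : WallTreeVertex T o) => wallGraph_adj_iff hT.isTree (p := a) (p' := b)
  have hp : p ∉ F := fun h => by
    have h1 := hupper p h
    rw [SimpleGraph.dist_eq_one_iff_adj.2 hn.symm] at h1
    push_cast at h1; omega
  have h12 : (wallGraph T o).Adj y₁ y₂ := (ai _ _).2 (.inr ⟨ht₁ ▸ hn, by omega⟩)
  refine hG'.extNum_edge (hT.flatGraph o) hF hp hy₁ hy₂ ((ai _ _).2 ?_) ((ai _ _).2 ?_) h12 ?_
    (hT.ncard_commonNeighbors_le h12).1 (hT.ncard_commonNeighbors_le h12).2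
  · exact .inl ⟨ht₁.symm, by omega⟩
  · exact .inr ⟨hn, by omega⟩
  -- The cone of `p` leaves only lower neighbours of `p`, and the cone with apex `y₂` leaves a
  -- single one outside the column of `p`.
  · intro v hv h
    have h1 := hcone v hv
    have h2 := hupper v hv
    rcases (ai _ _).1 h with h | h
    · left
      refine wall_ext (by rw [ht₁, h.1]) ?_
      rw [← h.1, SimpleGraph.dist_self] at h1
      push_cast at h1; omega
    · right
      rw [SimpleGraph.dist_eq_one_iff_adj.2 h.1] at h1
      push_cast at h1
      have hu : v.1.2 = p.1.2 - 1 := by omega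
      refine wall_ext ?_ (by omega)
      have : T.dist y₂.1.1 v.1.1 = 0 := by omega
      exact (hT.isTree.1.dist_eq_zero_iff.1 this).symm

/-- Adding a peak to a convex set all of whose vertices lie over one vertex of the tree. -/
lemma extNum_insert_peak_column (hG' : RegularFlatGraph G' q) [Nontrivial V']
    {F : Set (WallTreeVertex T o)} {p y : WallTreeVertex T o} (hp : p ∉ F)
    (hcone : ∀ x ∈ F, x.1.1 = p.1.1 ∧ x.1.2 ≤ p.1.2) (hy : y ∈ F) (hu : y.1.2 = p.1.2 - 2) :
    ∃ n, ExtNum (wallGraph T o) G' F (insert p F) n := by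
  have ai := fun (a b : WallTreeVertex T o) => wallGraph_adj_iff hT.isTree (p := a) (p' := b)
  have hcol := fun x hx => (hcone x hx).1
  have hpy : (wallGraph T o).Adj p y := (ai _ _).2 (.inl ⟨(hcol y hy).symm, by omega⟩)
  have hnb : ∀ v ∈ F, (wallGraph T o).Adj p v → v = y := by
    intro v hv h
    have h1 := hcone v hv
    rcases (ai _ _).1 h with h | h
    · exact wall_ext ((hcol v hv).trans (hcol y hy).symm) (by omega)
    · exact absurd h.1 (by rw [h1.1]; exact T.irrefl)
  have hx : ∀ x ∈ F, (wallGraph T o).Adj y x → x.1.2 = p.1.2 - 4 := by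
    intro x hx h
    rcases (ai _ _).1 h with h | h
    · have : x ≠ p := fun h' => hp (h' ▸ hx)
      have h2 : x.1.2 ≠ p.1.2 := fun h' => this (wall_ext (hcol x hx) h')
      omega
    · exact absurd h.1 (by rw [hcol x hx, hcol y hy]; exact T.irrefl)
  -- If the column continues below `y`, the image of `p` must be opposite to the next vertex;
  -- otherwise every neighbour of the image of `y` is allowed.
  by_cases hex : ∃ x ∈ F, (wallGraph T o).Adj y x
  · obtain ⟨x, hxF, hxy⟩ := hex
    have hux := hx x hxF hxy
    refine ⟨_, hG'.extNum_end hp hy hpy hnb hxF hxy ⟨?_, ?_, ?_⟩ (fun v hv h => ?_)⟩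
    · rintro rfl; exact hp hxF
    · intro h
      exact absurd (hnb x hxF h.symm) hxy.ne'
    · intro w h1 h2 h3
      have hc := hcol x hxF
      have h2' := (ai _ _).1 h2
      have h3' := (ai _ _).1 h3
      have h1' := (ai _ _).1 h1
      rcases h2' with h2' | h2' <;> rcases h3' with h3' | h3'
      · have : w = y := wall_ext (h3'.1.trans (hcol y hy).symm) (by omega)
        exact absurd h1 (this ▸ (wallGraph T o).irrefl)
      · omega
      · omega
      · omega
    · exact wall_ext ((hcol v hv).trans (hcol x hxF).symm) (by rw [hx v hv h, hux])
  · push Not at hex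
    exact ⟨_, hG'.extNum_isolated hp hy hpy hnb hex⟩

/-- Adding a peak that is the only vertex of its column, when this column is a leaf. -/
lemma extNum_insert_peak_leaf (hG' : RegularFlatGraph G' q) [Nontrivial V']
    {F : Set (WallTreeVertex T o)} {p y : WallTreeVertex T o} (hp : p ∉ F)
    (hF : GConvex (wallGraph T o) (insert p F))
    (hcone : ∀ x ∈ F, x.1.2 + T.dist p.1.1 x.1.1 ≤ p.1.2) (hcol : ∀ x ∈ F, x.1.1 ≠ p.1.1)
    (hn : T.Adj p.1.1 y.1.1) (hleaf : ∀ x ∈ F, T.dist p.1.1 x.1.1 = T.dist y.1.1 x.1.1 + 1)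
    (hy : y ∈ F) (hu : y.1.2 = p.1.2 - 1) :
    ∃ n, ExtNum (wallGraph T o) G' F (insert p F) n := by
  have hTT := hT.isTree
  have ai := fun (a b : WallTreeVertex T o) => wallGraph_adj_iff hTT (p := a) (p' := b)
  have hpy : (wallGraph T o).Adj p y := (ai _ _).2 (.inr ⟨hn, by omega⟩)
  have hnb : ∀ v ∈ F, (wallGraph T o).Adj p v → v = y := by
    intro v hv h
    have h1 := hcone v hv
    have h2 := hleaf v hv
    rcases (ai _ _).1 h with h | h
    · exact absurd h.1.symm (hcol v hv)
    · rw [SimpleGraph.dist_eq_one_iff_adj.2 h.1] at h1 h2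
      push_cast at h1
      have : T.dist y.1.1 v.1.1 = 0 := by omega
      exact wall_ext (hTT.1.dist_eq_zero_iff.1 this).symm (by omega)
  -- the neighbours of `y` in `F` are opposite to `p`
  have hlow : ∀ v ∈ F, v.1.1 = y.1.1 → v.1.2 = p.1.2 - 3 → False := by
    intro v hv ht hu'
    let m : WallTreeVertex T o := wallVertex p.1.1 (p.1.2 - 2) (wall_parity_of hTT p (by simp))
    have hm : m ∈ insert p F := by
      refine hF.mem_of_steep hTT (x := v) (p := p) (Set.mem_insert_of_mem _ hv) (Set.mem_insert _ _)
        ?_ ?_ ?_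
      · simp [m]
      · simp only [m, wallVertex_fst, wallVertex_snd, ht, SimpleGraph.dist_eq_one_iff_adj.2 hn.symm]
        push_cast; omega
      · simp [m]
    rcases hm with hm | hm
    · have : m.1.2 = p.1.2 := by rw [hm]
      simp only [m, wallVertex_snd] at this; omega
    · exact hcol m hm rfl
  have hx : ∀ x ∈ F, (wallGraph T o).Adj y x → T.Adj y.1.1 x.1.1 ∧ x.1.2 = p.1.2 - 2 := by
    intro x hx h
    have h1 := hcone x hx
    have h2 := hleaf x hx
    rcases (ai _ _).1 h with h | h
    · exfalso
      rw [← h.1, SimpleGraph.dist_eq_one_iff_adj.2 hn] at h1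
      push_cast at h1
      exact hlow x hx h.1.symm (by omega)
    · refine ⟨h.1, ?_⟩
      rw [SimpleGraph.dist_eq_one_iff_adj.2 h.1] at h2
      omega
  by_cases hex : ∃ x ∈ F, (wallGraph T o).Adj y x
  · obtain ⟨x, hxF, hxy⟩ := hex
    obtain ⟨hxt, hxu⟩ := hx x hxF hxy
    have hd := hleaf x hxF
    rw [SimpleGraph.dist_eq_one_iff_adj.2 hxt] at hd
    refine ⟨_, hG'.extNum_end hp hy hpy hnb hxF hxy ⟨?_, ?_, ?_⟩ (fun v hv h => ?_)⟩
    · rintro rfl; exact hp hxF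
    · intro h
      exact absurd (hnb x hxF h.symm) hxy.ne'
    · intro w h1 h2 h3
      have h2' := (ai _ _).1 h2
      have h3' := (ai _ _).1 h3
      have h1' := (ai _ _).1 h1
      rcases h2' with h2' | h2' <;> rcases h3' with h3' | h3'
      · exact hcol x hxF (h2'.1.trans h3'.1)
      · rw [← h2'.1] at h3'
        have := SimpleGraph.dist_eq_one_iff_adj.2 h3'.1.symm
        omega
      · rw [h3'.1] at h2'
        have := SimpleGraph.dist_eq_one_iff_adj.2 h2'.1.symm
        omega
      · have e1 : w.1.1 = y.1.1 :=
          tree_parent_unique hTT (o := p.1.1) h2'.1 hxt.symm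
            (by rw [SimpleGraph.dist_eq_one_iff_adj.2 h3'.1.symm]; omega)
            (by rw [SimpleGraph.dist_eq_one_iff_adj.2 hn]; omega)
        rcases h1' with h1' | h1'
        · omega
        · exact absurd h1'.1 (e1 ▸ T.irrefl)
    · obtain ⟨hvt, hvu⟩ := hx v hv h
      by_contra hne
      have hne' : v.1.1 ≠ x.1.1 := fun h => hne (wall_ext h (by omega))
      -- Two neighbours of `y` in different columns would enforce, by convexity, the vertex below
      -- `y`, which `hlow` excludes.
      let m : WallTreeVertex T o := wallVertex y.1.1 (y.1.2 - 2) (wall_parity_of hTT y (by simp))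
      have hm : m ∈ insert p F := by
        refine hF v (Set.mem_insert_of_mem _ hv) x (Set.mem_insert_of_mem _ hxF) m ?_
        have h1 := wallGraph_dist hTT v m
        have h2 := wallGraph_dist hTT m x
        have h3 := wallGraph_dist hTT v x
        rw [show m.1.1 = y.1.1 from rfl, show m.1.2 = y.1.2 - 2 from rfl] at h1 h2
        rw [SimpleGraph.dist_eq_one_iff_adj.2 hvt.symm] at h1
        rw [SimpleGraph.dist_eq_one_iff_adj.2 hxt] at h2
        have h4 : T.dist v.1.1 x.1.1 = 2 :=
          dist_eq_two hne' (fun h => by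
            have h6 := tree_even hTT y.1.1 v.1.1 x.1.1
            rw [SimpleGraph.dist_eq_one_iff_adj.2 h, SimpleGraph.dist_eq_one_iff_adj.2 hvt,
              SimpleGraph.dist_eq_one_iff_adj.2 hxt] at h6
            exact absurd h6 (by decide)) hvt.symm hxt
        rw [h4] at h3
        omega
      rcases hm with hm | hm
      · have : m.1.2 = p.1.2 := by rw [hm]
        simp only [m, wallVertex_snd] at this; omega
      · exact hlow m hm rfl (by simp only [m, wallVertex_snd]; omega)
  · push Not at hex
    exact ⟨_, hG'.extNum_isolated hp hy hpy hnb hex⟩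

end ThickTree

end WallSteps

/-! ### Peeling a finite convex set down to a convex subset -/

section WallCounting

variable {W : Type*} {T : SimpleGraph W} {o : W} {q : ℕ}
  {V' : Type*} {G' : SimpleGraph V'}

/-- There is a convex set between `F₁` and `F₂`, smaller than `F₂`, from which local isometries have a
constant number of extensions to `F₂`. -/
def HasConvexStep {V : Type*} (G : SimpleGraph V) (G' : SimpleGraph V') (F₁ F₂ : Set V) : Prop :=
  ∃ F, GConvex G F ∧ F₁ ⊆ F ∧ F ⊂ F₂ ∧ ∃ n, ExtNum G G' F F₂ n

namespace ThickTree

variable (hT : ThickTree T q)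

include hT

/-- The vertices of a slanted row are determined by the first one. -/
lemma extNum_row (hG' : FlatGraph G') {F₁ F₂ : Set (WallTreeVertex T o)}
    (hF₂ : GConvex (wallGraph T o) F₂) (hfin : F₂.Finite) (h₁₂ : F₁ ⊆ F₂)
    (hcols : ∀ x ∈ F₂, ∃ x' ∈ F₁, x'.1.1 = x.1.1) {p : WallTreeVertex T o} (hp : p ∈ F₂)
    (hcone : ∀ x ∈ F₂, x.1.2 + T.dist p.1.1 x.1.1 ≤ p.1.2) {n : W} (hn : T.Adj p.1.1 n)
    (hup : ∀ x ∈ F₁, x.1.2 + T.dist n x.1.1 ≤ p.1.2 - 1) :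
    ExtNum (wallGraph T o) G' (insert p (F₂ ∩ {x | x.1.2 + T.dist n x.1.1 ≤ p.1.2 - 1})) F₂ 1 := by
  have hTT := hT.isTree
  have ai := fun (a b : WallTreeVertex T o) => wallGraph_adj_iff hTT (p := a) (p' := b)
  -- The row that is cut off lies on the surface of the cone of `p`, in the columns on the side of
  -- `p` away from `n`.
  have hrow : ∀ x ∈ F₂, ¬ x.1.2 + T.dist n x.1.1 ≤ p.1.2 - 1 →
      x.1.2 + T.dist p.1.1 x.1.1 = p.1.2 ∧ T.dist n x.1.1 = T.dist p.1.1 x.1.1 + 1 := by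
    intro x hx h
    have h1 := hcone x hx
    have h2 := wall_parity hTT p x
    have h3 := tree_dist_adj hTT x.1.1 hn
    rw [T.dist_comm (u := x.1.1) (v := n), T.dist_comm (u := x.1.1) (v := p.1.1)] at h3
    omega
  have hmemF : ∀ x ∈ F₂, x.1.2 + T.dist n x.1.1 ≤ p.1.2 - 1 →
      x ∈ F₂ ∩ {x | x.1.2 + T.dist n x.1.1 ≤ p.1.2 - 1} := fun x hx h => ⟨hx, h⟩
  -- The row is filled in the order of increasing tree distance from `p`; each new vertex is a
  -- corner.
  refine extNum_of_levels (fun x => T.dist p.1.1 x.1.1)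
    (F := F₂ ∩ {x | x.1.2 + T.dist n x.1.1 ≤ p.1.2 - 1}) hfin ?_ _ le_rfl
    (Set.insert_subset hp Set.inter_subset_left) ?_
  swap
  · rintro v (rfl | hv) hvF x hx hxK
    · simp
    · exact absurd hv hvF
  intro K w hK₀ hK hw hwK hmin hlev
  have hwF : ¬ w.1.2 + T.dist n w.1.1 ≤ p.1.2 - 1 := fun h =>
    hwK (hK₀ (Set.mem_insert_of_mem _ (hmemF w hw h)))
  obtain ⟨hwu, hwn⟩ := hrow w hw hwF
  have hwp : p.1.1 ≠ w.1.1 := by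
    intro h
    rw [← h, SimpleGraph.dist_self] at hwu
    have : w = p := wall_ext h.symm (by simpa using hwu)
    exact hwK (hK₀ (this ▸ Set.mem_insert _ _))
  obtain ⟨r, hr, hrd⟩ := tree_exists_parent hTT hwp
  have hr1 := SimpleGraph.dist_eq_one_iff_adj.2 hr
  have hmemK : ∀ x ∈ F₂, T.dist p.1.1 x.1.1 < T.dist p.1.1 w.1.1 → x ∈ K := by
    intro x hx h
    by_contra hxK
    exact absurd (hmin x hx hxK) (by omega)
  have hrn : T.dist n r = T.dist p.1.1 r + 1 := by
    have h1 := hTT.1.dist_triangle (u := n) (v := p.1.1) (w := r)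
    have h2 := hTT.1.dist_triangle (u := n) (v := r) (w := w.1.1)
    rw [SimpleGraph.dist_eq_one_iff_adj.2 hn.symm] at h1
    rw [SimpleGraph.dist_eq_one_iff_adj.2 hr.symm] at h2
    omega
  let z₁ : WallTreeVertex T o := wallVertex r (w.1.2 + 1) (wall_parity_of hTT w (by rw [hr1]; omega))
  let z₂ : WallTreeVertex T o := wallVertex w.1.1 (w.1.2 - 2) (wall_parity_of hTT w (by simp))
  let y : WallTreeVertex T o := wallVertex r (w.1.2 - 1) (wall_parity_of hTT w (by rw [hr1]; omega))
  have hz₁ : z₁ ∈ F₂ := by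
    refine hF₂.mem_of_steep hTT hw hp ?_ ?_ ?_
    · show T.dist w.1.1 r + T.dist r p.1.1 = _
      rw [T.dist_comm (u := r), T.dist_comm (u := w.1.1) (v := p.1.1)]; omega
    · show w.1.2 + T.dist w.1.1 r ≤ w.1.2 + 1
      omega
    · show w.1.2 + 1 + T.dist r p.1.1 ≤ p.1.2
      rw [T.dist_comm (u := r)]; omega
  -- The column meets `F₁`, which lies below the cone with apex at height `p.1.2 - 1` over `n`; so
  -- it contains a vertex below `w`, and convexity fills the gap.
  have hz₂ : z₂ ∈ F₂ := by
    obtain ⟨x, hx, hxt⟩ := hcols w hw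
    have h1 := hup x hx
    rw [hxt] at h1
    refine hF₂.mem_of_steep hTT (h₁₂ hx) hw ?_ ?_ ?_
    · show T.dist x.1.1 w.1.1 + T.dist w.1.1 w.1.1 = _
      simp
    · show x.1.2 + T.dist x.1.1 w.1.1 ≤ w.1.2 - 2
      rw [hxt, SimpleGraph.dist_self]; push_cast; omega
    · show w.1.2 - 2 + T.dist w.1.1 w.1.1 ≤ w.1.2
      rw [SimpleGraph.dist_self]; push_cast; omega
  have hy : y ∈ F₂ := by
    obtain ⟨x, hx, hxt⟩ := hcols z₁ hz₁
    have h1 := hup x hx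
    replace hxt : x.1.1 = r := hxt
    rw [hxt] at h1
    refine hF₂.mem_of_steep hTT (h₁₂ hx) hz₁ ?_ ?_ ?_
    · show T.dist x.1.1 r + T.dist r r = T.dist x.1.1 r
      simp
    · show x.1.2 + T.dist x.1.1 r ≤ w.1.2 - 1
      rw [hxt, SimpleGraph.dist_self]; push_cast; omega
    · show w.1.2 - 1 + T.dist r r ≤ w.1.2 + 1
      rw [SimpleGraph.dist_self]; push_cast; omega
  refine hT.extNum_corner hG' hF₂ hK (y := y) (z₁ := z₁) (z₂ := z₂) hwK
    (hmemK y hy (by show T.dist p.1.1 r < _; omega)) (hmemK z₁ hz₁ (by show T.dist p.1.1 r < _; omega))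
    (hK₀ (Set.mem_insert_of_mem _ (hmemF z₂ hz₂ ?_))) hr rfl rfl rfl rfl rfl ?_ ?_ ?_
  · show w.1.2 - 2 + T.dist n w.1.1 ≤ p.1.2 - 1
    omega
  · intro v hv h
    have h1 := hcone v (hK hv)
    rcases (ai _ _).1 h with h | h
    · right; right
      rw [← h.1] at h1
      exact wall_ext h.1.symm (by show v.1.2 = w.1.2 - 2; omega)
    · by_cases hvr : v.1.1 = r
      · rcases h.2 with h2 | h2
        · left; exact wall_ext hvr (by show v.1.2 = w.1.2 - 1; omega)
        · right; left; exact wall_ext hvr (by show v.1.2 = w.1.2 + 1; omega)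
      · exfalso
        have h2 := tree_dist_eq_add_one hTT hr hrd h.1 hvr
        have h3 : T.dist n v.1.1 = T.dist n w.1.1 + 1 :=
          tree_dist_eq_add_one hTT hr (by omega) h.1 hvr
        have h4 : v ∉ F₂ ∩ {x | x.1.2 + T.dist n x.1.1 ≤ p.1.2 - 1} := by
          rintro ⟨-, h5⟩
          rw [Set.mem_ofPred_eq] at h5
          omega
        have := hlev v hv h4 w hw hwK
        omega
  · intro m hm hmt
    refine hmemK m hm ?_
    rw [hmt]; show T.dist p.1.1 r < _; omega
  · intro x hx m hm hxm _ hxu _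
    refine hmemK m hm ?_
    have := hcone x hx
    rw [hxm] at this
    omega

/-- The step that removes the peak of `F₂` when `F₁` meets all columns of `F₂`. -/
lemma hasConvexStep_row (hG' : RegularFlatGraph G' q) [Nontrivial V']
    {F₁ F₂ : Set (WallTreeVertex T o)} (hF₁ : GConvex (wallGraph T o) F₁) (hne : F₁.Nonempty)
    (hF₂ : GConvex (wallGraph T o) F₂) (hfin : F₂.Finite) (h₁₂ : F₁ ⊆ F₂)
    (hcols : ∀ x ∈ F₂, ∃ x' ∈ F₁, x'.1.1 = x.1.1) {p : WallTreeVertex T o} (hp : p ∈ F₂)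
    (hcone : ∀ x ∈ F₂, x.1.2 + T.dist p.1.1 x.1.1 ≤ p.1.2) (hpF : p ∉ F₁) :
    HasConvexStep (wallGraph T o) G' F₁ F₂ := by
  have hTT := hT.isTree
  obtain ⟨p₁, hp₁, hcone₁⟩ := hF₁.exists_peak hTT (hfin.subset h₁₂) hne
  have hnext : ∀ x ∈ F₂, x.1.1 ≠ p.1.1 → ∃ n, T.Adj p.1.1 n ∧ T.dist x.1.1 n + 1 =
      T.dist x.1.1 p.1.1 ∧ ∃ y ∈ F₂, y.1.1 = n ∧ y.1.2 = p.1.2 - 1 := by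
    intro x hx hxp
    obtain ⟨n, hn, hd⟩ := tree_exists_parent hTT hxp
    have hn1 := SimpleGraph.dist_eq_one_iff_adj.2 hn
    have hn1' := SimpleGraph.dist_eq_one_iff_adj.2 hn.symm
    have h1 := hcone x hx
    rw [T.dist_comm] at h1
    refine ⟨n, hn, hd, wallVertex n (p.1.2 - 1) (wall_parity_of hTT p (by rw [hn1]; omega)), ?_, rfl,
      rfl⟩
    refine hF₂.mem_of_steep hTT hx hp ?_ ?_ ?_ <;> simp only [wallVertex_fst, wallVertex_snd] <;>
      omega
  -- Choose a direction `n` such that `F₁` stays below the cone with apex at height `p.1.2 - 1` over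
  -- `n`: towards the peak `p₁` of `F₁`, or any useful neighbour when `p₁` is in the column of `p`.
  obtain ⟨n, hn, hup, hdis⟩ : ∃ n, T.Adj p.1.1 n ∧
      (∀ x ∈ F₁, x.1.2 + T.dist n x.1.1 ≤ p.1.2 - 1) ∧
      ((∃ y ∈ F₂, y.1.1 = n ∧ y.1.2 = p.1.2 - 1) ∨ ∀ x ∈ F₂, x.1.1 = p.1.1) := by
    by_cases hpp : p₁.1.1 = p.1.1
    · have hu : p₁.1.2 ≤ p.1.2 - 2 := by
        have h1 := hcone p₁ (h₁₂ hp₁)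
        have h2 := wall_parity hTT p p₁
        have h3 : p₁.1.2 ≠ p.1.2 := fun h => hpF (wall_ext hpp h ▸ hp₁)
        rw [hpp, SimpleGraph.dist_self] at h1 h2
        push_cast at h1 h2
        omega
      have hup : ∀ n, T.Adj p.1.1 n → ∀ x ∈ F₁, x.1.2 + T.dist n x.1.1 ≤ p.1.2 - 1 := by
        intro n hn x hx
        have h1 := hcone₁ x hx
        have h2 := hTT.1.dist_triangle (u := n) (v := p.1.1) (w := x.1.1)
        rw [SimpleGraph.dist_eq_one_iff_adj.2 hn.symm] at h2
        rw [hpp] at h1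
        omega
      by_cases hex : ∃ x ∈ F₂, x.1.1 ≠ p.1.1
      · obtain ⟨x, hx, hxp⟩ := hex
        obtain ⟨n, hn, -, hy⟩ := hnext x hx hxp
        exact ⟨n, hn, hup n hn, .inl hy⟩
      · push Not at hex
        obtain ⟨n, hn, -⟩ := hT.exists_adj_ne p.1.1 p.1.1
        exact ⟨n, hn, hup n hn, .inr hex⟩
    · obtain ⟨n, hn, hd, hy⟩ := hnext p₁ (h₁₂ hp₁) hpp
      refine ⟨n, hn, fun x hx => ?_, .inl hy⟩
      have h1 := hcone₁ x hx
      have h2 := hTT.1.dist_triangle (u := n) (v := p₁.1.1) (w := x.1.1)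
      have h3 := hcone p₁ (h₁₂ hp₁)
      rw [T.dist_comm (u := n) (v := p₁.1.1)] at h2
      rw [T.dist_comm (u := p.1.1)] at h3
      omega
  have hn1 := SimpleGraph.dist_eq_one_iff_adj.2 hn.symm
  set F := F₂ ∩ {x | x.1.2 + T.dist n x.1.1 ≤ p.1.2 - 1} with hF
  have hFc : GConvex (wallGraph T o) F := hF₂.inter (gconvex_upper hTT n _)
  have hpF' : p ∉ F := by
    rintro ⟨-, h⟩
    rw [Set.mem_ofPred_eq, hn1] at h
    push_cast at h; omega
  refine ⟨F, hFc, fun x hx => ⟨h₁₂ hx, hup x hx⟩, ⟨Set.inter_subset_left, fun h => hpF' (h hp)⟩, ?_⟩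
  obtain ⟨y₁, hy₁, ht₁, hu₁⟩ : ∃ y₁ ∈ F, y₁.1.1 = p.1.1 ∧ y₁.1.2 = p.1.2 - 2 := by
    obtain ⟨x, hx, hxt⟩ := hcols p hp
    have h1 := hup x hx
    rw [hxt, hn1] at h1
    push_cast at h1
    refine ⟨wallVertex p.1.1 (p.1.2 - 2) (wall_parity_of hTT p (by simp)), ⟨?_, ?_⟩, rfl, rfl⟩
    · refine hF₂.mem_of_steep hTT (h₁₂ hx) hp ?_ ?_ ?_ <;>
        simp only [wallVertex_fst, wallVertex_snd, hxt, SimpleGraph.dist_self] <;> push_cast <;> omega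
    · rw [Set.mem_ofPred_eq]
      simp only [wallVertex_fst, wallVertex_snd, hn1]
      push_cast; omega
  obtain ⟨m, hm⟩ : ∃ m, ExtNum (wallGraph T o) G' F (insert p F) m := by
    rcases hdis with ⟨y₂, hy₂, rfl, hu₂⟩ | hall
    · refine hT.extNum_insert_peak_edge hG' hFc (y₁ := y₁) (y₂ := y₂) (fun x hx => hcone x hx.1) hn
        (fun x hx => hx.2) hy₁ ⟨hy₂, ?_⟩ ht₁ hu₁ hu₂
      rw [Set.mem_ofPred_eq, SimpleGraph.dist_self]; push_cast; omega
    · refine hT.extNum_insert_peak_column hG' (y := y₁) hpF' (fun x hx => ⟨hall x hx.1, ?_⟩) hy₁ hu₁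
      have := hcone x hx.1
      omega
  exact ⟨_, hm.trans (hT.extNum_row hG'.flatGraph hF₂ hfin h₁₂ hcols hp hcone hn hup)⟩

/-- The step that removes the peak of `F₂` when its column is a leaf that does not meet `F₁`. -/
lemma hasConvexStep_leaf_peak (hG' : RegularFlatGraph G' q) [Nontrivial V']
    {F₁ F₂ : Set (WallTreeVertex T o)} (hne : F₁.Nonempty)
    (hF₂ : GConvex (wallGraph T o) F₂) (h₁₂ : F₁ ⊆ F₂) {p : WallTreeVertex T o} (hp : p ∈ F₂)
    (hcone : ∀ x ∈ F₂, x.1.2 + T.dist p.1.1 x.1.1 ≤ p.1.2) {n : W} (hn : T.Adj p.1.1 n)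
    (hleaf : ∀ x ∈ F₂, x.1.1 ≠ p.1.1 → T.dist p.1.1 x.1.1 = T.dist n x.1.1 + 1)
    (hcol : ∀ x ∈ F₁, x.1.1 ≠ p.1.1) :
    HasConvexStep (wallGraph T o) G' F₁ F₂ := by
  have hTT := hT.isTree
  have hn1 := SimpleGraph.dist_eq_one_iff_adj.2 hn
  have hn1' := SimpleGraph.dist_eq_one_iff_adj.2 hn.symm
  -- As the column is a leaf, removing `p` alone amounts to intersecting with a cone, so the result
  -- is convex.
  have hF : F₂ \ {p} = F₂ ∩ {x | x.1.2 + T.dist n x.1.1 ≤ p.1.2 - 1} := by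
    ext x
    constructor
    · rintro ⟨hx, hxp⟩
      refine ⟨hx, ?_⟩
      rw [Set.mem_ofPred_eq]
      have h1 := hcone x hx
      by_cases hxt : x.1.1 = p.1.1
      · have h2 := wall_parity hTT p x
        have h3 : x.1.2 ≠ p.1.2 := fun h => hxp (wall_ext hxt h)
        rw [hxt, SimpleGraph.dist_self] at h1 h2
        rw [hxt, hn1']
        push_cast at h1 h2 ⊢
        omega
      · have := hleaf x hx hxt
        omega
    · rintro ⟨hx, hxu⟩
      refine ⟨hx, ?_⟩
      rintro rfl
      rw [Set.mem_ofPred_eq, hn1'] at hxu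
      push_cast at hxu; omega
  have hFc : GConvex (wallGraph T o) (F₂ \ {p}) := hF ▸ hF₂.inter (gconvex_upper hTT n _)
  have hins : insert p (F₂ \ {p}) = F₂ := by
    rw [Set.insert_sdiff_singleton, Set.insert_eq_of_mem hp]
  refine ⟨F₂ \ {p}, hFc, fun x hx => ⟨h₁₂ hx, fun h => hcol x hx (by rw [h])⟩,
    ⟨Set.sdiff_subset, fun h => (h hp).2 rfl⟩, ?_⟩
  obtain ⟨x, hx⟩ := hne
  have hxp := hcol x hx
  have hd := hleaf x (h₁₂ hx) hxp
  have hxc := hcone x (h₁₂ hx)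
  obtain ⟨y, hy, hyt, hyu⟩ : ∃ y ∈ F₂ \ {p}, y.1.1 = n ∧ y.1.2 = p.1.2 - 1 := by
    refine ⟨wallVertex n (p.1.2 - 1) (wall_parity_of hTT p (by rw [hn1]; omega)), ⟨?_, ?_⟩, rfl, rfl⟩
    · rw [T.dist_comm, T.dist_comm (u := n)] at hd
      rw [T.dist_comm] at hxc
      refine hF₂.mem_of_steep hTT (h₁₂ hx) hp ?_ ?_ ?_ <;> simp only [wallVertex_fst, wallVertex_snd] <;>
        omega
    · intro h
      exact hn.ne (congrArg (fun p : WallTreeVertex T o => p.1.1) h).symm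
  rw [← hins] at hF₂
  subst hyt
  suffices H : ∃ m, ExtNum (wallGraph T o) G' (F₂ \ {p}) (insert p (F₂ \ {p})) m by rwa [hins] at H
  by_cases hex : ∃ x ∈ F₂ \ {p}, x.1.1 = p.1.1
  · obtain ⟨x', hx', hxt'⟩ := hex
    have h1 := hcone x' hx'.1
    have h2 := wall_parity hTT p x'
    have h3 : x'.1.2 ≠ p.1.2 := fun h => hx'.2 (wall_ext hxt' h)
    rw [hxt', SimpleGraph.dist_self] at h1 h2
    push_cast at h1 h2
    refine hT.extNum_insert_peak_edge hG' hFc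
      (y₁ := wallVertex p.1.1 (p.1.2 - 2) (wall_parity_of hTT p (by simp))) (y₂ := y)
      (fun x hx => hcone x hx.1) hn (fun x hx => (hF.subset hx).2) ⟨?_, ?_⟩ hy rfl rfl hyu
    · rw [hins] at hF₂
      refine hF₂.mem_of_steep hTT hx'.1 hp ?_ ?_ ?_ <;>
        simp only [wallVertex_fst, wallVertex_snd, hxt', SimpleGraph.dist_self] <;> push_cast <;> omega
    · intro h
      have := congrArg (fun p : WallTreeVertex T o => p.1.2) h
      simp only [wallVertex_snd] at this
      omega
  · push Not at hex
    exact hT.extNum_insert_peak_leaf hG' (fun h => h.2 rfl) hF₂ (fun x hx => hcone x hx.1) hex hn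
      (fun x hx => hleaf x hx.1 (hex x hx)) hy hyu

/-- The step that removes a column of `F₂` that is a leaf and contains neither the highest nor the
lowest vertex. -/
lemma hasConvexStep_leaf_column (hG' : RegularFlatGraph G' q)
    {F₁ F₂ : Set (WallTreeVertex T o)} (hF₂ : GConvex (wallGraph T o) F₂) (hfin : F₂.Finite)
    (h₁₂ : F₁ ⊆ F₂) {p b : WallTreeVertex T o} (hp : p ∈ F₂)
    (hcone : ∀ x ∈ F₂, x.1.2 + T.dist p.1.1 x.1.1 ≤ p.1.2) (hb : b ∈ F₂)
    (hcone' : ∀ x ∈ F₂, b.1.2 + T.dist b.1.1 x.1.1 ≤ x.1.2) {t n : W} (hn : T.Adj t n)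
    (hleaf : ∀ x ∈ F₂, x.1.1 ≠ t → T.dist t x.1.1 = T.dist n x.1.1 + 1)
    (hcol : ∀ x ∈ F₁, x.1.1 ≠ t) (hpt : p.1.1 ≠ t) (hbt : b.1.1 ≠ t)
    (hex : ∃ x ∈ F₂, x.1.1 = t) :
    HasConvexStep (wallGraph T o) G' F₁ F₂ := by
  have hTT := hT.isTree
  have ai := fun (a b : WallTreeVertex T o) => wallGraph_adj_iff hTT (p := a) (p' := b)
  have hn1 := SimpleGraph.dist_eq_one_iff_adj.2 hn
  have hn1' := SimpleGraph.dist_eq_one_iff_adj.2 hn.symm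
  set F := F₂ ∩ {x | x.1.1 ≠ t} with hF
  have hFc : GConvex (wallGraph T o) F := by
    rintro x ⟨hx, hxt⟩ y ⟨hy, hyt⟩ w hw
    refine ⟨hF₂ x hx y hy w hw, ?_⟩
    rintro rfl
    have h1 := wall_between hTT hw
    have h2 := hleaf x hx hxt
    have h3 := hleaf y hy hyt
    have h4 := hTT.1.dist_triangle (u := x.1.1) (v := n) (w := y.1.1)
    rw [T.dist_comm (u := x.1.1) (v := n)] at h4
    rw [T.dist_comm (u := x.1.1) (v := w.1.1)] at h1
    omega
  -- the next column contains the neighbours of the column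
  have hnext : ∀ w ∈ F₂, w.1.1 = t → ∀ v : WallTreeVertex T o, v.1.1 = n →
      (v.1.2 = w.1.2 + 1 ∨ v.1.2 = w.1.2 - 1) → v ∈ F := by
    intro w hw hwt v hv hvu
    refine ⟨?_, fun h => hn.ne' (hv.symm.trans h)⟩
    have h1 := hleaf p hp hpt
    have h2 := hleaf b hb hbt
    have h3 := hcone w hw
    have h4 := hcone' w hw
    rw [hwt] at h3 h4
    rcases hvu with hvu | hvu
    · rw [T.dist_comm (u := p.1.1)] at h3
      refine hF₂.mem_of_steep hTT hw hp ?_ ?_ ?_ <;> rw [hv] <;> try rw [hwt]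
      all_goals omega
    · rw [T.dist_comm (u := b.1.1)] at h4
      rw [T.dist_comm (u := t), T.dist_comm (u := n)] at h2
      refine hF₂.mem_of_steep hTT hb hw ?_ ?_ ?_ <;> rw [hv] <;> try rw [hwt]
      all_goals try rw [T.dist_comm (u := t)] at h4
      all_goals omega
  obtain ⟨w₀, ⟨hw₀, hw₀t⟩, hmin₀⟩ := Set.exists_min_image {x | x ∈ F₂ ∧ x.1.1 = t} (fun x => x.1.2)
    (hfin.subset fun x hx => hx.1) hex
  have hw₀F : w₀ ∉ F := fun h => h.2 hw₀t
  refine ⟨F, hFc, fun x hx => ⟨h₁₂ hx, hcol x hx⟩, ⟨Set.inter_subset_left, fun h => hw₀F (h hw₀)⟩, ?_⟩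
  have hnbr : ∀ w ∈ F₂, w.1.1 = t → ∀ v ∈ F, (wallGraph T o).Adj w v →
      v.1.1 = n ∧ (v.1.2 = w.1.2 - 1 ∨ v.1.2 = w.1.2 + 1) := by
    intro w hw hwt v hv h
    rcases (ai _ _).1 h with h | h
    · exact absurd (h.1.symm.trans hwt) hv.2
    · have h1 := hleaf v hv.1 hv.2
      rw [hwt] at h
      rw [SimpleGraph.dist_eq_one_iff_adj.2 h.1] at h1
      exact ⟨(hTT.1.dist_eq_zero_iff.1 (show T.dist n v.1.1 = 0 by omega)).symm, by omega⟩
  classical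
  let up : WallTreeVertex T o → WallTreeVertex T o := fun w =>
    if h : w.1.1 = t then wallVertex n (w.1.2 + 1) (wall_parity_of hTT w (by rw [h, hn1]; omega)) else w
  let down : WallTreeVertex T o → WallTreeVertex T o := fun w =>
    if h : w.1.1 = t then wallVertex n (w.1.2 - 1) (wall_parity_of hTT w (by rw [h, hn1]; omega)) else w
  have hup : ∀ w, w.1.1 = t → (up w).1.1 = n ∧ (up w).1.2 = w.1.2 + 1 := by
    intro w h; simp [up, h]
  have hdown : ∀ w, w.1.1 = t → (down w).1.1 = n ∧ (down w).1.2 = w.1.2 - 1 := by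
    intro w h; simp [down, h]
  -- The lowest vertex of the column is attached to a vertical edge of the next column; the vertices
  -- above it are then corners and have unique images.
  obtain ⟨m, hm⟩ : ∃ m, ExtNum (wallGraph T o) G' F (insert w₀ F) m := by
    obtain ⟨u1, u2⟩ := hup w₀ hw₀t
    obtain ⟨d1, d2⟩ := hdown w₀ hw₀t
    have h12 : (wallGraph T o).Adj (up w₀) (down w₀) := (ai _ _).2 (.inl ⟨u1.trans d1.symm, by omega⟩)
    refine hG'.extNum_edge (hT.flatGraph o) hFc hw₀F (hnext w₀ hw₀ hw₀t _ u1 (.inl u2))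
      (hnext w₀ hw₀ hw₀t _ d1 (.inr d2)) ((ai _ _).2 (.inr ⟨?_, by omega⟩))
      ((ai _ _).2 (.inr ⟨?_, by omega⟩)) h12 ?_
      (hT.ncard_commonNeighbors_le h12).1 (hT.ncard_commonNeighbors_le h12).2
    · rw [u1, hw₀t]; exact hn
    · rw [d1, hw₀t]; exact hn
    · intro v hv h
      obtain ⟨h1, h2⟩ := hnbr w₀ hw₀ hw₀t v hv h
      rcases h2 with h2 | h2
      · right; exact wall_ext (h1.trans d1.symm) (by omega)
      · left; exact wall_ext (h1.trans u1.symm) (by omega)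
  refine ⟨_, hm.trans (extNum_of_levels (fun x => (x.1.2 - w₀.1.2).toNat) (F := F) hfin ?_ _ le_rfl
    (Set.insert_subset hw₀ Set.inter_subset_left) ?_)⟩
  swap
  · rintro v (rfl | hv) hvF x hx hxK
    · simp
    · exact absurd hv hvF
  intro K w hK₀ hK hw hwK hmin hlev
  have hFK : F ⊆ K := (Set.subset_insert _ _).trans hK₀
  have hmemF : ∀ x ∈ F₂, x ∉ F → x.1.1 = t := fun x hx hxF => by
    by_contra h; exact hxF ⟨hx, h⟩
  have hwt : w.1.1 = t := hmemF w hw (fun h => hwK (hFK h))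
  have hww₀ := hmin₀ w ⟨hw, hwt⟩
  have hwu : w₀.1.2 + 2 ≤ w.1.2 := by
    have h1 : w.1.2 ≠ w₀.1.2 := fun h =>
      hwK (hK₀ ((wall_ext (hwt.trans hw₀t.symm) h : w = w₀) ▸ Set.mem_insert _ _))
    have h2 := wall_parity hTT w w₀
    rw [hwt, hw₀t, SimpleGraph.dist_self] at h2
    push_cast at h2
    omega
  obtain ⟨u1, u2⟩ := hup w hwt
  obtain ⟨d1, d2⟩ := hdown w hwt
  let z₂ : WallTreeVertex T o := wallVertex w.1.1 (w.1.2 - 2) (wall_parity_of hTT w (by simp))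
  have hz₂ : z₂ ∈ F₂ := by
    refine hF₂.mem_of_steep hTT hw₀ hw ?_ ?_ ?_ <;>
      simp only [z₂, wallVertex_fst, wallVertex_snd, hw₀t, hwt, SimpleGraph.dist_self] <;>
      push_cast <;> omega
  have hz₂K : z₂ ∈ K := by
    by_contra h
    have := hmin z₂ hz₂ h
    simp only [z₂, wallVertex_snd] at this
    omega
  refine hT.extNum_corner hG'.flatGraph hF₂ hK (y := down w) (z₁ := up w) (z₂ := z₂) hwK
    (hFK (hnext w hw hwt _ d1 (.inr d2))) (hFK (hnext w hw hwt _ u1 (.inl u2))) hz₂K ?_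
    (u1.trans d1.symm) rfl d2 u2 rfl ?_ ?_ ?_
  · rw [d1, hwt]; exact hn
  · intro v hv h
    by_cases hvF : v ∈ F
    · obtain ⟨h1, h2⟩ := hnbr w hw hwt v hvF h
      rcases h2 with h2 | h2
      · left; exact wall_ext (h1.trans d1.symm) (by omega)
      · right; left; exact wall_ext (h1.trans u1.symm) (by omega)
    · have hvt := hmemF v (hK hv) hvF
      have h1 := hlev v hv hvF w hw hwK
      right; right
      rcases (ai _ _).1 h with h | h
      · exact wall_ext h.1.symm (by show v.1.2 = w.1.2 - 2; omega)
      · exact absurd h.1 (by rw [hwt, hvt]; exact T.irrefl)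
  · intro m hm hmt
    exact hFK ⟨hm, by rw [Set.mem_ofPred_eq, hmt, d1]; exact hn.ne'⟩
  · intro x hx m hm _ hmt _ _
    exact hFK ⟨hm, by rw [hwt] at hmt; exact hmt⟩

/-- Exchanging up and down turns the steps at a highest vertex into steps at a lowest one. -/
lemma hasConvexStep_reflect {F₁ F₂ : Set (WallTreeVertex T o)}
    (h : HasConvexStep (wallGraph T o) G' (wallReflect T o '' F₁) (wallReflect T o '' F₂)) :
    HasConvexStep (wallGraph T o) G' F₁ F₂ := by
  have hinv : ∀ S : Set (WallTreeVertex T o), wallReflect T o '' (wallReflect T o '' S) = S := by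
    intro S
    rw [Set.image_image]; simp
  have hloc := locIsomOn_iso (wallReflectIso hT.isTree o)
  have hfg := hT.flatGraph o
  obtain ⟨F, hF, h1, h2, n, hn⟩ := h
  refine ⟨wallReflect T o '' F, LocIsomOn.gconvex_image hfg hfg hF (hloc.mono (Set.subset_univ _)), ?_,
    ?_, n, ?_⟩
  · rw [← hinv F₁]; exact Set.image_mono h1
  · rw [← hinv F₂]; exact (wallReflect T o).injective.image_strictMono h2
  · rw [← hinv F₂]
    exact hn.image hfg hfg gconvex_univ hloc (Set.subset_univ _)

lemma gconvex_reflect {F : Set (WallTreeVertex T o)} (hF : GConvex (wallGraph T o) F) :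
    GConvex (wallGraph T o) (wallReflect T o '' F) :=
  LocIsomOn.gconvex_image (hT.flatGraph o) (hT.flatGraph o) hF
    ((locIsomOn_iso (wallReflectIso hT.isTree o)).mono (Set.subset_univ _))

/-- If `F₁` meets all columns of `F₂`, it misses the highest or the lowest vertex of `F₂`, since
otherwise convexity would fill every column; a row can be removed there. If not, a missed column as
far as possible from the peak of `F₁` is a leaf, and it is removed, or the highest or lowest vertex
of `F₂` if it is in that column. -/
lemma hasConvexStep (hG' : RegularFlatGraph G' q) [Nontrivial V']
    {F₁ F₂ : Set (WallTreeVertex T o)} (hF₁ : GConvex (wallGraph T o) F₁) (hne : F₁.Nonempty)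
    (hF₂ : GConvex (wallGraph T o) F₂) (hfin : F₂.Finite) (h₁₂ : F₁ ⊂ F₂) :
    HasConvexStep (wallGraph T o) G' F₁ F₂ := by
  have hTT := hT.isTree
  obtain ⟨p, hp, hcone⟩ := hF₂.exists_peak hTT hfin (hne.mono h₁₂.1)
  obtain ⟨b', ⟨b, hb, rfl⟩, hcone'⟩ := (hT.gconvex_reflect hF₂).exists_peak hTT (hfin.image _)
    ((hne.mono h₁₂.1).image _)
  have hconeb : ∀ x ∈ F₂, b.1.2 + T.dist b.1.1 x.1.1 ≤ x.1.2 := by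
    intro x hx
    have := hcone' _ ⟨x, hx, rfl⟩
    simp only [wallReflect_fst, wallReflect_snd] at this
    omega
  by_cases hcols : ∀ x ∈ F₂, ∃ x' ∈ F₁, x'.1.1 = x.1.1
  · by_cases hpF : p ∈ F₁
    · by_cases hbF : b ∈ F₁
      · exfalso
        refine h₁₂.2 (fun x hx => ?_)
        obtain ⟨x', hx', ht⟩ := hcols x hx
        have h1 := hcone x hx
        have h2 := hconeb x hx
        have hd : T.dist x'.1.1 x.1.1 = 0 := by rw [ht, SimpleGraph.dist_self]
        have hd' : T.dist x.1.1 x'.1.1 = 0 := by rw [ht, SimpleGraph.dist_self]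
        rcases le_total x'.1.2 x.1.2 with h | h
        · rw [T.dist_comm] at h1
          exact hF₁.mem_of_steep hTT hx' hpF (by rw [hd, ht, zero_add]) (by omega) (by omega)
        · exact hF₁.mem_of_steep hTT hbF hx' (by rw [hd', ht, add_zero]) (by omega) (by omega)
      · refine hT.hasConvexStep_reflect ?_
        refine hT.hasConvexStep_row hG' (hT.gconvex_reflect hF₁) (hne.image _)
          (hT.gconvex_reflect hF₂) (hfin.image _) (Set.image_mono h₁₂.1) ?_ ⟨b, hb, rfl⟩ hcone' ?_
        · rintro _ ⟨x, hx, rfl⟩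
          obtain ⟨x', hx', ht⟩ := hcols x hx
          exact ⟨_, ⟨x', hx', rfl⟩, ht⟩
        · rintro ⟨b₂, hb₂, he⟩
          exact hbF ((wallReflect T o).injective he ▸ hb₂)
    · exact hT.hasConvexStep_row hG' hF₁ hne hF₂ hfin h₁₂.1 hcols hp hcone hpF
  · push Not at hcols
    obtain ⟨p₁, hp₁, hcone₁⟩ := hF₁.exists_peak hTT (hfin.subset h₁₂.1) hne
    obtain ⟨w, ⟨hw, hwcol⟩, hmax⟩ := Set.exists_max_image
      {x | x ∈ F₂ ∧ ∀ x' ∈ F₁, x'.1.1 ≠ x.1.1} (fun x => T.dist p₁.1.1 x.1.1)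
      (hfin.subset fun x hx => hx.1) hcols
    obtain ⟨n, hn, hnd⟩ := tree_exists_parent hTT (hwcol p₁ hp₁)
    have hleaf : ∀ x ∈ F₂, x.1.1 ≠ w.1.1 → T.dist w.1.1 x.1.1 = T.dist n x.1.1 + 1 := by
      intro x hx hxw
      have h1 := tree_dist_adj hTT x.1.1 hn
      rw [T.dist_comm (u := x.1.1), T.dist_comm (u := x.1.1)] at h1
      refine h1.resolve_left (fun h2 => ?_)
      -- `w` lies between `p₁` and `x`
      obtain ⟨a, ha, had⟩ := tree_exists_parent hTT hxw
      have han : a ≠ n := by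
        rintro rfl
        rw [T.dist_comm (u := x.1.1), T.dist_comm (u := x.1.1)] at had
        omega
      have h3 := tree_dist_add hTT (o := p₁.1.1) (x := x.1.1) _ w.1.1 a n rfl ha had hn hnd han
      have h4 : 0 < T.dist w.1.1 x.1.1 := hTT.1.pos_dist_of_ne hxw.symm
      by_cases hxcol : ∀ x' ∈ F₁, x'.1.1 ≠ x.1.1
      · have := hmax x ⟨hx, hxcol⟩
        omega
      -- If `F₁` meets the column of `x`, convexity between this vertex and the peak `p₁` forces a
      -- vertex over the missed column of `w`.
      · push Not at hxcol
        obtain ⟨x', hx', ht⟩ := hxcol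
        have h5 := hcone₁ x' hx'
        rw [ht] at h5
        have h6 := wall_parity hTT p₁ x'
        let v : WallTreeVertex T o := wallVertex w.1.1 (p₁.1.2 - T.dist p₁.1.1 w.1.1)
          (wall_parity_of hTT p₁ (by omega))
        refine hwcol v ?_ rfl
        have c₁ := T.dist_comm (u := p₁.1.1) (v := x.1.1)
        have c₂ := T.dist_comm (u := p₁.1.1) (v := w.1.1)
        have c₃ := T.dist_comm (u := x.1.1) (v := w.1.1)
        refine hF₁.mem_of_steep hTT hx' hp₁ ?_ ?_ ?_
        · show T.dist x'.1.1 w.1.1 + T.dist w.1.1 p₁.1.1 = _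
          rw [ht]; omega
        · show x'.1.2 + T.dist x'.1.1 w.1.1 ≤ p₁.1.2 - T.dist p₁.1.1 w.1.1
          rw [ht]; omega
        · show p₁.1.2 - T.dist p₁.1.1 w.1.1 + T.dist w.1.1 p₁.1.1 ≤ p₁.1.2
          omega
    by_cases hpw : p.1.1 = w.1.1
    · rw [← hpw] at hn hleaf hwcol
      exact hT.hasConvexStep_leaf_peak hG' hne hF₂ h₁₂.1 hp hcone hn hleaf hwcol
    by_cases hbw : b.1.1 = w.1.1
    · rw [← hbw] at hn hleaf hwcol
      refine hT.hasConvexStep_reflect ?_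
      refine hT.hasConvexStep_leaf_peak hG' (hne.image _) (hT.gconvex_reflect hF₂)
        (Set.image_mono h₁₂.1) ⟨b, hb, rfl⟩ hcone' hn ?_ ?_
      · rintro _ ⟨x, hx, rfl⟩ h
        exact hleaf x hx h
      · rintro _ ⟨x, hx, rfl⟩ h
        exact hwcol x hx h
    · exact hT.hasConvexStep_leaf_column hG' hF₂ hfin h₁₂.1 hp hcone hb hconeb hn hleaf hwcol hpw hbw
        ⟨w, hw, rfl⟩

/-- Local isometries on a finite convex set have a constant number of extensions to a larger finite
convex set. -/
theorem exists_extNum (hG' : RegularFlatGraph G' q) [Nontrivial V']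
    {F₁ F₂ : Set (WallTreeVertex T o)} (hF₁ : GConvex (wallGraph T o) F₁) (hne : F₁.Nonempty)
    (hF₂ : GConvex (wallGraph T o) F₂) (hfin : F₂.Finite) (h₁₂ : F₁ ⊆ F₂) :
    ∃ n, ExtNum (wallGraph T o) G' F₁ F₂ n := by
  induction hk : F₂.ncard using Nat.strong_induction_on generalizing F₂ with
  | _ k ih =>
    rcases h₁₂.eq_or_ssubset with rfl | h
    · exact ⟨1, extNum_refl _⟩
    · obtain ⟨F, hF, h1, h2, n, hn⟩ := hT.hasConvexStep hG' hF₁ hne hF₂ hfin h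
      obtain ⟨m, hm⟩ := ih _ (hk ▸ Set.ncard_lt_ncard h2 hfin) hF (hfin.subset h2.1) h1 rfl
      exact ⟨_, hm.trans hn⟩

end ThickTree

end WallCounting

/-! ### Base points -/

section BasePoint

lemma gconvex_singleton {V : Type*} {G : SimpleGraph V} (hG : G.Connected) (p : V) :
    GConvex G {p} := by
  rintro x rfl y rfl w hw
  rw [SimpleGraph.dist_self] at hw
  exact (hG.dist_eq_zero_iff.1 (show G.dist y w = 0 by omega)).symm

lemma gconvex_pair {V : Type*} {G : SimpleGraph V} (hG : G.Connected) {p p' : V} (h : G.Adj p p') :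
    GConvex G {p, p'} := by
  have key : ∀ x y w : V, G.dist x y ≤ 1 → G.dist x w + G.dist w y = G.dist x y →
      w = x ∨ w = y := by
    intro x y w h1 h2
    rcases Nat.eq_zero_or_pos (G.dist x w) with h3 | h3
    · exact .inl (hG.dist_eq_zero_iff.1 h3).symm
    · exact .inr (hG.dist_eq_zero_iff.1 (by omega))
  have h1 := SimpleGraph.dist_eq_one_iff_adj.2 h
  have h2 := SimpleGraph.dist_eq_one_iff_adj.2 h.symm
  rintro x (rfl | rfl) y (rfl | rfl) w hw <;>
    rcases key _ _ w (by simp [h1, h2]) hw with rfl | rfl <;> simp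

variable {W : Type*} {T : SimpleGraph W} {o : W} {q : ℕ} {V' : Type*} {G' : SimpleGraph V'}

/-- Count through the edge: extending from either end to the edge allows as many choices as a vertex
has neighbours, and then both counts agree. -/
lemma ThickTree.extNum_adj (hT : ThickTree T q) (hG' : RegularFlatGraph G' q) [Nontrivial V']
    {F : Set (WallTreeVertex T o)} (hF : GConvex (wallGraph T o) F) (hfin : F.Finite)
    {p p' : WallTreeVertex T o} (hp : p ∈ F) (hp' : p' ∈ F) (h : (wallGraph T o).Adj p p') {n m : ℕ}
    (hn : ExtNum (wallGraph T o) G' {p} F n) (hm : ExtNum (wallGraph T o) G' {p'} F m) : n = m := by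
  have hc := (hT.flatGraph o).connected
  have hedge : ∀ {a b : WallTreeVertex T o}, (wallGraph T o).Adj a b →
      ExtNum (wallGraph T o) G' {a} {b, a} (1 + (q + 1) + (q + 1) * q + q * q) := by
    intro a b hab
    refine hG'.extNum_isolated (K := {a}) (w := b) (y := a) (fun h => hab.ne' h) rfl hab.symm
      (fun v hv _ => hv) ?_
    rintro v rfl
    exact (wallGraph T o).irrefl
  obtain ⟨k, hk⟩ := hT.exists_extNum hG' (gconvex_pair hc h) (Set.insert_nonempty _ _) hF hfin
    (Set.insert_subset hp (Set.singleton_subset_iff.2 hp'))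
  have h1 := hn.unique ((Set.pair_comm p p' ▸ hedge h).trans hk)
  have h2 := hm.unique ((hedge h.symm).trans hk)
  rw [h1, h2]

/-- The number of extensions from a vertex to a finite convex set does not depend on the vertex. -/
lemma ThickTree.extNum_basePoint (hT : ThickTree T q) (hG' : RegularFlatGraph G' q) [Nontrivial V']
    {F : Set (WallTreeVertex T o)} (hF : GConvex (wallGraph T o) F) (hfin : F.Finite)
    {p p' : WallTreeVertex T o} (hp : p ∈ F) (hp' : p' ∈ F) {n m : ℕ}
    (hn : ExtNum (wallGraph T o) G' {p} F n) (hm : ExtNum (wallGraph T o) G' {p'} F m) : n = m := by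
  have hc := (hT.flatGraph o).connected
  obtain ⟨k, hk⟩ : ∃ k, (wallGraph T o).dist p p' = k := ⟨_, rfl⟩
  induction k generalizing p' m with
  | zero =>
    rw [hc.dist_eq_zero_iff] at hk
    subst hk
    exact hn.unique hm
  | succ k ih =>
    obtain ⟨c, hcd⟩ := (hT.flatGraph o).downSet_nonempty (u := p) (y := p') (by
      rintro rfl; rw [SimpleGraph.dist_self] at hk; omega)
    have hcF := hF.downSet_subset hp hp' hcd
    obtain ⟨l, hl⟩ := hT.exists_extNum hG' (gconvex_singleton hc c) (Set.singleton_nonempty _) hF hfin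
      (Set.singleton_subset_iff.2 hcF)
    have := hcd.2
    rw [ih hcF hl (by omega), hT.extNum_adj hG' hF hfin hcF hp' hcd.1.symm hl hm]

end BasePoint

/-! ### Random extensions along an exhaustion -/

section RandomExtension

variable {V V' : Type*} {G : SimpleGraph V} {G' : SimpleGraph V'}

lemma LocIsomOn.iUnion {B : ℕ → Set V} (hB : Monotone B) {f : V → V'}
    (h : ∀ n, LocIsomOn G G' f (B n)) : LocIsomOn G G' f (⋃ n, B n) := by
  have key : ∀ x y z, x ∈ ⋃ n, B n → y ∈ ⋃ n, B n → z ∈ ⋃ n, B n →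
      ∃ n, x ∈ B n ∧ y ∈ B n ∧ z ∈ B n := by
    intro x y z hx hy hz
    obtain ⟨i, hi⟩ := Set.mem_iUnion.1 hx
    obtain ⟨j, hj⟩ := Set.mem_iUnion.1 hy
    obtain ⟨k, hk⟩ := Set.mem_iUnion.1 hz
    exact ⟨max i (max j k), hB (by omega) hi, hB (by omega) hj, hB (by omega) hk⟩
  constructor
  · intro x hx y hy
    obtain ⟨n, h1, h2, -⟩ := key x y y hx hy hy
    exact (h n).adj x h1 y h2
  · intro y hy c hc z hz
    obtain ⟨n, h1, h2, h3⟩ := key y c z hy hc hz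
    exact (h n).opp y h1 c h2 z h3
  · intro y hy c hc z hz
    obtain ⟨n, h1, h2, h3⟩ := key y c z hy hc hz
    exact (h n).mid y h1 c h2 z h3

lemma ExtNum.exists_enum {K K' : Set V} {n : ℕ} (h : ExtNum G G' K K' n) (f : V → V') :
    ∃ e : Fin n → V → V', LocIsomOn G G' f K →
      Function.Injective e ∧ Set.range e = extensions G G' f K K' := by
  by_cases hf : LocIsomOn G G' f K
  · have hfin := h.finite hf
    have : Finite (extensions G G' f K K') := hfin
    have hcard : Nat.card (extensions G G' f K K') = n := h.ncard_eq f hf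
    let e := (Finite.equivFinOfCardEq hcard).symm
    refine ⟨fun i => (e i).1, fun _ => ⟨Subtype.val_injective.comp e.injective, ?_⟩⟩
    ext g
    constructor
    · rintro ⟨i, rfl⟩; exact (e i).2
    · intro hg; exact ⟨e.symm ⟨g, hg⟩, by simp⟩
  · exact ⟨fun _ => f, fun h => absurd h hf⟩

/-- Along an exhaustion with constant numbers of extensions, the local isometries are parametrized by
the image of the base point and a sequence of independent choices. -/
theorem exists_choices {B : ℕ → Set V} (hB : Monotone B) {z₀ : V} (hB₀ : B 0 = {z₀}) {N : ℕ → ℕ}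
    (hN : ∀ n, ExtNum G G' (B n) (B (n + 1)) (N n)) :
    ∃ L : V' → (∀ n, Fin (N n)) → V → V', (∀ v ω, LocIsomOn G G' (L v ω) (⋃ n, B n)) ∧
      (∀ z v, ∃ n, ∀ ω ω', (∀ i < n, ω i = ω' i) → L v ω z = L v ω' z) ∧
      ∀ n f, LocIsomOn G G' f (B n) →
        ∃ k : ∀ i, Fin (N i), ∀ v ω, Set.EqOn (L v ω) f (B n) ↔ v = f z₀ ∧ ∀ i < n, ω i = k i := by
  classical
  choose e he using fun n f => (hN n).exists_enum f
  let s : V' → (∀ n, Fin (N n)) → ℕ → V → V' := fun v ω n =>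
    Nat.rec (fun _ => v) (fun n f => e n f (ω n)) n
  have s0 : ∀ v ω, s v ω 0 = fun _ => v := fun v ω => rfl
  have s1 : ∀ v ω n, s v ω (n + 1) = e n (s v ω n) (ω n) := fun v ω n => rfl
  have hs : ∀ v ω n, LocIsomOn G G' (s v ω n) (B n) := by
    intro v ω n
    induction n with
    | zero => rw [hB₀]; exact locIsomOn_singleton _ _
    | succ n ih =>
      have : s v ω (n + 1) ∈ extensions G G' (s v ω n) (B n) (B (n + 1)) := by
        rw [← (he n _ ih).2]; exact ⟨ω n, rfl⟩
      exact this.1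
  have hmem : ∀ v ω n, s v ω (n + 1) ∈ extensions G G' (s v ω n) (B n) (B (n + 1)) := by
    intro v ω n
    rw [← (he n _ (hs v ω n)).2]; exact ⟨ω n, rfl⟩
  have hstab : ∀ v ω n m, n ≤ m → ∀ z ∈ B n, s v ω m z = s v ω n z := by
    intro v ω n m hnm z hz
    induction m, hnm using Nat.le_induction with
    | base => rfl
    | succ m hm ih =>
      rw [(hmem v ω m).2 z (fun h => h.2 (hB hm hz)), ih]
  -- The partial maps are constant off `B n`, so a partial map is determined by its restriction to
  -- `B n`; this matters when it is compared with `g` below.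
  have hout : ∀ v ω n z, z ∉ B n → s v ω n z = v := by
    intro v ω n z
    induction n with
    | zero => intro _; rfl
    | succ n ih =>
      intro hz
      rw [(hmem v ω n).2 z (fun h => hz h.1), ih (fun h => hz (hB n.le_succ h))]
  have hz₀ : ∀ n, z₀ ∈ B n := fun n => hB (Nat.zero_le n) (by rw [hB₀]; rfl)
  have hsz : ∀ v ω n, s v ω n z₀ = v := fun v ω n =>
    hstab v ω 0 n (Nat.zero_le n) z₀ (hz₀ 0)
  let rk : V → ℕ := fun z => if h : ∃ n, z ∈ B n then Nat.find h else 0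
  have hrk : ∀ n z, z ∈ B n → z ∈ B (rk z) ∧ rk z ≤ n := by
    intro n z hz
    have h : ∃ n, z ∈ B n := ⟨n, hz⟩
    simp only [rk, h, dif_pos]
    exact ⟨Nat.find_spec h, Nat.find_min' h hz⟩
  let L : V' → (∀ n, Fin (N n)) → V → V' := fun v ω z => s v ω (rk z) z
  have hL : ∀ v ω n, Set.EqOn (L v ω) (s v ω n) (B n) := by
    intro v ω n z hz
    obtain ⟨h1, h2⟩ := hrk n z hz
    exact (hstab v ω _ n h2 z h1).symm
  refine ⟨L, fun v ω => LocIsomOn.iUnion hB fun n => (hs v ω n).congr (hL v ω n).symm, ?_, ?_⟩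
  · intro z v
    refine ⟨rk z, fun ω ω' h => ?_⟩
    have : ∀ n, (∀ i < n, ω i = ω' i) → s v ω n = s v ω' n := by
      intro n
      induction n with
      | zero => intro _; rfl
      | succ n ih =>
        intro h
        rw [s1, s1, ih (fun i hi => h i (by omega)), h n (by omega)]
    exact congrFun (this _ h) z
  · intro n f hf
    -- The partial maps that would lead to `f`, with the value off `B i` that `hout` forces. The
    -- choices `k i` reproduce them for `i < n` and are arbitrary afterwards.
    let g : ℕ → V → V' := fun i z => if z ∈ B i then f z else f z₀
    have hk : ∀ i, ∃ k : Fin (N i), i < n → e i (g i) k = g (i + 1) := by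
      intro i
      by_cases hi : i < n
      · have hgi : LocIsomOn G G' (g i) (B i) :=
          (hf.mono (hB hi.le)).congr (fun z hz => by simp [g, hz])
        have : g (i + 1) ∈ extensions G G' (g i) (B i) (B (i + 1)) := by
          refine ⟨(hf.mono (hB hi)).congr (fun z hz => by simp [g, hz]), fun z hz => ?_⟩
          by_cases h1 : z ∈ B (i + 1)
          · have h2 : z ∈ B i := by by_contra h2; exact hz ⟨h1, h2⟩
            simp [g, h1, h2]
          · have h2 : z ∉ B i := fun h2 => h1 (hB i.le_succ h2)
            simp [g, h1, h2]
        rw [← (he i _ hgi).2] at this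
        obtain ⟨k, hk⟩ := this
        exact ⟨k, fun _ => hk⟩
      · exact ⟨⟨0, (hN i).pos⟩, fun h => absurd h hi⟩
    choose k hk using hk
    refine ⟨k, fun v ω => ?_⟩
    have hiff : ∀ m, m ≤ n → (s v ω m = g m ↔ v = f z₀ ∧ ∀ i < m, ω i = k i) := by
      intro m
      induction m with
      | zero =>
        intro _
        simp only [not_lt_zero, IsEmpty.forall_iff, implies_true, and_true]
        constructor
        · intro h
          have := congrFun h z₀
          simpa [g, s0, hz₀] using this
        · intro h
          funext z
          rw [s0]
          by_cases hz : z ∈ B 0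
          · have : z = z₀ := by rw [hB₀] at hz; exact hz
            simp [g, h, this]
          · simp [g, hz, h]
      | succ m ih =>
        intro hm
        have hgm : LocIsomOn G G' (g m) (B m) :=
          (hf.mono (hB (by omega))).congr (fun z hz => by simp [g, hz])
        constructor
        · intro h
          have hm' : s v ω m = g m := by
            have hv : v = f z₀ := by
              have : v = g (m + 1) z₀ := (hsz v ω (m + 1)).symm.trans (congrFun h z₀)
              simpa [g, hz₀] using this
            funext z
            by_cases hz : z ∈ B m
            · have := congrFun h z
              rw [hstab v ω m (m + 1) m.le_succ z hz] at this
              simpa [g, hz, hB m.le_succ hz] using this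
            · rw [hout v ω m z hz]; simp [g, hz, hv]
          obtain ⟨h1, h2⟩ := (ih (by omega)).1 hm'
          refine ⟨h1, fun i hi => ?_⟩
          rcases Nat.lt_succ_iff_lt_or_eq.1 hi with hi | rfl
          · exact h2 i hi
          · apply (he i _ hgm).1
            rw [hk i (by omega), ← h, s1, hm']
        · rintro ⟨h1, h2⟩
          rw [s1, (ih (by omega)).2 ⟨h1, fun i hi => h2 i (by omega)⟩, h2 m (by omega), hk m (by omega)]
    rw [← hiff n le_rfl]
    constructor
    · intro h
      funext z
      by_cases hz : z ∈ B n
      · rw [← hL v ω n hz, h hz]; simp [g, hz]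
      · rw [hout v ω n z hz, ← hsz v ω n, ← hL v ω n (hz₀ n), h (hz₀ n)]; simp [g, hz]
    · intro h z hz
      rw [hL v ω n hz, h]; simp [g, hz]

end RandomExtension

/-! ### Simplicial isometries and local isometries -/

lemma FlatGraph.sqDist_nonneg {V : Type*} {G : SimpleGraph V} (hG : FlatGraph G) {x y : V} {D : ℤ}
    (h : SqDist G x y D) : 0 ≤ D := by
  by_cases hxy : x = y
  · subst hxy; exact (h.unique .self).ge
  · obtain ⟨φ, hφ, a, b, rfl, rfl⟩ := hG.exists_flat_pair hxy
    rw [h.unique (hφ.sqDist a b)]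
    unfold latticeSqNorm
    nlinarith [sq_nonneg ((b - a).1 + (b - a).2), sq_nonneg (b - a).1, sq_nonneg (b - a).2]

section IsomLoc

variable {V : Type*} {X : AbstractSimplicialComplex V} {𝒜 : Set (Set (Finset V))}
  {W : Type*} {T : SimpleGraph W} {o : W} {q : ℕ} {Z : ConvexSubset T o}

lemma ConvexSubset.gconvex (Z : ConvexSubset T o) : GConvex (wallGraph T o) Z.verts := Z.convex

lemma mem_wallTree_faces {s : Finset (WallTreeVertex T o)} : s ∈ (wallTree T o).faces ↔
    s.Nonempty ∧ ∀ v ∈ s, ∀ w ∈ s, v = w ∨ (wallGraph T o).Adj v w := by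
  have : s ∈ (wallTree T o).faces ↔
      s.Nonempty ∧ ∀ v ∈ s, ∀ w ∈ s, wallTreeSqDist T o v w ≤ 4 := Iff.rfl
  rw [this]
  refine and_congr_right fun _ => forall₄_congr fun v _ w _ => ?_
  by_cases h : v = w
  · subst h; simp [wallTreeSqDist]
  · simp [h, wallGraph_adj_iff_sq]

lemma ConvexSubset.mem_faces {s : Finset Z.verts} : s ∈ Z.complex.faces ↔
    s.Nonempty ∧ ∀ v ∈ s, ∀ w ∈ s, v = w ∨ (wallGraph T o).Adj v w := by
  have : s ∈ Z.complex.faces ↔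
    s.map (Function.Embedding.subtype (· ∈ Z.verts)) ∈ (wallTree T o).faces := Iff.rfl
  rw [this, mem_wallTree_faces, Finset.map_nonempty]
  refine and_congr_right fun _ => ?_
  simp only [Finset.mem_map, Function.Embedding.subtype_apply, Subtype.exists, exists_and_right,
    exists_eq_right]
  constructor
  · intro h v hv w hw
    exact (h v.1 ⟨v.2, hv⟩ w.1 ⟨w.2, hw⟩).imp Subtype.ext id
  · rintro h v ⟨hv, hv'⟩ w ⟨hw, hw'⟩
    exact (h _ hv' _ hw').imp (congrArg Subtype.val) id

/-- The underlying map of a simplicial isometry is a local isometry. -/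
lemma Isom.locIsomOn [Nonempty V] (h𝒜 : IsApartmentSystem X 𝒜) (hT : ThickTree T q)
    (β : Isom Z.complex (buildingComplex X)) {f : WallTreeVertex T o → V}
    (hf : ∀ z : Z.verts, f z = β.toFun z) : LocIsomOn (wallGraph T o) (skeleton X) f Z.verts := by
  refine LocIsomOn.of_sqDist (hT.flatGraph o) h𝒜.flatGraph (fun x hx y hy D hD => ?_)
  obtain ⟨D', hD'⟩ := h𝒜.flatGraph.exists_sqDist (f x) (f y)
  have h1 : euclDist X (f x) (f y) = (wallTree T o).dist x y := by
    rw [hf ⟨x, hx⟩, hf ⟨y, hy⟩]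
    exact β.dist_eq ⟨x, hx⟩ ⟨y, hy⟩
  rw [h𝒜.euclDist_eq hD', hT.dist_eq_sqrt hD, Real.sqrt_inj
    (by exact_mod_cast h𝒜.flatGraph.sqDist_nonneg hD') (by exact_mod_cast hT.sqDist_nonneg hD)] at h1
  rw [← (by exact_mod_cast h1 : D' = D)]
  exact hD'

/-- A local isometry on a convex set is a simplicial isometry. -/
def LocIsomOn.toIsom [Nonempty V] (h𝒜 : IsApartmentSystem X 𝒜) (hT : ThickTree T q)
    (Z : ConvexSubset T o) {f : WallTreeVertex T o → V}
    (hf : LocIsomOn (wallGraph T o) (skeleton X) f Z.verts) :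
    Isom Z.complex (buildingComplex X) where
  toFun z := f z
  dist_eq v w := by
    obtain ⟨D, hD⟩ := (hT.flatGraph o).exists_sqDist v.1 w.1
    show euclDist X (f v) (f w) = (wallTree T o).dist v w
    rw [hT.dist_eq_sqrt hD, h𝒜.euclDist_eq (hf.sqDist (hT.flatGraph o) h𝒜.flatGraph Z.gconvex v.2 w.2 hD)]
  image_mem_iff s := by
    classical
    have h1 : ∀ t : Finset V, t ∈ (buildingComplex X).faces ↔
        t.Nonempty ∧ ∀ v ∈ t, ∀ w ∈ t, v = w ∨ (skeleton X).Adj v w := h𝒜.mem_faces_iff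
    rw [h1, ConvexSubset.mem_faces, Finset.image_nonempty]
    refine and_congr_right fun _ => ?_
    have key : ∀ v w : Z.verts, (f v = f w ∨ (skeleton X).Adj (f v) (f w)) ↔
        (v = w ∨ (wallGraph T o).Adj v w) := fun v w => by
      rw [hf.adj_iff (hT.flatGraph o) h𝒜.flatGraph Z.gconvex v.2 w.2,
        (hf.injOn (hT.flatGraph o) h𝒜.flatGraph Z.gconvex).eq_iff v.2 w.2, Subtype.ext_iff]
    constructor
    · intro h v hv w hw
      exact (key v w).1 (h _ (Finset.mem_image_of_mem _ hv) _ (Finset.mem_image_of_mem _ hw))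
    · intro h v hv w hw
      obtain ⟨v', hv', rfl⟩ := Finset.mem_image.1 hv
      obtain ⟨w', hw', rfl⟩ := Finset.mem_image.1 hw
      exact (key v' w').2 (h v' hv' w' hw')

@[simp] lemma LocIsomOn.toIsom_toFun [Nonempty V] (h𝒜 : IsApartmentSystem X 𝒜) (hT : ThickTree T q)
    (Z : ConvexSubset T o) {f : WallTreeVertex T o → V}
    (hf : LocIsomOn (wallGraph T o) (skeleton X) f Z.verts) (z : Z.verts) :
    (hf.toIsom h𝒜 hT Z).toFun z = f z := rfl

end IsomLoc

/-! ### Cylinders -/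

section Cylinders

lemma measurable_isom_iff {U V Ω : Type*} {K : MetricComplex U} {L : MetricComplex V}
    [MeasurableSpace Ω] {Φ : Ω → Isom K L} :
    Measurable Φ ↔ ∀ z (A : Set V), MeasurableSet {ω | (Φ ω).toFun z ∈ A} := by
  rw [measurable_iff_comap_le, Isom.measurableSpace, MeasurableSpace.comap_iSup, iSup_le_iff]
  refine forall_congr' fun z => ?_
  rw [MeasurableSpace.comap_comp, ← measurable_iff_comap_le]
  exact ⟨fun h A => h (MeasurableSpace.measurableSet_top (s := A)), fun h A _ => h A⟩

lemma measurableSet_isom_eval {U V : Type*} {K : MetricComplex U} {L : MetricComplex V} (z : U)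
    (A : Set V) : MeasurableSet {β : Isom K L | β.toFun z ∈ A} :=
  measurable_isom_iff.1 (measurable_id (α := Isom K L)) z A

variable {V : Type*} {X : AbstractSimplicialComplex V}
  {W : Type*} {T : SimpleGraph W} {o : W} {q : ℕ}

/-- The simplicial isometries that coincide with `f` on `F`. -/
def cyl (X : AbstractSimplicialComplex V) (Z : ConvexSubset T o) (F : Set (WallTreeVertex T o))
    (f : WallTreeVertex T o → V) : Set (Isom Z.complex (buildingComplex X)) :=
  {β | ∀ z : Z.verts, z.1 ∈ F → β.toFun z = f z}

lemma measurableSet_cyl (Z : ConvexSubset T o) {F : Set (WallTreeVertex T o)} (hF : F.Finite)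
    (f : WallTreeVertex T o → V) : MeasurableSet (cyl X Z F f) := by
  have hfin : {z : Z.verts | z.1 ∈ F}.Finite := hF.preimage Subtype.val_injective.injOn
  have : cyl X Z F f = ⋂ z ∈ {z : Z.verts | z.1 ∈ F}, {β | β.toFun z ∈ ({f z} : Set V)} := by
    ext β; simp [cyl]
  rw [this]
  exact MeasurableSet.biInter hfin.countable fun z _ => measurableSet_isom_eval z _

/-- Measures that give the weight `n⁻¹` to the cylinders over `F`, where `n` is the number of
extensions to `F` of a map defined at one vertex. -/
def IsEquidistributed (Z : ConvexSubset T o) (μ : Measure (Isom Z.complex (buildingComplex X))) :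
    Prop :=
  ∀ F ⊆ Z.verts, F.Finite → GConvex (wallGraph T o) F → ∀ p ∈ F, ∀ n,
    ExtNum (wallGraph T o) (skeleton X) {p} F n → ∀ f,
      LocIsomOn (wallGraph T o) (skeleton X) f F → μ (cyl X Z F f) = (n : ENNReal)⁻¹

/-- The balls of a convex set. -/
def ConvexSubset.ball (Z : ConvexSubset T o) (z₀ : WallTreeVertex T o) (n : ℕ) :
    Set (WallTreeVertex T o) := Z.verts ∩ {w | (wallGraph T o).dist z₀ w ≤ n}

namespace ConvexSubset

variable (Z : ConvexSubset T o) {z₀ : WallTreeVertex T o}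

lemma ball_mono : Monotone (Z.ball z₀) := fun _ _ h _ hx => ⟨hx.1, le_trans hx.2 h⟩

lemma iUnion_ball : ⋃ n, Z.ball z₀ n = Z.verts := by
  refine Set.Subset.antisymm (Set.iUnion_subset fun n => Set.inter_subset_left) (fun z hz => ?_)
  exact Set.mem_iUnion.2 ⟨(wallGraph T o).dist z₀ z, hz, le_refl ((wallGraph T o).dist z₀ z)⟩

lemma exists_subset_ball {F : Set (WallTreeVertex T o)} (hF : F ⊆ Z.verts) (hfin : F.Finite) :
    ∃ n, F ⊆ Z.ball z₀ n := by
  obtain ⟨n, hn⟩ := (hfin.image (fun w => (wallGraph T o).dist z₀ w)).bddAbove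
  exact ⟨n, fun w hw => ⟨hF hw, hn ⟨w, hw, rfl⟩⟩⟩

lemma gconvex_ball (hT : ThickTree T q) (n : ℕ) : GConvex (wallGraph T o) (Z.ball z₀ n) :=
  Z.gconvex.inter (A2Tilde.gconvex_ball hT.isTree z₀ n)

lemma finite_ball (hT : ThickTree T q) (n : ℕ) : (Z.ball z₀ n).Finite :=
  (hT.finite_ball z₀ n).subset Set.inter_subset_right

lemma ball_zero (hT : ThickTree T q) (hz : z₀ ∈ Z.verts) : Z.ball z₀ 0 = {z₀} := by
  ext w
  constructor
  · rintro ⟨-, h⟩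
    have : (wallGraph T o).dist z₀ w = 0 := Nat.le_zero.1 h
    exact ((hT.flatGraph o).connected.dist_eq_zero_iff.1 this).symm
  · rintro rfl
    refine ⟨hz, ?_⟩
    rw [Set.mem_ofPred_eq, SimpleGraph.dist_self]

lemma mem_ball (hz : z₀ ∈ Z.verts) (n : ℕ) : z₀ ∈ Z.ball z₀ n := by
  refine ⟨hz, ?_⟩
  rw [Set.mem_ofPred_eq, SimpleGraph.dist_self]; exact Nat.zero_le n

end ConvexSubset

variable {𝒜 : Set (Set (Finset V))}

/-- A condition on the value at one vertex is a union of cylinders over a ball containing it,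
countable because balls are finite and `V` is countable. -/
lemma generateFrom_cyl [Countable V] [Nonempty V] (hT : ThickTree T q) (Z : ConvexSubset T o)
    (z₀ : WallTreeVertex T o) : Isom.measurableSpace Z.complex (buildingComplex X) =
      MeasurableSpace.generateFrom {S | ∃ n f, S = cyl X Z (Z.ball z₀ n) f} := by
  classical
  refine le_antisymm (iSup_le fun z => ?_) (MeasurableSpace.generateFrom_le ?_)
  · rintro _ ⟨A, -, rfl⟩
    obtain ⟨n, hn⟩ := Set.mem_iUnion.1 ((Z.iUnion_ball (z₀ := z₀)).symm ▸ z.2 :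
      z.1 ∈ ⋃ n, Z.ball z₀ n)
    have : Finite (Z.ball z₀ n) := Z.finite_ball hT n
    obtain ⟨x₀⟩ := ‹Nonempty V›
    let ext : (Z.ball z₀ n → V) → WallTreeVertex T o → V := fun g w =>
      if h : w ∈ Z.ball z₀ n then g ⟨w, h⟩ else x₀
    have : (fun β : Isom Z.complex (buildingComplex X) => β.toFun z) ⁻¹' A =
        ⋃ g ∈ {g : Z.ball z₀ n → V | g ⟨z, hn⟩ ∈ A}, cyl X Z (Z.ball z₀ n) (ext g) := by
      ext β
      simp only [Set.mem_preimage, Set.mem_iUnion, exists_prop]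
      constructor
      · intro h
        exact ⟨fun w => β.toFun ⟨w.1, w.2.1⟩, h, fun w hw => by simp [ext, hw]⟩
      · rintro ⟨g, hg, hβ⟩
        have := hβ z hn
        simp only [ext, hn, dif_pos] at this
        rw [this]; exact hg
    rw [this]
    exact MeasurableSet.biUnion (Set.to_countable _) fun g _ =>
      MeasurableSpace.measurableSet_generateFrom ⟨n, ext g, rfl⟩
  · rintro _ ⟨n, f, rfl⟩
    exact measurableSet_cyl Z (Z.finite_ball hT n) f

/-- Two cylinders over concentric balls that meet are nested. -/
lemma isPiSystem_cyl (Z : ConvexSubset T o) (z₀ : WallTreeVertex T o) :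
    IsPiSystem {S | ∃ n f, S = cyl X Z (Z.ball z₀ n) f} := by
  have key : ∀ n m f g, n ≤ m → (cyl X Z (Z.ball z₀ n) f ∩ cyl X Z (Z.ball z₀ m) g).Nonempty →
      cyl X Z (Z.ball z₀ n) f ∩ cyl X Z (Z.ball z₀ m) g = cyl X Z (Z.ball z₀ m) g := by
    rintro n m f g hnm ⟨β, h1, h2⟩
    refine Set.inter_eq_right.2 fun β' h' z hz => ?_
    rw [h' z (Z.ball_mono hnm hz), ← h2 z (Z.ball_mono hnm hz), h1 z hz]
  rintro _ ⟨n, f, rfl⟩ _ ⟨m, g, rfl⟩ hne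
  rcases le_total n m with h | h
  · exact ⟨m, g, key n m f g h hne⟩
  · rw [Set.inter_comm] at hne ⊢
    exact ⟨n, f, key m n g f h hne⟩

/-- Nonempty cylinders over balls come from local isometries and so have prescribed mass. They form
a generating π-system, and those over the ball of radius zero are a countable cover by sets of
finite mass. -/
lemma IsEquidistributed.unique [Nontrivial V] (h𝒜 : IsApartmentSystem X 𝒜)
    (hX : RegularFlatGraph (skeleton X) q) (hT : ThickTree T q) (Z : ConvexSubset T o)
    {μ ν : Measure (Isom Z.complex (buildingComplex X))} (hμ : IsEquidistributed Z μ)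
    (hν : IsEquidistributed Z ν) : μ = ν := by
  have hV : Countable V := hX.countable
  obtain ⟨z₀, hz₀⟩ := Z.nonempty
  have hext : ∀ n, ∃ k, ExtNum (wallGraph T o) (skeleton X) {z₀} (Z.ball z₀ n) k := fun n =>
    hT.exists_extNum hX (gconvex_singleton (hT.flatGraph o).connected z₀) (Set.singleton_nonempty _)
      (Z.gconvex_ball hT n) (Z.finite_ball hT n) (Set.singleton_subset_iff.2 (Z.mem_ball hz₀ n))
  have hval : ∀ n f, (∃ k : ℕ, 0 < k ∧ μ (cyl X Z (Z.ball z₀ n) f) = (k : ENNReal)⁻¹ ∧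
      ν (cyl X Z (Z.ball z₀ n) f) = (k : ENNReal)⁻¹) ∨ cyl X Z (Z.ball z₀ n) f = ∅ := by
    intro n f
    obtain ⟨k, hk⟩ := hext n
    rcases (cyl X Z (Z.ball z₀ n) f).eq_empty_or_nonempty with h | ⟨β, hβ⟩
    · exact .inr h
    · classical
      have hf : LocIsomOn (wallGraph T o) (skeleton X) f (Z.ball z₀ n) := by
        refine ((β.locIsomOn h𝒜 hT (f := fun w => if h : w ∈ Z.verts then β.toFun ⟨w, h⟩ else f w)
          (fun z => by simp)).mono Set.inter_subset_left).congr (fun w hw => ?_)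
        simp only [hw.1, dif_pos]
        exact hβ ⟨w, hw.1⟩ hw
      exact .inl ⟨k, hk.pos, hμ _ Set.inter_subset_left (Z.finite_ball hT n) (Z.gconvex_ball hT n) z₀
        (Z.mem_ball hz₀ n) k hk f hf, hν _ Set.inter_subset_left (Z.finite_ball hT n)
        (Z.gconvex_ball hT n) z₀ (Z.mem_ball hz₀ n) k hk f hf⟩
  refine Measure.ext_of_generateFrom_of_cover_subset (generateFrom_cyl hT Z z₀)
    (isPiSystem_cyl Z z₀) (T := Set.range fun v : V => cyl X Z (Z.ball z₀ 0) fun _ => v) ?_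
    (Set.countable_range _) ?_ ?_ ?_
  · rintro _ ⟨v, rfl⟩; exact ⟨0, _, rfl⟩
  · refine Set.eq_univ_of_forall fun β => ⟨_, ⟨β.toFun ⟨z₀, hz₀⟩, rfl⟩, fun z hz => ?_⟩
    rw [Z.ball_zero hT hz₀] at hz
    obtain rfl : z = ⟨z₀, hz₀⟩ := Subtype.ext hz
    rfl
  · rintro _ ⟨v, rfl⟩
    show μ (cyl X Z (Z.ball z₀ 0) fun _ => v) ≠ ⊤
    rcases hval 0 (fun _ => v) with ⟨k, hk, h, -⟩ | h
    · rw [h]; simp [hk.ne']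
    · rw [h]; simp
  · rintro _ ⟨n, f, rfl⟩
    rcases hval n f with ⟨k, -, h, h'⟩ | h
    · rw [h, h']
    · rw [h, measure_empty, measure_empty]

end Cylinders

/-! ### Existence and naturality of the equidistributed measures -/

section Existence

lemma measurableSet_of_finite_dependence {N : ℕ → ℕ} {S : Set (∀ n, Fin (N n))} {n : ℕ}
    (h : ∀ ω ω', (∀ i < n, ω i = ω' i) → ω ∈ S → ω' ∈ S) : MeasurableSet S := by
  let r : (∀ n, Fin (N n)) → ∀ i : Fin n, Fin (N i) := fun ω i => ω i
  have hr : Measurable r := measurable_pi_lambda _ fun i => measurable_pi_apply _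
  have : S = r ⁻¹' (r '' S) := by
    refine Set.Subset.antisymm (Set.subset_preimage_image r S) ?_
    rintro ω ⟨ω', hω', he⟩
    exact h ω' ω (fun i hi => congrFun he ⟨i, hi⟩) hω'
  rw [this]
  exact hr (Set.toFinite _).measurableSet

variable {V : Type*} {X : AbstractSimplicialComplex V} {𝒜 : Set (Set (Finset V))}
  {W : Type*} {T : SimpleGraph W} {o : W} {q : ℕ}

/-- A cylinder over `F` is the disjoint union of `m` cylinders over a ball containing `F`, each of
mass `l⁻¹`. Multiplicativity and independence of the base point give `l = k * m`, hence the mass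
`k⁻¹`. -/
lemma isEquidistributed_of_ball [Nontrivial V] (h𝒜 : IsApartmentSystem X 𝒜)
    (hX : RegularFlatGraph (skeleton X) q) (hT : ThickTree T q) (Z : ConvexSubset T o)
    {z₀ : WallTreeVertex T o} (hz₀ : z₀ ∈ Z.verts)
    {μ : Measure (Isom Z.complex (buildingComplex X))}
    (hμ : ∀ n k, ExtNum (wallGraph T o) (skeleton X) {z₀} (Z.ball z₀ n) k → ∀ f,
      LocIsomOn (wallGraph T o) (skeleton X) f (Z.ball z₀ n) →
        μ (cyl X Z (Z.ball z₀ n) f) = (k : ENNReal)⁻¹) : IsEquidistributed Z μ := by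
  classical
  intro F hFZ hfin hF p hp k hk f hf
  obtain ⟨n, hn⟩ := Z.exists_subset_ball (z₀ := z₀) hFZ hfin
  obtain ⟨m, hm⟩ := hT.exists_extNum hX hF ⟨p, hp⟩ (Z.gconvex_ball hT n) (Z.finite_ball hT n) hn
  obtain ⟨l, hl⟩ := hT.exists_extNum hX (gconvex_singleton (hT.flatGraph o).connected z₀)
    (Set.singleton_nonempty _) (Z.gconvex_ball hT n) (Z.finite_ball hT n)
    (Set.singleton_subset_iff.2 (Z.mem_ball hz₀ n))
  have hkl := hT.extNum_basePoint hX (Z.gconvex_ball hT n) (Z.finite_ball hT n) (hn hp)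
    (Z.mem_ball hz₀ n) (hk.trans hm) hl
  have hE := hm.finite hf
  have hcov : cyl X Z F f = ⋃ g ∈ hE.toFinset, cyl X Z (Z.ball z₀ n) g := by
    ext β
    simp only [Set.mem_iUnion, Set.Finite.mem_toFinset, exists_prop]
    constructor
    · intro hβ
      refine ⟨fun w => if h : w ∈ Z.ball z₀ n then β.toFun ⟨w, h.1⟩ else f w, ⟨?_, ?_⟩, ?_⟩
      · refine ((β.locIsomOn h𝒜 hT (f := fun w => if h : w ∈ Z.verts then β.toFun ⟨w, h⟩ else f w)
          (fun z => by simp)).mono Set.inter_subset_left).congr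
          (fun w (hw : w ∈ Z.ball z₀ n) => ?_)
        simp only [hw.1, hw, dif_pos]
      · intro w hw
        by_cases hwb : w ∈ Z.ball z₀ n
        · simp only [hwb, dif_pos]
          exact hβ ⟨w, hwb.1⟩ (by by_contra hwF; exact hw ⟨hwb, hwF⟩)
        · simp only [hwb, dif_neg, not_false_eq_true]
      · intro z hz
        simp only [hz, dif_pos]
    · rintro ⟨g, hg, hβ⟩ z hz
      rw [hβ z (hn hz), hg.2 z.1 (fun h => h.2 hz)]
  rw [hcov, measure_biUnion_finset ?_ (fun g _ => measurableSet_cyl Z (Z.finite_ball hT n) g)]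
  · rw [Finset.sum_congr rfl (fun g hg => hμ n l hl g (hE.mem_toFinset.1 hg).1), Finset.sum_const,
      ← Set.ncard_eq_toFinset_card _ hE, hm.ncard_eq f hf, ← hkl, nsmul_eq_mul, Nat.cast_mul,
      ENNReal.mul_inv (.inr (ENNReal.natCast_ne_top _)) (.inl (ENNReal.natCast_ne_top _)), mul_left_comm,
      ENNReal.mul_inv_cancel (by exact_mod_cast hm.pos.ne') (ENNReal.natCast_ne_top _), mul_one]
  · intro g hg g' hg' hne
    refine Set.disjoint_left.2 fun β h1 h2 => hne ?_
    rw [Finset.mem_coe, Set.Finite.mem_toFinset] at hg hg'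
    funext w
    by_cases hw : w ∈ Z.ball z₀ n
    · rw [← h1 ⟨w, hw.1⟩ hw, h2 ⟨w, hw.1⟩ hw]
    · rw [hg.2 w (fun h => hw h.1), hg'.2 w (fun h => hw h.1)]

/-- The image of the centre is summed over all vertices, and the extensions from ball to ball are
uniform and independent. A nonempty cylinder over the `n`th ball fixes the image and the first `n`
choices, so its mass is the inverse of the product of the extension numbers. -/
theorem exists_isEquidistributed [Nontrivial V] (h𝒜 : IsApartmentSystem X 𝒜)
    (hX : RegularFlatGraph (skeleton X) q) (hT : ThickTree T q) (Z : ConvexSubset T o) :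
    ∃ μ : Measure (Isom Z.complex (buildingComplex X)), IsEquidistributed Z μ := by
  obtain ⟨z₀, hz₀⟩ := Z.nonempty
  choose N hN using fun n => hT.exists_extNum hX (Z.gconvex_ball hT (z₀ := z₀) n)
    ⟨z₀, Z.mem_ball hz₀ n⟩ (Z.gconvex_ball hT (z₀ := z₀) (n + 1)) (Z.finite_ball hT (n + 1))
    (Z.ball_mono n.le_succ)
  obtain ⟨L, hL, hdep, hcyl⟩ := exists_choices Z.ball_mono (Z.ball_zero hT hz₀) hN
  rw [Z.iUnion_ball] at hL
  have : ∀ i, Nonempty (Fin (N i)) := fun i => ⟨⟨0, (hN i).pos⟩⟩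
  let P := Measure.infinitePi fun i => (PMF.uniformOfFintype (Fin (N i))).toMeasure
  let Φ : V → (∀ n, Fin (N n)) → Isom Z.complex (buildingComplex X) := fun v ω =>
    (hL v ω).toIsom h𝒜 hT Z
  have hΦ : ∀ v, Measurable (Φ v) := by
    intro v
    refine measurable_isom_iff.2 fun z A => ?_
    obtain ⟨n, hn⟩ := hdep z v
    refine measurableSet_of_finite_dependence (n := n) fun ω ω' h hω => ?_
    have : L v ω' z ∈ A := by rw [← hn ω ω' h]; exact hω
    exact this
  refine ⟨Measure.sum fun v => P.map (Φ v), isEquidistributed_of_ball h𝒜 hX hT Z hz₀ ?_⟩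
  intro n k hk f hf
  have hprod : ExtNum (wallGraph T o) (skeleton X) {z₀} (Z.ball z₀ n) (∏ i ∈ Finset.range n, N i) := by
    clear hk hf
    induction n with
    | zero => rw [Z.ball_zero hT hz₀]; exact extNum_refl _
    | succ n ih => rw [Finset.prod_range_succ]; exact ih.trans (hN n)
  rw [hk.unique hprod]
  obtain ⟨c, hc⟩ := hcyl n f hf
  have hmeas := measurableSet_cyl (X := X) Z (Z.finite_ball hT n (z₀ := z₀)) f
  have hpre : ∀ v, Φ v ⁻¹' cyl X Z (Z.ball z₀ n) f =
      {ω | v = f z₀ ∧ ∀ i < n, ω i = c i} := by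
    intro v
    ext ω
    rw [Set.mem_ofPred_eq, ← hc v ω]
    constructor
    · intro h z hz; exact h ⟨z, hz.1⟩ hz
    · intro h z hz; exact h hz
  rw [Measure.sum_apply _ hmeas, tsum_eq_single (f z₀)]
  · rw [Measure.map_apply (hΦ _) hmeas, hpre]
    have : {ω : ∀ n, Fin (N n) | f z₀ = f z₀ ∧ ∀ i < n, ω i = c i} =
        Set.pi (Finset.range n : Set ℕ) fun i => {c i} := by
      ext ω; simp
    rw [this, Measure.infinitePi_pi _ (fun i _ => measurableSet_singleton _)]
    push_cast
    rw [ENNReal.prod_inv_distrib]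
    · refine Finset.prod_congr rfl fun i _ => ?_
      rw [PMF.toMeasure_apply_singleton _ _ (measurableSet_singleton _), PMF.uniformOfFintype_apply,
        Fintype.card_fin]
    · intro i _ j _ _
      exact .inl (by exact_mod_cast (hN i).pos.ne')
  · intro v hv
    rw [Measure.map_apply (hΦ _) hmeas, hpre]
    simp [hv]

/-- Composition with a local isometry of convex sets and an automorphism of the building preserves
equidistributed measures. -/
theorem IsEquidistributed.measurePreserving [Nontrivial V] (h𝒜 : IsApartmentSystem X 𝒜)
    (hX : RegularFlatGraph (skeleton X) q) (hT : ThickTree T q) {Z₁ Z₂ : ConvexSubset T o}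
    {μ₁ : Measure (Isom Z₁.complex (buildingComplex X))}
    {μ₂ : Measure (Isom Z₂.complex (buildingComplex X))} (hμ₁ : IsEquidistributed Z₁ μ₁)
    (hμ₂ : IsEquidistributed Z₂ μ₂) {i : WallTreeVertex T o → WallTreeVertex T o}
    (hi : LocIsomOn (wallGraph T o) (wallGraph T o) i Z₁.verts)
    (hmaps : ∀ z ∈ Z₁.verts, i z ∈ Z₂.verts) (h : skeleton X ≃g skeleton X)
    {Φ : Isom Z₂.complex (buildingComplex X) → Isom Z₁.complex (buildingComplex X)}
    (hΦ : ∀ β z, (Φ β).toFun z = h (β.toFun ⟨i z, hmaps z z.2⟩)) :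
    MeasurePreserving Φ μ₂ μ₁ := by
  have hfg := hT.flatGraph o
  have hmeas : Measurable Φ := by
    refine measurable_isom_iff.2 fun z A => ?_
    simp only [hΦ]
    exact measurableSet_isom_eval (K := Z₂.complex) (L := buildingComplex X) ⟨i z, hmaps z z.2⟩ (h ⁻¹' A)
  refine ⟨hmeas, IsEquidistributed.unique h𝒜 hX hT Z₁ ?_ hμ₁⟩
  intro F hFZ hfin hF p hp n hn f hf
  have hiF := hi.mono hFZ
  have hinj := hiF.injOn hfg hfg hF
  rw [Measure.map_apply hmeas (measurableSet_cyl Z₁ hfin f)]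
  have : Nonempty (WallTreeVertex T o) := ⟨p⟩
  -- The preimage of a cylinder over `F` is a cylinder over `i '' F`, which has the same extension
  -- number. The values of `g` off `i '' F` play no role.
  let g : WallTreeVertex T o → V := fun w => h.symm (f (Function.invFunOn i F w))
  have hg : ∀ z ∈ F, g (i z) = h.symm (f z) := fun z hz => by
    have : Function.invFunOn i F (i z) = z :=
      hinj (Function.invFunOn_mem ⟨z, hz, rfl⟩) hz (Function.invFunOn_eq ⟨z, hz, rfl⟩)
    simp only [g, this]
  have hpre : Φ ⁻¹' cyl X Z₁ F f = cyl X Z₂ (i '' F) g := by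
    ext β
    constructor
    · rintro hβ ⟨_, hz₂⟩ ⟨z, hz, rfl⟩
      have := hβ ⟨z, hFZ hz⟩ hz
      rw [hΦ] at this
      rw [hg z hz, ← this, RelIso.symm_apply_apply]
    · intro hβ z hz
      rw [hΦ, hβ ⟨i z, hmaps z z.2⟩ ⟨z, hz, rfl⟩, hg z hz, RelIso.apply_symm_apply]
  rw [hpre]
  have hloc : LocIsomOn (wallGraph T o) (skeleton X) g (i '' F) := by
    rw [← hiF.comp_iff hfg hfg hF le_rfl]
    have h1 : LocIsomOn (wallGraph T o) (skeleton X) (h.symm ∘ f) F :=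
      (hf.comp_iff hfg hX.flatGraph hF le_rfl _).2 ((locIsomOn_iso h.symm).mono (Set.subset_univ _))
    exact h1.congr fun z hz => (hg z hz).symm
  refine hμ₂ _ ?_ (hfin.image i) (hiF.gconvex_image hfg hfg hF) (i p) ⟨p, hp, rfl⟩ n ?_ g hloc
  · rintro _ ⟨z, hz, rfl⟩; exact hmaps z (hFZ hz)
  · have := hn.image hfg hfg hF hiF le_rfl
    rwa [Set.image_singleton] at this

end Existence

/-! ### Automorphisms and isometries as local isometries -/

section Automorphisms

lemma SimplicialAut.adj_iff {V : Type*} {K : AbstractSimplicialComplex V} (g : SimplicialAut K)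
    (a b : V) : (skeleton K).Adj (g.toEquiv a) (g.toEquiv b) ↔ (skeleton K).Adj a b := by
  constructor
  · rintro ⟨hne, s, hs, ha, hb⟩
    refine ⟨fun h => hne (by rw [h]), s.map g.toEquiv.symm.toEmbedding, ?_, ?_, ?_⟩
    · rw [← g.map_mem_iff, Finset.map_map]
      convert hs
      ext x; simp
    · simpa using ha
    · simpa using hb
  · rintro ⟨hne, s, hs, ha, hb⟩
    exact ⟨g.toEquiv.injective.ne hne, s.map g.toEquiv.toEmbedding, (g.map_mem_iff s).2 hs,
      by simpa using ha, by simpa using hb⟩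

/-- The action of an automorphism on the 1-skeleton. -/
def SimplicialAut.toIso {V : Type*} {K : AbstractSimplicialComplex V} (g : SimplicialAut K) :
    skeleton K ≃g skeleton K where
  toEquiv := g.toEquiv
  map_rel_iff' {a b} := g.adj_iff a b

variable {W : Type*} {T : SimpleGraph W} {o : W} {q : ℕ}

lemma ConvexSubset.adj_iff {Z : ConvexSubset T o} {a b : Z.verts} :
    (skeleton Z.complex.toAbstractSimplicialComplex).Adj a b ↔ (wallGraph T o).Adj a b := by
  classical
  constructor
  · rintro ⟨hne, s, hs, ha, hb⟩
    exact ((ConvexSubset.mem_faces.1 hs).2 a ha b hb).resolve_left hne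
  · intro h
    refine ⟨fun h' => h.ne (congrArg Subtype.val h'), {a, b}, ConvexSubset.mem_faces.2 ⟨by simp, ?_⟩,
      by simp, by simp⟩
    intro v hv w hw
    simp only [Finset.mem_insert, Finset.mem_singleton] at hv hw
    rcases hv with rfl | rfl <;> rcases hw with rfl | rfl <;> simp [h, h.symm]

/-- A bijection of a convex set that preserves adjacency in both directions is a local isometry. -/
lemma ConvexSubset.locIsomOn_equiv (Z : ConvexSubset T o) (e : Z.verts ≃ Z.verts)
    (he : ∀ a b : Z.verts, (wallGraph T o).Adj (e a) (e b) ↔ (wallGraph T o).Adj a b)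
    {i : WallTreeVertex T o → WallTreeVertex T o} (hi : ∀ z : Z.verts, i z = e z) :
    LocIsomOn (wallGraph T o) (wallGraph T o) i Z.verts := by
  have hadj : ∀ x (hx : x ∈ Z.verts) y (hy : y ∈ Z.verts),
      (wallGraph T o).Adj (i x) (i y) ↔ (wallGraph T o).Adj x y := fun x hx y hy => by
    rw [hi ⟨x, hx⟩, hi ⟨y, hy⟩, he]
  have hne : ∀ x (hx : x ∈ Z.verts) y (hy : y ∈ Z.verts), x ≠ y → i x ≠ i y := by
    intro x hx y hy hxy h
    rw [hi ⟨x, hx⟩, hi ⟨y, hy⟩] at h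
    exact hxy (congrArg Subtype.val (e.injective (Subtype.ext h)))
  refine ⟨fun x hx y hy => (hadj x hx y hy).2, ?_, ?_⟩
  · intro y hy c hc z hz h1 h2 ho
    have hnadj : ¬ (wallGraph T o).Adj (i c) (i z) := fun h => ho.2.1 ((hadj c hc z hz).1 h)
    refine (opp_or_isMid (hne c hc z hz ho.1) hnadj).resolve_right ?_
    rintro ⟨w, hw⟩
    -- Convexity of `Z` keeps a midpoint of the images inside `Z`, where it has a preimage under
    -- `e`.
    have hwZ : w ∈ Z.verts := Z.gconvex.mem_of_isMid (hi ⟨c, hc⟩ ▸ (e ⟨c, hc⟩).2)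
      (hi ⟨z, hz⟩ ▸ (e ⟨z, hz⟩).2) hw
    obtain ⟨⟨w', hw'⟩, hew⟩ := e.surjective ⟨w, hwZ⟩
    have hiw : i w' = w := by rw [hi ⟨w', hw'⟩, hew]
    rw [← hiw] at hw
    exact ho.2.2 w' ((hadj y hy w' hw').1 hw.2.2.1) ((hadj c hc w' hw').1 hw.2.2.2.1)
      ((hadj w' hw' z hz).1 hw.2.2.2.2)
  · rintro y hy c hc z hz h1 h2 ⟨w, hw⟩
    have hwZ := Z.gconvex.mem_of_isMid hc hz hw
    exact ⟨i w, hne c hc z hz hw.1, fun h => hw.2.1 ((hadj c hc z hz).1 h),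
      (hadj y hy w hwZ).2 hw.2.2.1, (hadj c hc w hwZ).2 hw.2.2.2.1, (hadj w hwZ z hz).2 hw.2.2.2.2⟩

lemma Isom.locIsomOn_convexSubset (hT : ThickTree T q) {Z₁ Z₂ : ConvexSubset T o}
    (i : Isom Z₁.complex Z₂.complex) {f : WallTreeVertex T o → WallTreeVertex T o}
    (hf : ∀ z : Z₁.verts, f z = i.toFun z) :
    LocIsomOn (wallGraph T o) (wallGraph T o) f Z₁.verts := by
  have hfg := hT.flatGraph o
  refine LocIsomOn.of_sqDist hfg hfg (fun x hx y hy D hD => ?_)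
  obtain ⟨D', hD'⟩ := hfg.exists_sqDist (f x) (f y)
  have h1 : (wallTree T o).dist (f x) (f y) = (wallTree T o).dist x y := by
    rw [hf ⟨x, hx⟩, hf ⟨y, hy⟩]
    exact i.dist_eq ⟨x, hx⟩ ⟨y, hy⟩
  rw [hT.dist_eq_sqrt hD', hT.dist_eq_sqrt hD, Real.sqrt_inj
    (by exact_mod_cast hT.sqDist_nonneg hD') (by exact_mod_cast hT.sqDist_nonneg hD)] at h1
  rw [← (by exact_mod_cast h1 : D' = D)]
  exact hD'

variable {V : Type*} {X : AbstractSimplicialComplex V} {𝒜 : Set (Set (Finset V))}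

lemma bijective_eval [Nonempty V] (h𝒜 : IsApartmentSystem X 𝒜) (hT : ThickTree T q)
    (Z : ConvexSubset T o) (p : Z.verts) (hZ : Z.verts = {p.1}) :
    Function.Bijective fun β : Isom Z.complex (buildingComplex X) => β.toFun p := by
  have hp : ∀ z : Z.verts, z = p := fun z => Subtype.ext (by
    have h : z.1 ∈ ({p.1} : Set (WallTreeVertex T o)) := hZ ▸ z.2
    exact h)
  constructor
  · intro β β' h
    refine Isom.ext (funext fun z => ?_)
    rw [hp z]; exact h
  · intro v
    have : LocIsomOn (wallGraph T o) (skeleton X) (fun _ => v) Z.verts := by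
      rw [hZ]; exact locIsomOn_singleton _ _
    exact ⟨this.toIsom h𝒜 hT Z, rfl⟩

/-- Over one vertex the extension number is 1 and cylinders are points; uniqueness then identifies
the measure of a vertex with counting measure. -/
lemma isEquidistributed_count [Nonempty V] (h𝒜 : IsApartmentSystem X 𝒜) (hT : ThickTree T q)
    (Z : ConvexSubset T o) (p : Z.verts) (hZ : Z.verts = {p.1}) :
    IsEquidistributed Z (Measure.count : Measure (Isom Z.complex (buildingComplex X))) := by
  intro F hFZ hfin hF p' hp' n hn f hf
  obtain rfl : p' = p.1 := by
    have h : p' ∈ ({p.1} : Set (WallTreeVertex T o)) := hZ ▸ hFZ hp'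
    exact h
  obtain rfl : F = {p.1} := by
    refine Set.Subset.antisymm (hZ ▸ hFZ) (Set.singleton_subset_iff.2 hp')
  rw [hn.unique (extNum_refl _)]
  obtain ⟨β, hβ⟩ := (bijective_eval h𝒜 hT Z p hZ).2 (f p)
  have hcyl : cyl X Z {p.1} f = {β} := by
    ext β'
    constructor
    · intro h
      exact (bijective_eval h𝒜 hT Z p hZ).1 ((h p rfl).trans hβ.symm)
    · rintro rfl z hz
      obtain rfl : z = p := Subtype.ext hz
      exact hβ
  have hm := measurableSet_cyl (X := X) Z hfin f
  rw [hcyl] at hm ⊢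
  rw [Measure.count_singleton' hm]
  simp

end Automorphisms

end A2Tilde

/-! ### The theorem, from existence, uniqueness and naturality of equidistributed measures -/

theorem mainTheorem5 {V : Type*} (X : AbstractSimplicialComplex V) (hX : A2Tilde.IsBuilding X)
    (q : ℕ) (hq : A2Tilde.HasThickness X q)
    {W : Type*} (T : SimpleGraph W) (hT : T.IsTree)
    (hreg : ∀ t : W, (T.neighborSet t).encard = q + 1) (o : W) :
    ∃ μ : ∀ Z : A2Tilde.ConvexSubset T o,
        MeasureTheory.Measure (A2Tilde.Isom Z.complex (A2Tilde.buildingComplex X)),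
      -- for a point, evaluation identifies `Isom(Z, X)` with the vertices of `X` and `μ` with the
      -- counting measure
      (∀ (Z : A2Tilde.ConvexSubset T o) (p : Z.verts), Z.verts = {p.1} →
        (Function.Bijective fun β : A2Tilde.Isom Z.complex (A2Tilde.buildingComplex X) =>
          β.toFun p) ∧
        μ Z = MeasureTheory.Measure.count) ∧
      -- restriction along simplicial isometries is measure-preserving
      (∀ (Z₁ Z₂ : A2Tilde.ConvexSubset T o) (i : A2Tilde.Isom Z₁.complex Z₂.complex),
        MeasureTheory.MeasurePreserving
          (fun β : A2Tilde.Isom Z₂.complex (A2Tilde.buildingComplex X) => β.comp i)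
          (μ Z₂) (μ Z₁)) ∧
      -- `Aut(Z) × Aut(X)` acts on `Isom(Z, X)` by `(g, h) • β = h ∘ β ∘ g⁻¹`, preserving `μ Z`
      (∀ (Z : A2Tilde.ConvexSubset T o)
        (g : A2Tilde.SimplicialAut Z.complex.toAbstractSimplicialComplex)
        (h : A2Tilde.SimplicialAut X),
        ∃ F : A2Tilde.Isom Z.complex (A2Tilde.buildingComplex X) →
            A2Tilde.Isom Z.complex (A2Tilde.buildingComplex X),
          (∀ β z, (F β).toFun z = h.toEquiv (β.toFun (g.toEquiv.symm z))) ∧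
          MeasureTheory.MeasurePreserving F (μ Z) (μ Z)) := by
  classical
  obtain ⟨𝒜, h𝒜⟩ := hX
  have hreg' := h𝒜.regular hq
  obtain ⟨-, e, he, hcard, -⟩ := hq
  have : Nontrivial V := by
    obtain ⟨x, y, hxy, -⟩ := Finset.card_eq_two.1 hcard
    exact ⟨x, y, hxy⟩
  have hTT : A2Tilde.ThickTree T q := ⟨hT, hreg'.two_le, hreg⟩
  choose μ hμ using fun Z : A2Tilde.ConvexSubset T o =>
    A2Tilde.exists_isEquidistributed h𝒜 hreg' hTT Z
  refine ⟨μ, fun Z p hZ => ⟨A2Tilde.bijective_eval h𝒜 hTT Z p hZ, ?_⟩, fun Z₁ Z₂ i => ?_,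
    fun Z g h => ?_⟩
  · exact (hμ Z).unique h𝒜 hreg' hTT Z (A2Tilde.isEquidistributed_count h𝒜 hTT Z p hZ)
  · let f : A2Tilde.WallTreeVertex T o → A2Tilde.WallTreeVertex T o := fun w =>
      if h : w ∈ Z₁.verts then i.toFun ⟨w, h⟩ else w
    have hf : ∀ z : Z₁.verts, f z = i.toFun z := fun z => by simp [f]
    refine (hμ Z₁).measurePreserving h𝒜 hreg' hTT (hμ Z₂) (i.locIsomOn_convexSubset hTT hf)
      (fun z hz => hf ⟨z, hz⟩ ▸ (i.toFun ⟨z, hz⟩).2) SimpleGraph.Iso.refl (fun β z => ?_)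
    exact congrArg β.toFun (Subtype.ext (hf z).symm)
  · let f : A2Tilde.WallTreeVertex T o → A2Tilde.WallTreeVertex T o := fun w =>
      if h : w ∈ Z.verts then g.toEquiv.symm ⟨w, h⟩ else w
    have hf : ∀ z : Z.verts, f z = g.toEquiv.symm z := fun z => by simp [f]
    have hloc := Z.locIsomOn_equiv g.toEquiv.symm (fun a b => by
      rw [← A2Tilde.ConvexSubset.adj_iff, ← g.adj_iff, Equiv.apply_symm_apply,
        Equiv.apply_symm_apply, A2Tilde.ConvexSubset.adj_iff]) hf
    have hmaps : ∀ z ∈ Z.verts, f z ∈ Z.verts := fun z hz =>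
      hf ⟨z, hz⟩ ▸ (g.toEquiv.symm ⟨z, hz⟩).2
    -- Automorphisms are not assumed to preserve distances, but they are local isometries, so the
    -- composite is again a simplicial isometry. The values off `Z` are arbitrary.
    have hΦ : ∀ β : A2Tilde.Isom Z.complex (A2Tilde.buildingComplex X), A2Tilde.LocIsomOn
        (A2Tilde.wallGraph T o) (A2Tilde.skeleton X) (fun w => if hw : w ∈ Z.verts then
          h.toIso (β.toFun ⟨f w, hmaps w hw⟩) else h.toIso (Classical.arbitrary V)) Z.verts := by
      intro β
      let b : A2Tilde.WallTreeVertex T o → V := fun w =>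
        if hw : w ∈ Z.verts then β.toFun ⟨w, hw⟩ else Classical.arbitrary V
      have hb := β.locIsomOn h𝒜 hTT (f := b) (fun z => by simp [b])
      have hfg := hTT.flatGraph o
      have h1 : A2Tilde.LocIsomOn (A2Tilde.wallGraph T o) (A2Tilde.skeleton X) (b ∘ f) Z.verts :=
        (hloc.comp_iff hfg hfg Z.gconvex le_rfl b).2
          (hb.mono (by rintro _ ⟨z, hz, rfl⟩; exact hmaps z hz))
      refine ((h1.comp_iff hfg hreg'.flatGraph Z.gconvex le_rfl h.toIso).2
        ((A2Tilde.locIsomOn_iso h.toIso).mono (Set.subset_univ _))).congr (fun w hw => ?_)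
      simp [b, hw, hmaps w hw]
    refine ⟨fun β => (hΦ β).toIsom h𝒜 hTT Z, fun β z => ?_,
      (hμ Z).measurePreserving h𝒜 hreg' hTT (hμ Z) hloc hmaps h.toIso (fun β z => ?_)⟩
    · rw [A2Tilde.LocIsomOn.toIsom_toFun]
      simp only [z.2, dif_pos]
      exact congrArg h.toEquiv (congrArg β.toFun (Subtype.ext (hf z)))
    · rw [A2Tilde.LocIsomOn.toIsom_toFun]
      simp only [z.2, dif_pos]
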